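/- Let $X_1,X_2,\dots$ be real random variables on a probability space and $S_N=\sum_{n=1}^N X_n$. Suppose there are a complex Banach space $\mathcal B$, bounded linear operators $\mathcal L_t:\mathcal B\to\mathcal B$ ($t\in\mathbb R$), $v\in\mathcal B$ and $\ell\in\mathcal B'$ such that $$\mathbb E\left(e^{itS_N}\right)=\ell(\mathcal L_t^N v)\qquad (t\in\mathbb R,\ N\ge 1).$$ Let $r\ge 2$ be an integer and assume: (A1) $t\mapsto\mathcal L_t$ is continuous in operator norm, and for some $\delta>0$ it is $r+2$ times continuously differentiable on $|t|\le\delta$. (A2) $1$ is an isolated and (algebraically) simple eigenvalue of $\mathcal L_0$, all other eigenvalues of $\mathcal L_0$ have absolute value less than $1$, and the essential spectrum of $\mathcal L_0$ (the points of the spectrum that are not isolated eigenvalues of finite algebraic multiplicity) is contained in $\{|z|<1\}$. (A3) For all $t\ne 0$ the spectrum of $\mathcal L_t$ is contained in $\{|z|<1\}$. (A4) There are positive real numbers $K,r_1,r_2,N_0$ with $r_1>\frac{r-1}{2}$ such that $\|\mathcal L_t^N\|\le N^{-r_2}$ for all integers $N>N_0$ and all $t$ with $K\le|t|\le N^{r_1}$.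 Then there are $A\in\mathbb R$ and $\sigma^2\ge 0$ such that $(S_N-NA)/\sqrt N$ converges in distribution to $\mathcal N(0,\sigma^2)$ (the point mass at $0$ if $\sigma^2=0$). If $\sigma^2>0$, then $S_N$ admits the Edgeworth expansion of order $r$: there are polynomials $P_1,\dots,P_r$ with real coefficients such that, uniformly in $z\in\mathbb R$ as $N\to\infty$, $$\mathbb P\left(\frac{S_N-NA}{\sqrt N}\le z\right)-\mathfrak N(z)=\sum_{p=1}^r\frac{P_p(z)}{N^{p/2}}\,\mathfrak n(z)+o\left(N^{-r/2}\right),$$ where $\mathfrak n(y)=\frac{1}{\sqrt{2\pi\sigma^2}}e^{-y^2/(2\sigma^2)}$ and $\mathfrak N(z)=\int_{-\infty}^z\mathfrak n(y)\,dy$. -/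

import Mathlib

open MeasureTheory ProbabilityTheory Filter Topology

noncomputable section

namespace Edgeworth

section SpectralTheory

variable {E : Type*} [NormedAddCommGroup E] [NormedSpace ℂ E]

/-- `lam` is an isolated point of the spectrum of `T`. -/
def IsIsolatedSpectralPoint (T : E →L[ℂ] E) (lam : ℂ) : Prop :=
  ∃ ε : ℝ, 0 < ε ∧ Metric.ball lam ε ∩ spectrum ℂ T = {lam}

/-- `P` is the spectral (Riesz) projection of `T` at `lam`: a bounded projection commuting with `T`
such that the restriction of `T` to the closed subspace `range P` has no spectrum other than `lam`,
and the restriction of `T` to the closed subspace `ker P` does not have `lam` in its spectrum.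
(Bijectivity on a closed subspace is invertibility there, by the open mapping theorem.) -/
structure IsSpectralProjection (T : E →L[ℂ] E) (lam : ℂ) (P : E →L[ℂ] E) : Prop where
  idem : P * P = P
  comm : P * T = T * P
  on_range : ∀ z : ℂ, z ≠ lam →
    Set.BijOn (fun x : E => T x - z • x) {x | P x = x} {x | P x = x}
  on_ker : Set.BijOn (fun x : E => T x - lam • x) {x | P x = 0} {x | P x = 0}

/-- `lam` is an isolated eigenvalue of `T` of finite algebraic multiplicity: an isolated point of
the spectrum whose spectral projection has finite rank. -/
def IsDiscreteEigenvalue (T : E →L[ℂ] E) (lam : ℂ) : Prop :=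
  IsIsolatedSpectralPoint T lam ∧
    ∃ P : E →L[ℂ] E, IsSpectralProjection T lam P ∧
      FiniteDimensional ℂ (LinearMap.range (P : E →ₗ[ℂ] E))

/-- The essential spectrum: the points of the spectrum which are not isolated eigenvalues of finite
algebraic multiplicity. -/
def essentialSpectrum (T : E →L[ℂ] E) : Set ℂ :=
  {lam | lam ∈ spectrum ℂ T ∧ ¬ IsDiscreteEigenvalue T lam}

/-- `lam` is an isolated and (algebraically) simple eigenvalue of `T`: an eigenvalue, isolated in
the spectrum, whose spectral projection has rank one. -/
def IsIsolatedSimpleEigenvalue (T : E →L[ℂ] E) (lam : ℂ) : Prop :=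
  Module.End.HasEigenvalue (T : E →ₗ[ℂ] E) lam ∧
    IsIsolatedSpectralPoint T lam ∧
    ∃ P : E →L[ℂ] E, IsSpectralProjection T lam P ∧
      Module.finrank ℂ (LinearMap.range (P : E →ₗ[ℂ] E)) = 1

/-- (A1): `t ↦ L t` is continuous for the operator norm, and `s` times continuously differentiable
on some interval `|t| ≤ δ`. -/
def AssumptionA1 (L : ℝ → E →L[ℂ] E) (s : ℕ) : Prop :=
  Continuous L ∧ ∃ δ : ℝ, 0 < δ ∧ ContDiffOn ℝ s L {t | |t| ≤ δ}

/-- (A2): `1` is an isolated and simple eigenvalue of `L 0`, all other eigenvalues have absolute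
value less than `1`, and the essential spectrum lies strictly inside the unit disk. -/
def AssumptionA2 (L : ℝ → E →L[ℂ] E) : Prop :=
  IsIsolatedSimpleEigenvalue (L 0) 1 ∧
    (∀ z : ℂ, Module.End.HasEigenvalue (L 0 : E →ₗ[ℂ] E) z → z ≠ 1 → ‖z‖ < 1) ∧
    essentialSpectrum (L 0) ⊆ Metric.ball 0 1

/-- (A3): for `t ≠ 0` the spectrum of `L t` lies in the open unit disk. -/
def AssumptionA3 (L : ℝ → E →L[ℂ] E) : Prop :=
  ∀ t : ℝ, t ≠ 0 → spectrum ℂ (L t) ⊆ {z | ‖z‖ < 1}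

/-- (A4) with exponent `r₁`: there are `K, r₂, N₀ > 0` with `‖L t ^ N‖ ≤ N ^ (-r₂)` whenever
`K ≤ |t| ≤ N ^ r₁` and `N > N₀`. -/
def AssumptionA4 (L : ℝ → E →L[ℂ] E) (r₁ : ℝ) : Prop :=
  0 < r₁ ∧ ∃ K r₂ N₀ : ℝ, 0 < K ∧ 0 < r₂ ∧ 0 < N₀ ∧
    ∀ (N : ℕ) (t : ℝ), N₀ < N → K ≤ |t| → |t| ≤ (N : ℝ) ^ r₁ →
      ‖L t ^ N‖ ≤ 1 / (N : ℝ) ^ r₂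

end SpectralTheory

section Probability

variable {Ω : Type*} [MeasurableSpace Ω]

/-- `S_N = X_1 + ⋯ + X_N`. -/
def partialSum (X : ℕ → Ω → ℝ) (N : ℕ) (ω : Ω) : ℝ :=
  ∑ n ∈ Finset.Icc 1 N, X n ω

/-- `(S_N - N A) / √N`. -/
def normalizedSum (X : ℕ → Ω → ℝ) (A : ℝ) (N : ℕ) (ω : Ω) : ℝ :=
  (partialSum X N ω - N * A) / √(N : ℝ)

/-- `S_N` admits the Edgeworth expansion of order `r`, with centering `A` and variance `v = σ²`:
there are real polynomials `Q 1, …, Q r` such that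
`ℙ((S_N - N A)/√N ≤ z) - 𝔑(z) = ∑_{p=1}^r Q_p(z) N^(-p/2) 𝔫(z) + o(N^(-r/2))` uniformly in `z`,
where `𝔫` is the density of the centered normal law of variance `v`. -/
def AdmitsEdgeworthExpansion (μ : Measure Ω) (X : ℕ → Ω → ℝ) (A : ℝ) (v : NNReal) (r : ℕ) : Prop :=
  ∃ Q : ℕ → Polynomial ℝ, ∀ ε : ℝ, 0 < ε → ∀ᶠ N : ℕ in atTop, ∀ z : ℝ,
    |μ.real {ω | normalizedSum X A N ω ≤ z}
        - (∫ y in Set.Iic z, gaussianPDFReal 0 v y)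
        - ∑ p ∈ Finset.Icc 1 r, (Q p).eval z / (N : ℝ) ^ ((p : ℝ) / 2) * gaussianPDFReal 0 v z|
      ≤ ε * (N : ℝ) ^ (-(r : ℝ) / 2)

end Probability

end Edgeworth

end

namespace Edgeworth

/-! The argument compares characteristic functions, with perturbation theory of the eigenvalue `1`
describing them near the origin. The operator `L 0` minus its rank-one spectral projection has
spectrum inside the open unit disk, and this persists, with uniform decay of powers, under small
perturbations. Hence for small `s` one has `l (L s ^ N v) = λ(s) ^ N w(s) + O(ρ ^ N)` with `ρ < 1`
and `λ`, `w` of class `C^(r+2)` at `0` (`exists_spectral_expansion`).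

The left side is a characteristic function. This forces `w(0) = 1`, `λ(-s) = conj λ(s)` and `|λ(s)|
≤ 1`, so that `log λ(s) = i A s - c s² + s² χ(s)` with `A` real, `c ≥ 0`, and `χ` equal up to
`o(s^r)` to a real polynomial in `i s` without constant term (`exists_cumulant_expansion`). With `s
= t / √N` the factor `N s²` becomes `t²`; the centred characteristic function tends to `exp (-c
t²)`, and Lévy's theorem gives the limit law with `σ² = 2c`.

If `c > 0`, then `exp (t² χ(s)) w(s)` is expanded in powers of `s`. The coefficient of `N ^ (-p/2)`
is a polynomial in `i t`; times the Gaussian it is the Fourier transform of the derivative of a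
polynomial times `𝔫`. Esseen's inequality (`exists_esseen_bound`) reduces the uniform estimate to
the integral over `0 < t ≤ T` of the difference of Fourier transforms divided by `t`, plus `m / T`.
Taking `T = B N ^ (r/2)` with `B` large makes the last term a small multiple of `N ^ (-r/2)`. The
frequencies `s = t / √N` then reach only `B N ^ ((r-1)/2)`, which is eventually below `N ^ r₁`.
Small `s` are covered by the expansion, intermediate `s` by (A3) and compactness, and large `s` by
(A4), whose possibly weak rate is amplified by cutting the power `N` into many blocks
(`exists_fourier_bound`). -/

/-! ### A nonnegative smoothing kernel with band-limited Fourier transform -/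

/-- The kernel `u ↦ 2 ∫₀¹ (1 - t) cos (t u) dt = 2 (1 - cos u) / u²`, whose Fourier transform is
supported in `[-1, 1]`. -/
noncomputable def smoothingKernel (u : ℝ) : ℝ := ∫ t in (0 : ℝ)..1, 2 * (1 - t) * Real.cos (t * u)

/-- Two integrations by parts give the closed form, from which positivity and quadratic decay are
read off without dividing at `u = 0`. -/
lemma sq_mul_smoothingKernel (u : ℝ) : u ^ 2 * smoothingKernel u = 2 * (1 - Real.cos u) := by
  rw [smoothingKernel, ← intervalIntegral.integral_const_mul]
  have h : ∀ t ∈ Set.uIcc (0 : ℝ) 1,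
      HasDerivAt (fun t : ℝ => 2 * (1 - t) * u * Real.sin (t * u) - 2 * Real.cos (t * u))
        (u ^ 2 * (2 * (1 - t) * Real.cos (t * u))) t := by
    intro t _
    have h1 : HasDerivAt (fun t : ℝ => t * u) u t := by
      simpa using (hasDerivAt_id t).mul_const u
    have h2 : HasDerivAt (fun t : ℝ => 2 * (1 - t) * u) (-2 * u) t := by
      have := (((hasDerivAt_id t).const_sub 1).const_mul 2).mul_const u
      simpa using this
    refine ((h2.mul h1.sin).sub (h1.cos.const_mul 2)).congr_deriv ?_
    ring
  rw [intervalIntegral.integral_eq_sub_of_hasDerivAt h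
    (by apply Continuous.intervalIntegrable; fun_prop)]
  simp
  ring

lemma continuous_smoothingKernel : Continuous smoothingKernel := by
  unfold smoothingKernel
  apply intervalIntegral.continuous_parametric_intervalIntegral_of_continuous' (by fun_prop)

lemma smoothingKernel_zero : smoothingKernel 0 = 1 := by
  simp only [smoothingKernel, mul_zero, Real.cos_zero, mul_one]
  rw [intervalIntegral.integral_const_mul, intervalIntegral.integral_sub (by simp) (by simp)]
  simp
  norm_num

lemma smoothingKernel_nonneg (u : ℝ) : 0 ≤ smoothingKernel u := by
  rcases eq_or_ne u 0 with rfl | hu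
  · rw [smoothingKernel_zero]; norm_num
  · have h1 := sq_mul_smoothingKernel u
    have h2 : 0 < u ^ 2 := by positivity
    nlinarith [Real.cos_le_one u]

lemma smoothingKernel_le_two (u : ℝ) : smoothingKernel u ≤ 2 := by
  refine (le_abs_self _).trans ?_
  rw [← Real.norm_eq_abs, smoothingKernel]
  have := intervalIntegral.norm_integral_le_of_norm_le_const (a := 0) (b := 1) (C := 2)
    (f := fun t : ℝ => 2 * (1 - t) * Real.cos (t * u)) ?_
  · simpa using this
  · intro t ht
    rw [Set.uIoc_of_le zero_le_one] at ht
    rw [norm_mul, Real.norm_eq_abs, Real.norm_eq_abs, abs_of_nonneg (by linarith [ht.2])]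
    have := Real.abs_cos_le_one (t * u)
    nlinarith [ht.1, ht.2, abs_nonneg (Real.cos (t * u))]

lemma smoothingKernel_le (u : ℝ) : smoothingKernel u ≤ 6 * (1 + u ^ 2)⁻¹ := by
  have h1 := sq_mul_smoothingKernel u
  have h2 := smoothingKernel_le_two u
  have h3 : 0 < 1 + u ^ 2 := by positivity
  rw [← div_eq_mul_inv, le_div_iff₀ h3]
  -- The `6` is `2 + 4`: the kernel is at most `2`, and `u ^ 2` times it is at most `4`.
  nlinarith [Real.neg_one_le_cos u]

lemma integrable_smoothingKernel : Integrable smoothingKernel := by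
  refine (integrable_inv_one_add_sq.const_mul 6).mono'
    continuous_smoothingKernel.aestronglyMeasurable (ae_of_all _ fun u => ?_)
  rw [Real.norm_eq_abs, abs_of_nonneg (smoothingKernel_nonneg u)]
  exact smoothingKernel_le u

lemma integral_smoothingKernel_pos : 0 < ∫ u, smoothingKernel u := by
  rw [integral_pos_iff_support_of_nonneg smoothingKernel_nonneg integrable_smoothingKernel]
  refine (continuous_smoothingKernel.isOpen_support).measure_pos _ ⟨0, ?_⟩
  simp [smoothingKernel_zero]

/-- The kernel rescaled so that its Fourier transform is supported in `[-T, T]`. -/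
noncomputable def scaledKernel (T u : ℝ) : ℝ := T * smoothingKernel (T * u)

lemma scaledKernel_eq {T : ℝ} (hT : 0 < T) (u : ℝ) :
    scaledKernel T u = ∫ t in (0 : ℝ)..T, 2 * (1 - t / T) * Real.cos (t * u) := by
  have := intervalIntegral.smul_integral_comp_mul_left (a := 0) (b := 1)
    (fun t : ℝ => 2 * (1 - t / T) * Real.cos (t * u)) T
  simp only [mul_zero, mul_one, smul_eq_mul] at this
  rw [← this, scaledKernel, smoothingKernel]
  congr 1
  refine intervalIntegral.integral_congr fun t _ => ?_
  rw [mul_div_cancel_left₀ _ hT.ne', show T * t * u = t * (T * u) by ring]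

lemma scaledKernel_nonneg {T : ℝ} (hT : 0 < T) (u : ℝ) : 0 ≤ scaledKernel T u :=
  mul_nonneg hT.le (smoothingKernel_nonneg _)

lemma integrable_scaledKernel {T : ℝ} (hT : 0 < T) : Integrable (scaledKernel T) :=
  ((integrable_smoothingKernel.comp_mul_left' hT.ne').const_mul T)

lemma integral_scaledKernel {T : ℝ} (hT : 0 < T) :
    ∫ u, scaledKernel T u = ∫ u, smoothingKernel u := by
  simp only [scaledKernel]
  rw [integral_const_mul, Measure.integral_comp_mul_left, abs_of_pos (by positivity), smul_eq_mul,
    ← mul_assoc, mul_inv_cancel₀ hT.ne', one_mul]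

lemma exists_tail_smoothingKernel_le {ε : ℝ} (hε : 0 < ε) :
    ∃ a : ℝ, 0 < a ∧ ∫ u, (Set.Icc (-a) a)ᶜ.indicator smoothingKernel u ≤ ε := by
  have h : Tendsto (fun n : ℕ => ∫ u, (Set.Icc (-(n : ℝ)) n)ᶜ.indicator smoothingKernel u) atTop
      (𝓝 (∫ _ : ℝ, (0 : ℝ))) := by
    refine tendsto_integral_of_dominated_convergence smoothingKernel
      (fun n => (integrable_smoothingKernel.indicator
        measurableSet_Icc.compl).aestronglyMeasurable) integrable_smoothingKernel
      (fun n => ae_of_all _ fun u => ?_) (ae_of_all _ fun u => ?_)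
    · refine (norm_indicator_le_norm_self _ _).trans ?_
      rw [Real.norm_eq_abs, abs_of_nonneg (smoothingKernel_nonneg u)]
    · refine tendsto_const_nhds.congr' ?_
      filter_upwards [eventually_ge_atTop ⌈|u|⌉₊] with n hn
      rw [Set.indicator_of_notMem]
      have : |u| ≤ n := (Nat.le_ceil _).trans (by exact_mod_cast hn)
      simpa using abs_le.mp this
  rw [integral_zero] at h
  obtain ⟨n, hn, hn'⟩ := ((h.eventually_le_const hε).and (eventually_gt_atTop 0)).exists
  exact ⟨n, by exact_mod_cast hn', hn⟩

/-- The scaled kernel concentrates on a window of width of order `1 / T`; this is the source of the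
term `m / T` in the smoothing inequality. -/
lemma integral_tail_scaledKernel {T : ℝ} (hT : 0 < T) (a : ℝ) :
    ∫ u, (Set.Icc (-(a / T)) (a / T))ᶜ.indicator (scaledKernel T) u =
      ∫ u, (Set.Icc (-a) a)ᶜ.indicator smoothingKernel u := by
  have : ∀ u, (Set.Icc (-(a / T)) (a / T))ᶜ.indicator (scaledKernel T) u =
      T * (Set.Icc (-a) a)ᶜ.indicator smoothingKernel (T * u) := by
    intro u
    have hmem : u ∈ (Set.Icc (-(a / T)) (a / T))ᶜ ↔ T * u ∈ (Set.Icc (-a) a)ᶜ := by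
      simp only [Set.mem_compl_iff, Set.mem_Icc, not_iff_not, ← neg_div]
      rw [div_le_iff₀ hT, le_div_iff₀ hT, mul_comm]
    by_cases hu : T * u ∈ (Set.Icc (-a) a)ᶜ
    · rw [Set.indicator_of_mem hu, Set.indicator_of_mem (hmem.mpr hu)]
      rfl
    · rw [Set.indicator_of_notMem hu, Set.indicator_of_notMem (mt hmem.mp hu), mul_zero]
  simp only [this]
  rw [integral_const_mul, Measure.integral_comp_mul_left, abs_of_pos (by positivity), smul_eq_mul,
    ← mul_assoc, mul_inv_cancel₀ hT.ne', one_mul]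

/-- A function that is bounded, decreases at most linearly, and has a small convolution with the
kernel is small. -/
lemma exists_bound_of_convolution_le : ∃ C : ℝ, 0 < C ∧ ∀ (D : ℝ → ℝ) (m η T : ℝ), 0 < T →
    0 ≤ m → Measurable D → (∃ M, ∀ x, |D x| ≤ M) →
    (∀ x y, x ≤ y → D x - m * (y - x) ≤ D y) →
    (∀ x, |∫ y, scaledKernel T y * D (x - y)| ≤ η) →
    ∀ x, |D x| ≤ C * (η + m / T) := by
  -- With tail mass at most `c / 8`, the tail contributes at most `2 M c / 8 = c M / 4`, small
  -- enough to be absorbed into the supremum `M`.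
  obtain ⟨a, ha, hτ⟩ := exists_tail_smoothingKernel_le
    (show 0 < (∫ u, smoothingKernel u) / 8 by linarith [integral_smoothingKernel_pos])
  set c := ∫ u, smoothingKernel u with hc
  have hcpos : 0 < c := integral_smoothingKernel_pos
  -- The factor `4 / 3` solves `M ≤ η / c + 2 b m + M / 4` for `M`.
  refine ⟨(4 / 3) * (c⁻¹ + 2 * a), by positivity, ?_⟩
  intro D m η T hT hm hD hbdd hlip hconv
  obtain ⟨M₀, hM₀⟩ := hbdd
  have hB : BddAbove (Set.range fun x => |D x|) := ⟨M₀, by rintro _ ⟨x, rfl⟩; exact hM₀ x⟩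
  set M := ⨆ x, |D x| with hM
  have hle : ∀ x, |D x| ≤ M := fun x => le_ciSup hB x
  have hM0 : 0 ≤ M := (abs_nonneg _).trans (hle 0)
  set b := a / T with hb
  have hb0 : 0 < b := by positivity
  set τ := ∫ u, (Set.Icc (-b) b)ᶜ.indicator (scaledKernel T) u with hτdef
  have hτ' : τ ≤ c / 8 := by rw [hτdef, hb, integral_tail_scaledKernel hT]; exact hτ
  have hKi := integrable_scaledKernel hT
  have hint : ∀ x, Integrable fun y => scaledKernel T y * D (x - y) := fun x =>
    hKi.mul_bdd (c := M) (hD.comp (by fun_prop)).aestronglyMeasurable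
      (ae_of_all _ fun y => hle _)
  have hmin : ∀ d, Integrable fun y => scaledKernel T y * d -
      2 * M * (Set.Icc (-b) b)ᶜ.indicator (scaledKernel T) y := fun d =>
    (hKi.mul_const d).sub ((hKi.indicator measurableSet_Icc.compl).const_mul _)
  have hminval : ∀ d, ∫ y, (scaledKernel T y * d -
      2 * M * (Set.Icc (-b) b)ᶜ.indicator (scaledKernel T) y) = c * d - 2 * M * τ := fun d => by
    rw [integral_sub (hKi.mul_const d) ((hKi.indicator measurableSet_Icc.compl).const_mul _),
      integral_mul_const, integral_const_mul, integral_scaledKernel hT]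
  -- If `± D` is at least `d` on the window, it is at least `-M ≥ d - 2 M` off it; integrating this
  -- lower bound against the kernel gives the inequality.
  have key : ∀ x d s : ℝ, d ≤ M → (s = 1 ∨ s = -1) →
      (∀ y ∈ Set.Icc (-b) b, d ≤ s * D (x - y)) → c * d - 2 * M * τ ≤ η := by
    intro x d s hd hs h
    have h1 : s * ∫ y, scaledKernel T y * D (x - y) ≤ η := by
      rcases hs with rfl | rfl
      · rw [one_mul]; exact (le_abs_self _).trans (hconv x)
      · rw [neg_one_mul]; exact (neg_le_abs _).trans (hconv x)
    refine le_trans ?_ h1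
    rw [← hminval, ← integral_const_mul]
    refine integral_mono (hmin d) ((hint x).const_mul s) fun y => ?_
    simp only
    have hk := scaledKernel_nonneg hT y
    by_cases hy : y ∈ Set.Icc (-b) b
    · rw [Set.indicator_of_notMem (by simpa using hy)]
      nlinarith [mul_le_mul_of_nonneg_left (h y hy) hk]
    · rw [Set.indicator_of_mem hy]
      have h2 : -M ≤ s * D (x - y) := by
        have := abs_le.mp (hle (x - y))
        rcases hs with rfl | rfl <;> linarith
      have : d - 2 * M ≤ s * D (x - y) := by linarith
      nlinarith [mul_le_mul_of_nonneg_left this hk]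
  have hbound : ∀ x, |D x| ≤ η * c⁻¹ + 2 * b * m + M / 4 := by
    intro x
    have fin : ∀ d : ℝ, c * (d - m * (2 * b)) - 2 * M * τ ≤ η →
        d ≤ η * c⁻¹ + 2 * b * m + M / 4 := by
      intro d hd
      have h3 : c * (d - m * (2 * b)) ≤ η + M * c / 4 := by nlinarith
      have h4 : d - m * (2 * b) ≤ (η + M * c / 4) / c := by
        rw [le_div_iff₀ hcpos]; linarith
      have h5 : (η + M * c / 4) / c = η * c⁻¹ + M / 4 := by field_simp
      linarith
    rw [abs_le']
    have hmb : 0 ≤ m * (2 * b) := by positivity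
    have hx := abs_le'.mp (hle x)
    constructor
    -- The window is centred at `x + b` so that all its points lie in `[x, x + 2 b]`, where the
    -- one-sided bound keeps `D` above `D x - 2 b m`. For `-D` the centre is `x - b`.
    · refine fin _ (key (x + b) _ 1 (by linarith) (Or.inl rfl) fun y hy => ?_)
      have := hlip x (x + b - y) (by linarith [hy.2])
      have h6 : m * (x + b - y - x) ≤ m * (2 * b) :=
        mul_le_mul_of_nonneg_left (by linarith [hy.1]) hm
      linarith
    · refine fin _ (key (x - b) _ (-1) (by linarith) (Or.inr rfl) fun y hy => ?_)
      have := hlip (x - b - y) x (by linarith [hy.1])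
      have h6 : m * (x - (x - b - y)) ≤ m * (2 * b) :=
        mul_le_mul_of_nonneg_left (by linarith [hy.2]) hm
      linarith
  have hMle : M ≤ η * c⁻¹ + 2 * b * m + M / 4 := ciSup_le hbound
  intro x
  have h7 : η * c⁻¹ + 2 * b * m ≤ (c⁻¹ + 2 * a) * (η + m / T) := by
    have h8 : 2 * b * m = 2 * a * (m / T) := by rw [hb]; ring
    have h9 : 0 ≤ η := (abs_nonneg _).trans (hconv 0)
    have h10 : 0 ≤ c⁻¹ * (m / T) := by positivity
    nlinarith [mul_nonneg (mul_nonneg zero_le_two ha.le) h9]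
  have := hle x
  linarith

/-! ### Fourier inversion and Esseen's inequality -/

lemma abs_sin_sub_sin_div_le (t a b : ℝ) :
    |(Real.sin (t * b) - Real.sin (t * a)) / t| ≤ |b - a| := by
  rcases eq_or_ne t 0 with rfl | ht
  · simp
  · rw [abs_div, div_le_iff₀ (abs_pos.mpr ht)]
    refine (Real.abs_sin_sub_sin_le _ _).trans ?_
    rw [← mul_sub, abs_mul, mul_comm]

lemma intervalIntegral_scaledKernel {T : ℝ} (hT : 0 < T) {a b : ℝ} (hab : a ≤ b) :
    ∫ y in a..b, scaledKernel T y =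
      ∫ t in (0 : ℝ)..T, 2 * (1 - t / T) * ((Real.sin (t * b) - Real.sin (t * a)) / t) := by
  simp only [scaledKernel_eq hT]
  rw [intervalIntegral.integral_of_le hab]
  simp only [intervalIntegral.integral_of_le hT.le]
  rw [integral_integral_swap]
  · refine setIntegral_congr_fun measurableSet_Ioc fun t ht => ?_
    rw [integral_const_mul, ← intervalIntegral.integral_of_le hab]
    congr 1
    rw [intervalIntegral.integral_comp_mul_left (fun y => Real.cos y) ht.1.ne', integral_cos]
    simp [div_eq_inv_mul]
  · rw [Measure.prod_restrict]
    change IntegrableOn _ _ _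
    refine IntegrableOn.mono_set ?_ (Set.prod_mono Set.Ioc_subset_Icc_self Set.Ioc_subset_Icc_self)
    apply ContinuousOn.integrableOn_compact (isCompact_Icc.prod isCompact_Icc)
    unfold Function.uncurry
    fun_prop

/-- Fubini, applied twice. Working with the increment between `x'` and `x` replaces a half-line by a
bounded interval, so the quotient by `t` stays bounded near `t = 0`; a single distribution function
would leave a `1 / t` singularity. -/
lemma integral_scaledKernel_mul_sub {μ : Measure ℝ} [SFinite μ] {w : ℝ → ℝ} (hw : Integrable w μ)
    {T : ℝ} (hT : 0 < T) {x' x : ℝ} (hx : x' ≤ x) :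
    ∫ y, scaledKernel T y *
        ((∫ u in Set.Iic (x - y), w u ∂μ) - ∫ u in Set.Iic (x' - y), w u ∂μ) =
      ∫ t in (0 : ℝ)..T, 2 * (1 - t / T) *
        ∫ u, w u * ((Real.sin (t * (x - u)) - Real.sin (t * (x' - u))) / t) ∂μ := by
  have hK := integrable_scaledKernel hT
  have hind : ∀ y u : ℝ, u + y ∈ Set.Ioc x' x ↔ u ∈ Set.Ioc (x' - y) (x - y) := by
    intro y u; simp only [Set.mem_Ioc]; constructor <;> rintro ⟨h1, h2⟩ <;> constructor <;> linarith
  have hind' : ∀ y u : ℝ, u + y ∈ Set.Ioc x' x ↔ y ∈ Set.Ioc (x' - u) (x - u) := by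
    intro y u; simp only [Set.mem_Ioc]; constructor <;> rintro ⟨h1, h2⟩ <;> constructor <;> linarith
  have h1 : ∀ y, scaledKernel T y *
      ((∫ u in Set.Iic (x - y), w u ∂μ) - ∫ u in Set.Iic (x' - y), w u ∂μ) =
      ∫ u, scaledKernel T y * w u * (Set.Ioc x' x).indicator 1 (u + y) ∂μ := by
    intro y
    rw [intervalIntegral.integral_Iic_sub_Iic hw.integrableOn hw.integrableOn,
      intervalIntegral.integral_of_le (by linarith), ← integral_indicator measurableSet_Ioc,
      ← integral_const_mul]
    congr 1 with u
    by_cases hu : u + y ∈ Set.Ioc x' x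
    · rw [Set.indicator_of_mem hu, Set.indicator_of_mem ((hind y u).mp hu)]; simp
    · rw [Set.indicator_of_notMem hu, Set.indicator_of_notMem (mt (hind y u).mpr hu)]; simp
  simp only [h1]
  rw [integral_integral_swap]
  swap
  · refine (hK.mul_prod hw).mul_bdd (c := 1) ?_ (ae_of_all _ fun z => ?_)
    · exact ((measurable_one.indicator measurableSet_Ioc).comp
        (measurable_snd.add measurable_fst)).aestronglyMeasurable
    · refine (norm_indicator_le_norm_self _ _).trans ?_
      simp
  have h2 : ∀ u, ∫ y, scaledKernel T y * w u * (Set.Ioc x' x).indicator 1 (u + y) =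
      ∫ t in Set.Ioc 0 T, w u *
        (2 * (1 - t / T) * ((Real.sin (t * (x - u)) - Real.sin (t * (x' - u))) / t)) := by
    intro u
    rw [integral_const_mul, ← intervalIntegral.integral_of_le hT.le,
      ← intervalIntegral_scaledKernel hT (by linarith),
      intervalIntegral.integral_of_le (by linarith), ← integral_indicator measurableSet_Ioc,
      ← integral_const_mul]
    congr 1 with y
    by_cases hu : u + y ∈ Set.Ioc x' x
    · rw [Set.indicator_of_mem hu, Set.indicator_of_mem ((hind' y u).mp hu)]; simp [mul_comm]
    · rw [Set.indicator_of_notMem hu, Set.indicator_of_notMem (mt (hind' y u).mpr hu)]; simp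
  simp only [h2]
  rw [integral_integral_swap, intervalIntegral.integral_of_le hT.le]
  · refine setIntegral_congr_fun measurableSet_Ioc fun t ht => ?_
    rw [← integral_const_mul]
    congr 1 with u
    ring
  · have h3 : Integrable (fun t : ℝ => 2 * (1 - t / T)) (volume.restrict (Set.Ioc 0 T)) :=
      (Continuous.integrableOn_Icc (by fun_prop)).mono_set Set.Ioc_subset_Icc_self
    have h4 := (hw.mul_prod h3).mul_bdd (c := |x - x'|)
      (g := fun z : ℝ × ℝ => (Real.sin (z.2 * (x - z.1)) - Real.sin (z.2 * (x' - z.1))) / z.2)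
      (by apply Measurable.aestronglyMeasurable; fun_prop) (ae_of_all _ fun z =>
        (abs_sin_sub_sin_div_le _ _ _).trans (le_of_eq (by congr 1; ring)))
    exact h4.congr (ae_of_all _ fun z => by simp only [Function.uncurry]; ring)

/-- The Fourier transform `t ↦ ∫ exp (i t u) w(u) dμ(u)` of the density `w` with respect to `μ`. -/
noncomputable def weightedCharFun (μ : Measure ℝ) (w : ℝ → ℝ) (t : ℝ) : ℂ :=
  ∫ u, Complex.exp (t * u * Complex.I) * w u ∂μ

lemma norm_exp_real_mul_I (t u : ℝ) : ‖Complex.exp (t * u * Complex.I)‖ = 1 := by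
  rw [← Complex.ofReal_mul, Complex.norm_exp_ofReal_mul_I]

lemma integrable_exp_mul {μ : Measure ℝ} {w : ℝ → ℝ} (hw : Integrable w μ) (t : ℝ) :
    Integrable (fun u : ℝ => Complex.exp (t * u * Complex.I) * w u) μ := by
  refine hw.ofReal.bdd_mul (c := 1) ?_ (ae_of_all _ fun u => (norm_exp_real_mul_I t u).le)
  apply Continuous.aestronglyMeasurable
  fun_prop

lemma integral_mul_sin_sub {μ : Measure ℝ} {w : ℝ → ℝ} (hw : Integrable w μ) (t x x' : ℝ) :
    ∫ u, w u * ((Real.sin (t * (x - u)) - Real.sin (t * (x' - u))) / t) ∂μ =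
      ((Complex.exp (-(t * x * Complex.I)) - Complex.exp (-(t * x' * Complex.I))) *
        weightedCharFun μ w t).im * (-1 / t) := by
  have h := (integrable_exp_mul hw t).const_mul
    (Complex.exp (-(t * x * Complex.I)) - Complex.exp (-(t * x' * Complex.I)))
  rw [weightedCharFun, ← integral_const_mul, ← RCLike.im_eq_complex_im, ← integral_im h,
    ← integral_mul_const]
  congr 1 with u
  rw [RCLike.im_eq_complex_im, sub_mul, ← mul_assoc, ← mul_assoc, ← Complex.exp_add,
    ← Complex.exp_add, ← sub_mul, Complex.im_mul_ofReal, Complex.sub_im]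
  have : ∀ y : ℝ, (Complex.exp (-(t * y * Complex.I) + t * u * Complex.I)).im =
      -Real.sin (t * (y - u)) := by
    intro y
    rw [show -((t : ℂ) * y * Complex.I) + t * u * Complex.I = ((-(t * (y - u)) : ℝ) : ℂ) * Complex.I
      by push_cast; ring, Complex.exp_ofReal_mul_I_im, Real.sin_neg]
  rw [this, this]
  ring

lemma tendsto_integral_Iic_atBot {μ : Measure ℝ} {w : ℝ → ℝ} (hw : Integrable w μ) :
    Tendsto (fun x => ∫ u in Set.Iic x, w u ∂μ) atBot (𝓝 0) := by
  have h : Tendsto (fun x => ∫ u, (Set.Iic x).indicator w u ∂μ) atBot (𝓝 (∫ _, (0 : ℝ) ∂μ)) := by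
    refine tendsto_integral_filter_of_dominated_convergence (fun u => ‖w u‖)
      (Eventually.of_forall fun x => (hw.indicator measurableSet_Iic).aestronglyMeasurable)
      (Eventually.of_forall fun x => ae_of_all _ fun u => norm_indicator_le_norm_self _ _) hw.norm
      (ae_of_all _ fun u => ?_)
    refine tendsto_const_nhds.congr' ?_
    filter_upwards [eventually_lt_atBot u] with x hx
    rw [Set.indicator_of_notMem (by simpa using hx)]
  simpa [integral_indicator measurableSet_Iic] using h

/-- **Esseen's smoothing inequality**, for a probability measure and a signed density. -/
theorem exists_esseen_bound : ∃ C : ℝ, 0 < C ∧ ∀ (μ : Measure ℝ) [IsProbabilityMeasure μ]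
    (g : ℝ → ℝ) (m T : ℝ) (h : ℝ → ℝ), Integrable g → (∀ x, |g x| ≤ m) → 0 < T →
    IntervalIntegrable h volume 0 T →
    (∀ t ∈ Set.Ioc 0 T, ‖charFun μ t - weightedCharFun volume g t‖ ≤ t * h t) →
    ∀ x, |μ.real (Set.Iic x) - ∫ y in Set.Iic x, g y| ≤ C * ((∫ t in (0 : ℝ)..T, h t) + m / T) := by
  obtain ⟨C, hC, H⟩ := exists_bound_of_convolution_le
  -- One factor `2` bounds the weight `2 (1 - t / T)`, another the difference of two unimodular
  -- exponentials.
  refine ⟨4 * C, by positivity, ?_⟩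
  intro μ _ g m T h hg hgm hT hh hΦ
  have hm : 0 ≤ m := (abs_nonneg _).trans (hgm 0)
  have h1 : Integrable (fun _ : ℝ => (1 : ℝ)) μ := integrable_const 1
  set F : ℝ → ℝ := fun x => ∫ _ in Set.Iic x, (1 : ℝ) ∂μ with hF
  set G : ℝ → ℝ := fun x => ∫ y in Set.Iic x, g y with hG
  have hFeq : ∀ x, μ.real (Set.Iic x) = F x := by intro x; simp [hF]
  have hFmono : Monotone F := by
    intro x y hxy
    rw [← hFeq, ← hFeq]
    exact measureReal_mono (Set.Iic_subset_Iic.mpr hxy)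
  have hGdiff : ∀ x y, G y - G x = ∫ u in x..y, g u := fun x y =>
    intervalIntegral.integral_Iic_sub_Iic hg.integrableOn hg.integrableOn
  have hGlip : ∀ x y, |G y - G x| ≤ m * |y - x| := by
    intro x y
    rw [hGdiff, ← Real.norm_eq_abs]
    exact intervalIntegral.norm_integral_le_of_norm_le_const fun u _ => hgm u
  have hGcont : Continuous G := by
    refine (LipschitzWith.of_dist_le_mul (K := ⟨m, hm⟩) fun x y => ?_).continuous
    exact hGlip y x
  have hmeas : Measurable (fun x => F x - G x) := hFmono.measurable.sub hGcont.measurable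
  have hbdd : ∀ x, |F x - G x| ≤ 1 + ∫ y, ‖g y‖ := by
    intro x
    refine (abs_sub _ _).trans (add_le_add ?_ ?_)
    · rw [← hFeq, abs_of_nonneg measureReal_nonneg]
      exact measureReal_le_one
    · exact (norm_integral_le_integral_norm _).trans
        (setIntegral_le_integral hg.norm (ae_of_all _ fun _ => norm_nonneg _))
  have hK := integrable_scaledKernel hT
  have hint : ∀ x, Integrable fun y => scaledKernel T y * (F (x - y) - G (x - y)) := fun x =>
    hK.mul_bdd (c := 1 + ∫ y, ‖g y‖) (hmeas.comp (by fun_prop)).aestronglyMeasurable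
      (ae_of_all _ fun y => hbdd _)
  have hFint : ∀ x, Integrable fun y => scaledKernel T y * F (x - y) := fun x =>
    hK.mul_bdd (c := 1) (hFmono.measurable.comp (by fun_prop)).aestronglyMeasurable
      (ae_of_all _ fun y => by
        rw [← hFeq, Real.norm_eq_abs, abs_of_nonneg measureReal_nonneg]; exact measureReal_le_one)
  have hGint : ∀ x, Integrable fun y => scaledKernel T y * G (x - y) := fun x =>
    ((hFint x).sub (hint x)).congr (ae_of_all _ fun y => by simp only [Pi.sub_apply]; ring)
  have hdiff : ∀ x' x, x' ≤ x →
      |(∫ y, scaledKernel T y * (F (x - y) - G (x - y))) -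
        ∫ y, scaledKernel T y * (F (x' - y) - G (x' - y))| ≤ 4 * ∫ t in (0 : ℝ)..T, h t := by
    intro x' x hx
    have e1 := integral_scaledKernel_mul_sub h1 hT hx
    have e2 := integral_scaledKernel_mul_sub hg hT hx
    have e3 : (∫ y, scaledKernel T y * (F (x - y) - G (x - y))) -
        ∫ y, scaledKernel T y * (F (x' - y) - G (x' - y)) =
        (∫ y, scaledKernel T y * (F (x - y) - F (x' - y))) -
        ∫ y, scaledKernel T y * (G (x - y) - G (x' - y)) := by
      simp only [mul_sub]
      rw [integral_sub (hFint _) (hGint _), integral_sub (hFint _) (hGint _),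
        integral_sub (hFint _) (hFint _), integral_sub (hGint _) (hGint _)]
      ring
    have hii : ∀ {ν : Measure ℝ} [SFinite ν] {w : ℝ → ℝ}, Integrable w ν →
        IntervalIntegrable (fun t : ℝ => 2 * (1 - t / T) *
          ∫ u, w u * ((Real.sin (t * (x - u)) - Real.sin (t * (x' - u))) / t) ∂ν) volume 0 T := by
      intro ν _ w hw
      rw [intervalIntegrable_iff_integrableOn_Ioc_of_le hT.le]
      have h3 : Integrable (fun t : ℝ => 2 * (1 - t / T)) (volume.restrict (Set.Ioc 0 T)) :=
        (Continuous.integrableOn_Icc (by fun_prop)).mono_set Set.Ioc_subset_Icc_self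
      refine h3.mul_bdd (c := ∫ u, ‖w u‖ * |x - x'| ∂ν) ?_ (ae_of_all _ fun t => ?_)
      · have : AEStronglyMeasurable (fun z : ℝ × ℝ => w z.2 *
            ((Real.sin (z.1 * (x - z.2)) - Real.sin (z.1 * (x' - z.2))) / z.1))
            ((volume.restrict (Set.Ioc 0 T)).prod ν) := by
          refine hw.aestronglyMeasurable.comp_snd.mul (Measurable.aestronglyMeasurable ?_)
          fun_prop
        exact this.integral_prod_right'
      · refine norm_integral_le_of_norm_le (hw.norm.mul_const _) (ae_of_all _ fun u => ?_)
        rw [norm_mul]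
        refine mul_le_mul_of_nonneg_left ?_ (norm_nonneg _)
        refine (abs_sin_sub_sin_div_le _ _ _).trans (le_of_eq ?_)
        congr 1
        ring
    rw [e3, e1, e2, ← intervalIntegral.integral_sub (hii h1) (hii hg),
      ← intervalIntegral.integral_const_mul, ← Real.norm_eq_abs]
    refine intervalIntegral.norm_integral_le_of_norm_le hT.le (ae_of_all _ fun t ht => ?_)
      (hh.const_mul 4)
    rw [integral_mul_sin_sub h1, integral_mul_sin_sub hg, ← mul_sub, ← sub_mul, ← Complex.sub_im,
      ← mul_sub]
    have hc : weightedCharFun μ (fun _ => 1) t = charFun μ t := by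
      simp [weightedCharFun, charFun_apply_real]
    rw [hc, norm_mul, norm_mul _ (-1 / t), norm_div, norm_neg, norm_one]
    have ht0 := ht.1
    have b1 : ‖2 * (1 - t / T)‖ ≤ 2 := by
      have : t / T ≤ 1 := (div_le_one hT).mpr ht.2
      have h0 : 0 ≤ t / T := by positivity
      rw [Real.norm_eq_abs, abs_of_nonneg (by linarith)]
      linarith
    have hexp : ∀ y : ℝ, ‖Complex.exp (-(t * y * Complex.I))‖ = 1 := by
      intro y
      have := norm_exp_real_mul_I (-t) y
      rwa [Complex.ofReal_neg, neg_mul, neg_mul] at this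
    have b2 : ‖((Complex.exp (-(t * x * Complex.I)) - Complex.exp (-(t * x' * Complex.I))) *
        (charFun μ t - weightedCharFun volume g t)).im‖ ≤ 2 * (t * h t) := by
      refine (Complex.abs_im_le_norm _).trans ?_
      rw [norm_mul]
      refine mul_le_mul ?_ (hΦ t ht) (norm_nonneg _) zero_le_two
      refine (norm_sub_le _ _).trans ?_
      rw [hexp, hexp]
      norm_num
    have hth : 0 ≤ t * h t := (norm_nonneg _).trans (hΦ t ht)
    calc _ ≤ 2 * (2 * (t * h t) * (1 / ‖t‖)) := by gcongr
      _ = 4 * h t := by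
        rw [Real.norm_eq_abs, abs_of_pos ht0]
        field_simp
        ring
  -- Letting `x' → -∞` removes the second endpoint: both primitives vanish at `-∞`, and dominated
  -- convergence carries this to the convolution.
  have hlim : ∀ x, |∫ y, scaledKernel T y * (F (x - y) - G (x - y))| ≤
      4 * ∫ t in (0 : ℝ)..T, h t := by
    intro x
    have hz : Tendsto (fun x' => ∫ y, scaledKernel T y * (F (x' - y) - G (x' - y))) atBot
        (𝓝 (∫ _ : ℝ, (0 : ℝ))) := by
      refine tendsto_integral_filter_of_dominated_convergence
        (fun y => scaledKernel T y * (1 + ∫ y, ‖g y‖))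
        (Eventually.of_forall fun x => (hint x).aestronglyMeasurable)
        (Eventually.of_forall fun x => ae_of_all _ fun u => ?_) (hK.mul_const _)
        (ae_of_all _ fun y => ?_)
      · rw [norm_mul, Real.norm_of_nonneg (scaledKernel_nonneg hT u)]
        exact mul_le_mul_of_nonneg_left (hbdd _) (scaledKernel_nonneg hT u)
      · have t1 : Tendsto (fun x' : ℝ => x' - y) atBot atBot :=
          tendsto_atBot_add_const_right _ _ tendsto_id
        have := (((tendsto_integral_Iic_atBot h1).comp t1).sub
          ((tendsto_integral_Iic_atBot hg).comp t1)).const_mul (scaledKernel T y)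
        rw [sub_zero, mul_zero] at this
        exact this
    rw [integral_zero] at hz
    have := (tendsto_const_nhds (x := ∫ y, scaledKernel T y * (F (x - y) - G (x - y)))).sub hz
    rw [sub_zero] at this
    refine le_of_tendsto this.abs ?_
    filter_upwards [eventually_le_atBot x] with x' hx'
    exact hdiff x' x hx'
  intro x
  -- `F - G` decreases at most linearly because `F` is monotone and `G` is `m`-Lipschitz.
  have := H (fun x => F x - G x) m _ T hT hm hmeas ⟨_, hbdd⟩ (fun x y hxy => by
    have h1 := (le_abs_self _).trans (hGlip x y)
    rw [abs_of_nonneg (by linarith)] at h1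
    linarith [hFmono hxy]) hlim x
  rw [hFeq]
  refine this.trans ?_
  have hmT : 0 ≤ m / T := by positivity
  nlinarith [mul_nonneg hC.le hmT]

/-! ### Polynomials times the Gaussian density and their Fourier transforms -/

lemma pow_le_const_mul_exp (n : ℕ) {b : ℝ} (hb : 0 < b) :
    ∃ C : ℝ, 0 ≤ C ∧ ∀ x : ℝ, |x| ^ n ≤ C * Real.exp (b * x ^ 2) := by
  refine ⟨1 + n.factorial / b ^ n, by positivity, fun x => ?_⟩
  have h1 : (b * x ^ 2) ^ n / n.factorial ≤ Real.exp (b * x ^ 2) :=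
    Real.pow_div_factorial_le_exp _ (by positivity) n
  have h2 : 1 ≤ Real.exp (b * x ^ 2) := Real.one_le_exp (by positivity)
  have h3 : (x ^ 2) ^ n = (|x| ^ n) ^ 2 := by rw [← sq_abs]; ring
  have h4 : (|x| ^ n) ^ 2 ≤ n.factorial / b ^ n * Real.exp (b * x ^ 2) := by
    rw [← h3]
    rw [mul_pow, div_le_iff₀ (by positivity)] at h1
    rw [div_mul_eq_mul_div, le_div_iff₀ (by positivity)]
    linarith
  -- From `2 |x| ^ n ≤ 1 + |x| ^ (2 n)`, with both terms on the right bounded by multiples of the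
  -- exponential.
  nlinarith [sq_nonneg (|x| ^ n - 1)]

lemma exists_abs_eval_le (q : Polynomial ℝ) {b : ℝ} (hb : 0 < b) :
    ∃ C : ℝ, 0 ≤ C ∧ ∀ x : ℝ, |q.eval x| ≤ C * Real.exp (b * x ^ 2) := by
  induction q using Polynomial.induction_on' with
  | add p q hp hq =>
    obtain ⟨C₁, h₁, H₁⟩ := hp
    obtain ⟨C₂, h₂, H₂⟩ := hq
    refine ⟨C₁ + C₂, by positivity, fun x => ?_⟩
    rw [Polynomial.eval_add, add_mul]
    exact (abs_add_le _ _).trans (add_le_add (H₁ x) (H₂ x))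
  | monomial n a =>
    obtain ⟨C, hC, H⟩ := pow_le_const_mul_exp n hb
    refine ⟨|a| * C, by positivity, fun x => ?_⟩
    rw [Polynomial.eval_monomial, abs_mul, abs_pow, mul_assoc]
    exact mul_le_mul_of_nonneg_left (H x) (abs_nonneg _)

/-- The operator on polynomials given by `(q 𝔫)' = (gaussianDeriv v q) 𝔫` for the centered normal
density `𝔫` of variance `v`. -/
noncomputable def gaussianDeriv (v : NNReal) (q : Polynomial ℝ) : Polynomial ℝ :=
  Polynomial.derivative q - Polynomial.C (v : ℝ)⁻¹ * Polynomial.X * q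

section Gaussian

variable {v : NNReal}

lemma gaussianPDFReal_zero_eq (v : NNReal) (x : ℝ) :
    gaussianPDFReal 0 v x = (√(2 * Real.pi * v))⁻¹ * Real.exp (-x ^ 2 / (2 * v)) := by
  simp [gaussianPDFReal]

lemma hasDerivAt_eval_mul_gaussianPDFReal (hv : 0 < v) (q : Polynomial ℝ) (x : ℝ) :
    HasDerivAt (fun x => q.eval x * gaussianPDFReal 0 v x)
      ((gaussianDeriv v q).eval x * gaussianPDFReal 0 v x) x := by
  have h1 : HasDerivAt (fun x : ℝ => -x ^ 2 / (2 * (v : ℝ))) (-(2 * x) / (2 * v)) x := by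
    simpa using ((hasDerivAt_pow 2 x).neg.div_const (2 * (v : ℝ)))
  have h2 := (h1.exp.const_mul (√(2 * Real.pi * v))⁻¹)
  have hv' : (v : ℝ) ≠ 0 := by exact_mod_cast hv.ne'
  simp only [gaussianPDFReal_zero_eq]
  refine ((q.hasDerivAt x).mul h2).congr_deriv ?_
  simp only [gaussianDeriv, Polynomial.eval_sub, Polynomial.eval_mul, Polynomial.eval_C,
    Polynomial.eval_X]
  field_simp
  ring

lemma exists_abs_eval_mul_gaussianPDFReal_le (hv : 0 < v) (q : Polynomial ℝ) :
    ∃ C : ℝ, 0 ≤ C ∧ ∀ x : ℝ, |q.eval x * gaussianPDFReal 0 v x| ≤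
      C * Real.exp (-(4 * (v : ℝ))⁻¹ * x ^ 2) := by
  have hv' : 0 < (v : ℝ) := by exact_mod_cast hv
  obtain ⟨C, hC, H⟩ := exists_abs_eval_le q (b := (4 * (v : ℝ))⁻¹) (by positivity)
  refine ⟨C * (√(2 * Real.pi * v))⁻¹, by positivity, fun x => ?_⟩
  rw [abs_mul, abs_of_nonneg (gaussianPDFReal_nonneg _ _ _), gaussianPDFReal_zero_eq]
  calc _ ≤ C * Real.exp ((4 * (v : ℝ))⁻¹ * x ^ 2) *
        ((√(2 * Real.pi * v))⁻¹ * Real.exp (-x ^ 2 / (2 * v))) := by gcongr; exact H x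
    _ = C * (√(2 * Real.pi * v))⁻¹ *
        (Real.exp ((4 * (v : ℝ))⁻¹ * x ^ 2) * Real.exp (-x ^ 2 / (2 * v))) := by ring
    _ = _ := by
      rw [← Real.exp_add]
      congr 2
      field_simp
      ring

lemma continuous_eval_mul_gaussianPDFReal (q : Polynomial ℝ) :
    Continuous fun x => q.eval x * gaussianPDFReal 0 v x := by
  simp only [gaussianPDFReal_zero_eq]
  fun_prop

lemma integrable_eval_mul_gaussianPDFReal (hv : 0 < v) (q : Polynomial ℝ) :
    Integrable fun x => q.eval x * gaussianPDFReal 0 v x := by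
  have hv' : 0 < (v : ℝ) := by exact_mod_cast hv
  obtain ⟨C, hC, H⟩ := exists_abs_eval_mul_gaussianPDFReal_le hv q
  exact ((integrable_exp_neg_mul_sq (b := (4 * (v : ℝ))⁻¹) (by positivity)).const_mul C).mono'
    (continuous_eval_mul_gaussianPDFReal q).aestronglyMeasurable (ae_of_all _ H)

lemma exists_abs_eval_mul_gaussianPDFReal_le_const (hv : 0 < v) (q : Polynomial ℝ) :
    ∃ C : ℝ, 0 ≤ C ∧ ∀ x : ℝ, |q.eval x * gaussianPDFReal 0 v x| ≤ C := by
  obtain ⟨C, hC, H⟩ := exists_abs_eval_mul_gaussianPDFReal_le hv q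
  refine ⟨C, hC, fun x => (H x).trans ?_⟩
  refine mul_le_of_le_one_right hC (Real.exp_le_one_iff.mpr ?_)
  rw [neg_mul]
  exact neg_nonpos.mpr (by positivity)

/-- The correction densities are exact derivatives, which is why each correction to the distribution
function is a polynomial times `𝔫`. -/
lemma setIntegral_gaussianDeriv (hv : 0 < v) (q : Polynomial ℝ) (z : ℝ) :
    ∫ x in Set.Iic z, (gaussianDeriv v q).eval x * gaussianPDFReal 0 v x =
      q.eval z * gaussianPDFReal 0 v z := by
  have hv' : 0 < (v : ℝ) := by exact_mod_cast hv
  rw [integral_Iic_of_hasDerivAt_of_tendsto' (m := 0)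
    (fun x _ => hasDerivAt_eval_mul_gaussianPDFReal hv q x)
    (integrable_eval_mul_gaussianPDFReal hv _).integrableOn, sub_zero]
  exact tendsto_zero_of_hasDerivAt_of_integrableOn_Iic (a := 0)
    (fun x _ => hasDerivAt_eval_mul_gaussianPDFReal hv q x)
    (integrable_eval_mul_gaussianPDFReal hv _).integrableOn
    (integrable_eval_mul_gaussianPDFReal hv _).integrableOn

/-- Integration by parts: the derivative of `exp (i t x) q(x) 𝔫(x)` is integrable and integrates to
zero. -/
lemma weightedCharFun_gaussianDeriv (hv : 0 < v) (q : Polynomial ℝ) (t : ℝ) :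
    weightedCharFun volume (fun x => (gaussianDeriv v q).eval x * gaussianPDFReal 0 v x) t =
      -(t * Complex.I) * weightedCharFun volume (fun x => q.eval x * gaussianPDFReal 0 v x) t := by
  have h0 := integrable_exp_mul (integrable_eval_mul_gaussianPDFReal hv q) t
  have h1 := integrable_exp_mul (integrable_eval_mul_gaussianPDFReal hv (gaussianDeriv v q)) t
  have h2 : Integrable fun x : ℝ => Complex.exp (t * x * Complex.I) * (t * Complex.I) *
      ((q.eval x * gaussianPDFReal 0 v x : ℝ) : ℂ) +
      Complex.exp (t * x * Complex.I) *
        (((gaussianDeriv v q).eval x * gaussianPDFReal 0 v x : ℝ) : ℂ) :=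
    ((h0.const_mul (t * Complex.I)).congr (ae_of_all _ fun x => by ring)).add h1
  have := integral_eq_zero_of_hasDerivAt_of_integrable (fun x => ?_) h2 h0
  · rw [integral_add ((h0.const_mul (t * Complex.I)).congr (ae_of_all _ fun x => by ring)) h1]
      at this
    simp only [weightedCharFun]
    rw [eq_neg_of_add_eq_zero_right this, ← integral_const_mul, ← integral_neg]
    congr 1 with x
    ring
  · refine HasDerivAt.mul ?_ (hasDerivAt_eval_mul_gaussianPDFReal hv q x).ofReal_comp
    have h3 : HasDerivAt (fun x : ℝ => (t : ℂ) * x * Complex.I) (t * Complex.I) x := by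
      simpa using ((Complex.ofRealCLM.hasDerivAt (x := x)).const_mul (t : ℂ)).mul_const Complex.I
    exact h3.cexp

lemma weightedCharFun_gaussianPDFReal (hv : 0 < v) (t : ℝ) :
    weightedCharFun volume (gaussianPDFReal 0 v) t = Complex.exp (-(v * t ^ 2 / 2)) := by
  have h := charFun_gaussianReal (μ := 0) (v := v) t
  rw [charFun_apply_real, integral_gaussianReal_eq_integral_smul hv.ne'] at h
  rw [weightedCharFun]
  simp only [Complex.real_smul, Complex.ofReal_zero, mul_zero, zero_mul, zero_sub] at h
  rw [← h]
  congr 1 with x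
  ring

/-- The polynomial `q` with `q 𝔫` the primitive of the signed density whose Fourier transform is
`t ↦ (∑ aₖ (i t)ᵏ) exp (- v t² / 2)`, the sum being over `k ≥ 1`. -/
noncomputable def inverseSymbol (v : NNReal) (p : Polynomial ℝ) : Polynomial ℝ :=
  p.sum fun k a => Polynomial.C (a * (-1) ^ k) * (gaussianDeriv v)^[k - 1] 1

lemma weightedCharFun_add {μ : Measure ℝ} {f g : ℝ → ℝ} (hf : Integrable f μ)
    (hg : Integrable g μ) (t : ℝ) :
    weightedCharFun μ (fun x => f x + g x) t = weightedCharFun μ f t + weightedCharFun μ g t := by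
  simp only [weightedCharFun]
  rw [← integral_add (integrable_exp_mul hf t) (integrable_exp_mul hg t)]
  congr 1 with x
  push_cast
  ring

lemma weightedCharFun_const_mul {μ : Measure ℝ} (f : ℝ → ℝ) (a t : ℝ) :
    weightedCharFun μ (fun x => a * f x) t = a * weightedCharFun μ f t := by
  simp only [weightedCharFun]
  rw [← integral_const_mul]
  congr 1 with x
  push_cast
  ring

lemma weightedCharFun_iterate_gaussianDeriv (hv : 0 < v) (k : ℕ) (t : ℝ) :
    weightedCharFun volume
      (fun x => ((gaussianDeriv v)^[k] 1).eval x * gaussianPDFReal 0 v x) t =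
      (-(t * Complex.I)) ^ k * Complex.exp (-(v * t ^ 2 / 2)) := by
  induction k with
  | zero => simpa using weightedCharFun_gaussianPDFReal hv t
  | succ k ih =>
    rw [Function.iterate_succ_apply', weightedCharFun_gaussianDeriv hv, ih, pow_succ]
    ring

lemma weightedCharFun_sum {ι : Type*} {μ : Measure ℝ} (s : Finset ι) {f : ι → ℝ → ℝ}
    (hf : ∀ i ∈ s, Integrable (f i) μ) (t : ℝ) :
    weightedCharFun μ (fun x => ∑ i ∈ s, f i x) t = ∑ i ∈ s, weightedCharFun μ (f i) t := by
  simp only [weightedCharFun]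
  rw [← integral_finsetSum _ fun i hi => integrable_exp_mul (hf i hi) t]
  congr 1 with x
  push_cast
  rw [Finset.mul_sum]

/-- The `k - 1` derivatives in `inverseSymbol` and the outer one produce `(-i t) ^ k`, and the sign
`(-1) ^ k` turns this into `(i t) ^ k`. -/
lemma weightedCharFun_gaussianDeriv_inverseSymbol (hv : 0 < v) {p : Polynomial ℝ}
    (hp : p.coeff 0 = 0) (t : ℝ) :
    weightedCharFun volume
      (fun x => (gaussianDeriv v (inverseSymbol v p)).eval x * gaussianPDFReal 0 v x) t =
      Polynomial.aeval (t * Complex.I) p * Complex.exp (-(v * t ^ 2 / 2)) := by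
  rw [weightedCharFun_gaussianDeriv hv, inverseSymbol, Polynomial.sum_def]
  simp only [Polynomial.eval_finsetSum, Finset.sum_mul, Polynomial.eval_mul, Polynomial.eval_C,
    mul_assoc]
  rw [weightedCharFun_sum]
  · simp only [weightedCharFun_const_mul, weightedCharFun_iterate_gaussianDeriv hv]
    rw [Polynomial.aeval_def, Polynomial.eval₂_eq_sum, Polynomial.sum_def, Finset.sum_mul,
      Finset.mul_sum]
    refine Finset.sum_congr rfl fun k hk => ?_
    -- Vanishing of the constant coefficient excludes `k = 0`, where the truncated `k - 1` would
    -- miscount the derivatives.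
    have hk0 : k ≠ 0 := by
      rintro rfl
      exact (Polynomial.mem_support_iff.mp hk) hp
    obtain ⟨j, rfl⟩ := Nat.exists_eq_succ_of_ne_zero hk0
    simp only [Nat.succ_eq_add_one, Nat.add_sub_cancel, Complex.coe_algebraMap]
    push_cast
    have h1 : ((-1 : ℂ)) ^ (j + 1) * (-(t * Complex.I)) ^ j = -(t * Complex.I) ^ j := by
      have h2 : ((-1 : ℂ)) ^ j * (-1) ^ j = 1 := by rw [← mul_pow]; simp
      rw [neg_pow (t * Complex.I)]
      linear_combination (-(t * Complex.I) ^ j) * h2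
    linear_combination (-(t * Complex.I) * (p.coeff (j + 1)) *
      Complex.exp (-(v * t ^ 2 / 2))) * h1
  · intro k _
    simp only [← mul_assoc]
    have := (integrable_eval_mul_gaussianPDFReal hv ((gaussianDeriv v)^[k - 1] 1)).const_mul
      (p.coeff k * (-1) ^ k)
    simpa only [mul_assoc] using this

end Gaussian

/-! ### Uniform geometric decay of powers in a Banach algebra -/

section PowerBounds

variable {A : Type*} [NormedRing A]

/-- Division of `n` by `k` with remainder. The constants depend only on `k`, `q` and `M`, so they
serve a whole neighbourhood of an element at once. -/
lemma exists_pow_norm_le_of_pow_norm_le {k : ℕ} (hk : 0 < k) {q M : ℝ} (hq : 0 < q) (hq1 : q < 1)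
    : ∃ C ρ : ℝ, 0 < C ∧ 0 < ρ ∧ ρ < 1 ∧ ∀ b : A, ‖(1 : A)‖ ≤ M → ‖b‖ ≤ M → ‖b ^ k‖ ≤ q →
      ∀ n : ℕ, ‖b ^ n‖ ≤ C * ρ ^ n := by
  set ρ : ℝ := q ^ ((k : ℝ)⁻¹) with hρ
  have hρ0 : 0 < ρ := Real.rpow_pos_of_pos hq _
  have hρ1 : ρ < 1 := Real.rpow_lt_one hq.le hq1 (by positivity)
  have hρk : ρ ^ k = q := Real.rpow_inv_natCast_pow hq.le hk.ne'
  set M' := max M 1 with hM'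
  have hM1 : 1 ≤ M' := le_max_right _ _
  -- `M' ^ (k + 1)` bounds the remainder power; the extra `M'` pays for `‖1‖`, which is not assumed
  -- to be `1`; and `ρ ^ k` pays for rounding `n` down to a multiple of `k`.
  refine ⟨M' ^ (k + 1) * M' / ρ ^ k, ρ, by positivity, hρ0, hρ1, fun b h1 hb hbk n => ?_⟩
  have hpow : ∀ e : ℕ, ‖b ^ e‖ ≤ M' ^ (e + 1) := by
    intro e
    induction e with
    | zero => rw [pow_zero, zero_add, pow_one]; exact h1.trans (le_max_left _ _)
    | succ e ih =>
      rw [pow_succ, pow_succ M']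
      exact (norm_mul_le _ _).trans (mul_le_mul ih (hb.trans (le_max_left _ _)) (norm_nonneg _)
        (by positivity))
  have hpowq : ∀ d : ℕ, ‖(b ^ k) ^ d‖ ≤ M' * q ^ d := by
    intro d
    induction d with
    | zero => rw [pow_zero, pow_zero, mul_one]; exact h1.trans (le_max_left _ _)
    | succ d ih =>
      rw [pow_succ, pow_succ q, ← mul_assoc]
      exact (norm_mul_le _ _).trans (mul_le_mul ih hbk (norm_nonneg _) (by positivity))
  have hlt := (Nat.mod_lt n hk).le
  have hn : k * (n / k) + n % k = n := Nat.div_add_mod n k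
  have h2 : ‖b ^ n‖ ≤ (M' * q ^ (n / k)) * M' ^ (n % k + 1) := by
    conv_lhs => rw [← hn, pow_add, pow_mul]
    exact (norm_mul_le _ _).trans (mul_le_mul (hpowq _) (hpow _) (norm_nonneg _) (by positivity))
  refine h2.trans ?_
  have h3 : q ^ (n / k) * ρ ^ k ≤ ρ ^ n := by
    rw [← hρk, ← pow_mul, ← pow_add]
    exact pow_le_pow_of_le_one hρ0.le hρ1.le (by omega)
  have h4 : M' ^ (n % k + 1) ≤ M' ^ (k + 1) := pow_le_pow_right₀ hM1 (by omega)
  rw [div_mul_eq_mul_div, le_div_iff₀ (by positivity)]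
  calc _ = M' * (q ^ (n / k) * ρ ^ k) * M' ^ (n % k + 1) := by ring
    _ ≤ M' * ρ ^ n * M' ^ (k + 1) := by gcongr
    _ = _ := by ring

/-- Telescoping. The factor `‖a - b‖` later becomes a factor `|s|`, which compensates the division
by `t` in Esseen's inequality. -/
lemma norm_pow_sub_pow_le {a b : A} {C ρ : ℝ} (hC : 0 ≤ C) (hρ : 0 ≤ ρ)
    (ha : ∀ n : ℕ, ‖a ^ n‖ ≤ C * ρ ^ n) (hb : ∀ n : ℕ, ‖b ^ n‖ ≤ C * ρ ^ n) (n : ℕ) :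
    ‖a ^ (n + 1) - b ^ (n + 1)‖ ≤ (n + 1) * C ^ 2 * ρ ^ n * ‖a - b‖ := by
  have hsum : a ^ (n + 1) - b ^ (n + 1) =
      ∑ i ∈ Finset.range (n + 1), a ^ i * (a - b) * b ^ (n - i) := by
    induction n with
    | zero => simp
    | succ n ih =>
      have h1 : a ^ (n + 1 + 1) - b ^ (n + 1 + 1) =
          (a ^ (n + 1) - b ^ (n + 1)) * b + a ^ (n + 1) * (a - b) := by
        rw [pow_succ a (n + 1), pow_succ b (n + 1)]
        noncomm_ring
      rw [h1, ih, Finset.sum_range_succ _ (n + 1), Finset.sum_mul]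
      congr 1
      · refine Finset.sum_congr rfl fun i hi => ?_
        have : n + 1 - i = n - i + 1 := by
          have := Finset.mem_range.mp hi
          omega
        rw [this, pow_succ]
        noncomm_ring
      · simp
  rw [hsum]
  refine (norm_sum_le _ _).trans ?_
  have : ∀ i ∈ Finset.range (n + 1), ‖a ^ i * (a - b) * b ^ (n - i)‖ ≤
      C ^ 2 * ρ ^ n * ‖a - b‖ := by
    intro i hi
    have hin : i + (n - i) = n := by
      have := Finset.mem_range.mp hi
      omega
    calc _ ≤ ‖a ^ i‖ * ‖a - b‖ * ‖b ^ (n - i)‖ :=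
          (norm_mul_le _ _).trans (mul_le_mul_of_nonneg_right (norm_mul_le _ _) (norm_nonneg _))
      _ ≤ (C * ρ ^ i) * ‖a - b‖ * (C * ρ ^ (n - i)) := by gcongr; exacts [ha _, hb _]
      _ = C ^ 2 * ρ ^ (i + (n - i)) * ‖a - b‖ := by rw [pow_add]; ring
      _ = _ := by rw [hin]
  refine (Finset.sum_le_sum this).trans (le_of_eq ?_)
  simp only [Finset.sum_const, Finset.card_range, nsmul_eq_mul]
  push_cast
  ring

/-- Compactness of the spectrum makes the spectral radius strictly less than `1`, and Gelfand's
formula converts this into a small power. -/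
lemma exists_pow_norm_lt_of_spectrum_subset [NormedAlgebra ℂ A] [CompleteSpace A] {a : A}
    (h : spectrum ℂ a ⊆ Metric.ball 0 1) : ∃ k : ℕ, 0 < k ∧ ‖a ^ k‖ < 1 / 2 := by
  rcases subsingleton_or_nontrivial A with hA | hA
  · exact ⟨1, one_pos, by rw [Subsingleton.elim (a ^ 1) 0]; norm_num⟩
  have hlt : spectralRadius ℂ a < 1 := by
    have := spectrum.spectralRadius_lt_of_forall_lt a (r := 1) fun k hk => by
      simpa [← NNReal.coe_lt_coe] using h hk
    simpa using this
  obtain ⟨q, hq1, hq2⟩ := ENNReal.lt_iff_exists_nnreal_btwn.mp hlt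
  have hq2' : q < 1 := by exact_mod_cast hq2
  have h1 := (spectrum.pow_nnnorm_pow_one_div_tendsto_nhds_spectralRadius a).eventually_lt_const hq1
  have h2 : ∀ᶠ n : ℕ in atTop, (q : ℝ) ^ n < 1 / 2 :=
    (tendsto_pow_atTop_nhds_zero_of_lt_one q.2 (by exact_mod_cast hq2')).eventually_lt_const
      (by norm_num)
  obtain ⟨n, ⟨hn1, hn2⟩, hn⟩ := ((h1.and h2).and (eventually_gt_atTop 0)).exists
  refine ⟨n, hn, lt_of_le_of_lt ?_ hn2⟩
  have h3 : ((‖a ^ n‖₊ : ENNReal) ^ (1 / n : ℝ)) ^ (n : ℝ) ≤ (q : ENNReal) ^ (n : ℝ) :=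
    ENNReal.rpow_le_rpow hn1.le (by positivity)
  rw [← ENNReal.rpow_mul, one_div_mul_cancel (by positivity), ENNReal.rpow_one,
    ENNReal.rpow_natCast] at h3
  exact_mod_cast h3

/-- Powers of operators close to one whose spectrum lies in the open unit disk decay uniformly. -/
lemma eventually_pow_norm_le_of_spectrum_subset [NormedAlgebra ℂ A] [CompleteSpace A] {a : A}
    (h : spectrum ℂ a ⊆ Metric.ball 0 1) :
    ∃ C ρ : ℝ, 0 < C ∧ 0 < ρ ∧ ρ < 1 ∧ ∀ᶠ b in 𝓝 a, ∀ n : ℕ, ‖b ^ n‖ ≤ C * ρ ^ n := by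
  obtain ⟨k, hk, hak⟩ := exists_pow_norm_lt_of_spectrum_subset h
  obtain ⟨C, ρ, hC, hρ, hρ1, H⟩ := exists_pow_norm_le_of_pow_norm_le (A := A) hk
    (q := 1 / 2) (M := max ‖(1 : A)‖ (‖a‖ + 1)) (by norm_num) (by norm_num)
  refine ⟨C, ρ, hC, hρ, hρ1, ?_⟩
  -- Smallness of one fixed power is an open condition, and one small power controls all of them.
  have h1 : ∀ᶠ b in 𝓝 a, ‖b ^ k‖ < 1 / 2 :=
    ((continuous_pow k).norm.tendsto a).eventually_lt_const hak
  have h2 : ∀ᶠ b in 𝓝 a, ‖b‖ < ‖a‖ + 1 :=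
    (continuous_norm.tendsto a).eventually_lt_const (by linarith)
  filter_upwards [h1, h2] with b hb1 hb2
  exact H b (le_max_left _ _) (hb2.le.trans (le_max_right _ _)) hb1.le

end PowerBounds

/-! ### The spectral gap at the simple eigenvalue -/

section Spectral

variable {E : Type*} [NormedAddCommGroup E] [NormedSpace ℂ E]

/-- If `T - z` is injective, it is also surjective on the finite-dimensional range of `P`; on `ker
P` it is bijective by the definition of the projection. So `T - z` would be invertible. Thus the
bound on eigenvalues in (A2) controls the whole discrete spectrum. -/
lemma eq_zero_or_hasEigenvalue_of_finiteDimensional {T P : E →L[ℂ] E} {z : ℂ} [CompleteSpace E]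
    (hP : IsSpectralProjection T z P)
    (hfin : FiniteDimensional ℂ (LinearMap.range (P : E →ₗ[ℂ] E)))
    (hz : z ∈ spectrum ℂ T) : Module.End.HasEigenvalue (T : E →ₗ[ℂ] E) z := by
  by_contra hne
  have hinj : Function.Injective ((T : E →ₗ[ℂ] E) - algebraMap ℂ (Module.End ℂ E) z) := by
    rw [← LinearMap.ker_eq_bot]
    by_contra hker
    exact hne (by
      rw [Module.End.hasEigenvalue_iff, Module.End.eigenspace_def]
      exact hker)
  have hPP : ∀ x, P (P x) = P x := fun x => congrArg (fun f : E →L[ℂ] E => f x) hP.idem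
  have hPT : ∀ x, P (T x) = T (P x) := fun x => congrArg (fun f : E →L[ℂ] E => f x) hP.comm
  set S : E →ₗ[ℂ] E := (T : E →ₗ[ℂ] E) - algebraMap ℂ (Module.End ℂ E) z with hS
  have hSapp : ∀ x, S x = T x - z • x := fun x => by
    simp [hS, Module.algebraMap_end_apply]
  have hSP : ∀ x, P (S x) = S (P x) := fun x => by
    rw [hSapp, hSapp, map_sub, map_smul, hPT]
  have hmaps : ∀ x ∈ LinearMap.range (P : E →ₗ[ℂ] E), S x ∈ LinearMap.range (P : E →ₗ[ℂ] E) := by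
    rintro _ ⟨x, rfl⟩
    exact ⟨S x, hSP x⟩
  have hsurjP : Function.Surjective (S.restrict hmaps) := by
    apply LinearMap.injective_iff_surjective.mp
    intro x y hxy
    apply Subtype.ext
    apply hinj
    simpa using congrArg Subtype.val hxy
  have hsurj : Function.Surjective S := by
    intro y
    obtain ⟨⟨a, ha⟩, ha'⟩ := hsurjP ⟨P y, ⟨y, rfl⟩⟩
    obtain ⟨b, -, hb⟩ := hP.on_ker.surjOn (show y - P y ∈ {x | P x = 0} by simp [hPP])
    refine ⟨a + b, ?_⟩
    have h1 : S a = P y := congrArg Subtype.val ha'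
    have h2 : S b = y - P y := by rw [hSapp]; exact hb
    rw [map_add, h1, h2]
    abel
  apply hz
  rw [spectrum.mem_resolventSet_iff, ← neg_sub, IsUnit.neg_iff, ContinuousLinearMap.isUnit_iff_bijective]
  exact ⟨hinj, hsurj⟩

/-- The eigenvector `h₀` and eigenfunctional `ν₀` for the simple eigenvalue `1`, and the spectral gap
for `L₀` minus the rank-one spectral projection. -/
lemma exists_spectral_gap [CompleteSpace E] {L : ℝ → E →L[ℂ] E} (h : AssumptionA2 L) :
    ∃ (h₀ : E) (ν₀ : E →L[ℂ] ℂ), L 0 h₀ = h₀ ∧ (∀ x, ν₀ (L 0 x) = ν₀ x) ∧ ν₀ h₀ = 1 ∧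
      spectrum ℂ (L 0 - ν₀.smulRight h₀) ⊆ Metric.ball 0 1 := by
  obtain ⟨⟨hev, -, P, hP, hrank⟩, heig, hess⟩ := h
  set T := L 0 with hT
  have hPP : ∀ x, P (P x) = P x := fun x => congrArg (fun f : E →L[ℂ] E => f x) hP.idem
  have hPT : ∀ x, P (T x) = T (P x) := fun x => congrArg (fun f : E →L[ℂ] E => f x) hP.comm
  obtain ⟨h₀, hh₀⟩ := hev.exists_hasEigenvector
  have hTh : T h₀ = h₀ := by simpa using hh₀.apply_eq_smul
  have hne : h₀ ≠ 0 := hh₀.2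
  have hPh : P h₀ = h₀ := by
    -- `h₀ - P h₀` lies in `ker P` and is killed by `T - 1`, which is injective there.
    have h1 : h₀ - P h₀ ∈ {x | P x = 0} := by simp [hPP]
    have h2 : (0 : E) ∈ {x | P x = 0} := by simp
    have := hP.on_ker.injOn h1 h2 (by simp [← hPT, hTh])
    exact (sub_eq_zero.mp this).symm
  have hspan : ∀ x, ∃ c : ℂ, c • h₀ = P x := by
    have h1 : (⟨h₀, ⟨h₀, hPh⟩⟩ : LinearMap.range (P : E →ₗ[ℂ] E)) ≠ 0 := by
      intro h0
      exact hne (congrArg Subtype.val h0)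
    intro x
    obtain ⟨c, hc⟩ := (finrank_eq_one_iff_of_nonzero' _ h1).mp hrank ⟨P x, ⟨x, rfl⟩⟩
    exact ⟨c, congrArg Subtype.val hc⟩
  -- A functional with `f h₀ = 1` turns the rank-one projection into `P x = ν₀ x • h₀` for `ν₀ = f ∘
  -- P`.
  obtain ⟨f, hf⟩ := SeparatingDual.exists_eq_one (R := ℂ) hne
  set ν₀ : E →L[ℂ] ℂ := f.comp P with hν₀
  have hPν : ∀ x, P x = ν₀ x • h₀ := by
    intro x
    obtain ⟨c, hc⟩ := hspan x
    have : ν₀ x = c := by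
      change f (P x) = c
      rw [← hc, map_smul, hf, smul_eq_mul, mul_one]
    rw [this, hc]
  have hPeq : ν₀.smulRight h₀ = P := by
    ext x
    simp [hPν]
  have hνT : ∀ x, ν₀ (T x) = ν₀ x := by
    intro x
    change f (P (T x)) = ν₀ x
    rw [hPT, hPν, map_smul, hTh, map_smul, hf, smul_eq_mul, mul_one]
  have hνh : ν₀ h₀ = 1 := by
    change f (P h₀) = 1
    rw [hPh, hf]
  refine ⟨h₀, ν₀, hTh, hνT, hνh, ?_⟩
  rw [hPeq]
  have hTP : ∀ x, T (P x) = P x := by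
    intro x
    rw [hPν, map_smul, hTh]
  intro z hz
  by_contra hz1
  have hz1' : 1 ≤ ‖z‖ := by simpa using hz1
  have hz0 : z ≠ 0 := by
    rintro rfl
    norm_num at hz1'
  -- On `ker P` the operator `T - P - z` equals `T - z`, so bijectivity there is what is needed. For
  -- `z = 1` it is part of the spectral projection; for other `z` with `|z| ≥ 1`, (A2) puts `z`
  -- outside the spectrum of `T`.
  have hker : Set.BijOn (fun x : E => T x - z • x) {x | P x = 0} {x | P x = 0} := by
    rcases eq_or_ne z 1 with rfl | hne1
    · exact hP.on_ker
    have hnot : z ∉ spectrum ℂ T := by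
      intro hmem
      by_cases hd : IsDiscreteEigenvalue T z
      · obtain ⟨-, P', hP', hfin⟩ := hd
        exact absurd (heig z (eq_zero_or_hasEigenvalue_of_finiteDimensional hP' hfin hmem) hne1)
          (not_lt.mpr hz1')
      · exact hz1 (hess ⟨hmem, hd⟩)
    rw [spectrum.notMem_iff, ← neg_sub, IsUnit.neg_iff,
      ContinuousLinearMap.isUnit_iff_bijective] at hnot
    have happ : ∀ x, (T - algebraMap ℂ (E →L[ℂ] E) z) x = T x - z • x := fun x => by
      simp [Algebra.algebraMap_eq_smul_one]
    refine ⟨fun x hx => ?_, fun x _ y _ hxy => ?_, fun y hy => ?_⟩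
    · simp only [Set.mem_ofPred_eq] at hx ⊢
      rw [map_sub, map_smul, hPT, hx]
      simp
    · exact hnot.1 (by rw [happ, happ]; exact hxy)
    · obtain ⟨x, hx⟩ := hnot.2 y
      rw [happ] at hx
      refine ⟨x, ?_, hx⟩
      simp only [Set.mem_ofPred_eq] at hy ⊢
      have h1 : P (T x - z • x) = 0 := by rw [hx, hy]
      rw [map_sub, map_smul, hPT, hTP] at h1
      have h2 : (1 - z) • P x = 0 := by rw [sub_smul, one_smul, h1]
      exact (smul_eq_zero.mp h2).resolve_left (sub_ne_zero.mpr hne1.symm)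
  apply hz
  rw [spectrum.mem_resolventSet_iff, ← neg_sub, IsUnit.neg_iff, ContinuousLinearMap.isUnit_iff_bijective]
  have happ : ∀ x, (T - P - algebraMap ℂ (E →L[ℂ] E) z) x = T x - P x - z • x := fun x => by
    simp [Algebra.algebraMap_eq_smul_one]
  have hPapp : ∀ x, P (T x - P x - z • x) = -(z • P x) := by
    intro x
    rw [map_sub, map_sub, map_smul, hPT, hTP, hPP]
    abel
  constructor
  · rw [injective_iff_map_eq_zero]
    intro x hx
    rw [happ] at hx
    have h1 := hPapp x
    rw [hx, map_zero, eq_comm, neg_eq_zero] at h1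
    have hPx : P x = 0 := (smul_eq_zero.mp h1).resolve_left hz0
    refine hker.injOn hPx (show (0 : E) ∈ {x | P x = 0} by simp) ?_
    rw [hPx, sub_zero] at hx
    simp [hx]
  · intro y
    obtain ⟨b, hb, hb'⟩ := hker.surjOn (show y - P y ∈ {x | P x = 0} by simp [hPP])
    -- On the range of `P` the operator `T - P` vanishes, so `T - P - z` is multiplication by `-z`
    -- there.
    refine ⟨b - z⁻¹ • P y, ?_⟩
    simp only [Set.mem_ofPred_eq] at hb hb'
    rw [happ, map_sub, map_sub, map_smul, map_smul, hTP, hPP, hb, smul_sub, smul_smul,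
      mul_inv_cancel₀ hz0, one_smul, eq_add_of_sub_eq hb']
    abel

/-- Spectral decomposition of a perturbed operator: `T^(n+1) = λ^(n+1) h ⊗ ν + N^(n+1)`. -/
lemma pow_eq_of_eigen {T : E →L[ℂ] E} {h : E} {ν : E →L[ℂ] ℂ} {lam : ℂ} (hT : T h = lam • h)
    (hν : ∀ x, ν (T x) = lam * ν x) (hνh : ν h = 1) (n : ℕ) (x : E) :
    (T ^ (n + 1)) x = (lam ^ (n + 1) * ν x) • h +
      ((T - lam • ν.smulRight h) ^ (n + 1)) x := by
  set N := T - lam • ν.smulRight h with hN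
  have hNapp : ∀ x, N x = T x - (lam * ν x) • h := fun x => by simp [hN, smul_smul]
  have hνN : ∀ x, ν (N x) = 0 := fun x => by simp [hNapp, hν, hνh]
  have hTN : ∀ x, ν x = 0 → T x = N x := fun x hx => by simp [hNapp, hx]
  induction n with
  | zero => simp [hNapp]
  | succ n ih =>
    -- The range of `N` lies in `ker ν`, where `T` and `N` agree; hence no cross terms appear.
    rw [pow_succ', mul_apply_eq_comp, ih, map_add, map_smul, hT,
      hTN ((N ^ (n + 1)) x) (by rw [pow_succ', mul_apply_eq_comp, hνN]),
      pow_succ' N (n + 1), mul_apply_eq_comp, smul_smul, pow_succ lam (n + 1)]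
    congr 2
    ring

end Spectral

/-! ### Smooth perturbation of the leading eigenvalue -/

section Perturbation

variable {E : Type*} [NormedAddCommGroup E] [NormedSpace ℂ E] [CompleteSpace E]

/-- Smooth dependence on the operator of the eigenvector of a simple eigenvalue. -/
lemma exists_contDiffAt_eigenvector {T₀ : E →L[ℂ] E} {h₀ : E} {ν₀ : E →L[ℂ] ℂ} (hT : T₀ h₀ = h₀)
    (hνT : ∀ x, ν₀ (T₀ x) = ν₀ x) (hνh : ν₀ h₀ = 1)
    (hunit : IsUnit (T₀ - ν₀.smulRight h₀ - 1)) (n : ℕ) (hn : n ≠ 0) :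
    ∃ ψ : (E →L[ℂ] E) → E, ContDiffAt ℂ n ψ T₀ ∧ ψ T₀ = h₀ ∧
      ∀ᶠ T in 𝓝 T₀, T (ψ T) = ν₀ (T (ψ T)) • ψ T ∧ ν₀ (ψ T) = 1 := by
  -- A zero of `f` with `ν₀ (T h) ≠ 0` is an eigenvector automatically normalised by `ν₀ h = 1`. The
  -- partial derivative in `h` at `(T₀, h₀)` is `T₀ - ν₀ ⊗ h₀ - 1`, invertible by hypothesis, so the
  -- implicit function theorem applies.
  set f : (E →L[ℂ] E) × E → E := fun p => p.1 p.2 - ν₀ (p.1 p.2) • p.2 with hf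
  have hcd : ContDiffAt ℂ n f (T₀, h₀) := by
    apply ContDiff.contDiffAt
    fun_prop
  have hn' : (n : WithTop ℕ∞) ≠ 0 := by exact_mod_cast hn
  have hderiv : ∀ k, (fderiv ℂ f (T₀, h₀) ∘L .inr ℂ (E →L[ℂ] E) E) k =
      (T₀ - ν₀.smulRight h₀ - 1) k := by
    intro k
    have h1 : HasFDerivAt f (fderiv ℂ f (T₀, h₀)) (T₀, h₀) :=
      (hcd.differentiableAt hn').hasFDerivAt
    have h2 : HasFDerivAt (fun h : E => f (T₀, h))
        (fderiv ℂ f (T₀, h₀) ∘L .inr ℂ (E →L[ℂ] E) E) h₀ :=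
      HasFDerivAt.comp h₀ h1 (hasFDerivAt_prodMk_right T₀ h₀)
    have h3 : HasFDerivAt (fun h : E => T₀ h - ν₀ (T₀ h) • h)
        (T₀ - (ν₀ (T₀ h₀) • ContinuousLinearMap.id ℂ E + (ν₀.comp T₀).smulRight h₀)) h₀ :=
      T₀.hasFDerivAt.sub ((ν₀.comp T₀).hasFDerivAt.smul (hasFDerivAt_id h₀))
    rw [h2.unique h3]
    simp [hνT, hνh, hT]
    abel
  have hinv : (fderiv ℂ f (T₀, h₀) ∘L .inr ℂ (E →L[ℂ] E) E).IsInvertible := by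
    rw [ContinuousLinearMap.ext hderiv]
    obtain ⟨u, hu⟩ := hunit
    exact ⟨ContinuousLinearEquiv.ofUnit u, hu⟩
  refine ⟨hcd.implicitFunction hn' hinv, hcd.contDiffAt_implicitFunction hn' hinv,
    hcd.implicitFunction_apply_self hn' hinv, ?_⟩
  have hcont : ContinuousAt (fun T => ν₀ (T (hcd.implicitFunction hn' hinv T))) T₀ :=
    ν₀.continuous.continuousAt.comp (continuousAt_id.clm_apply
      (hcd.contDiffAt_implicitFunction hn' hinv).continuousAt)
  have hne : ∀ᶠ T in 𝓝 T₀, ν₀ (T (hcd.implicitFunction hn' hinv T)) ≠ 0 := by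
    refine hcont.eventually_ne ?_
    have h0 : hcd.implicitFunction hn' hinv T₀ = h₀ := hcd.implicitFunction_apply_self hn' hinv
    rw [h0, hT, hνh]
    exact one_ne_zero
  filter_upwards [hcd.eventually_apply_implicitFunction hn' hinv, hne] with T hT1 hT2
  have h0 : f (T₀, h₀) = 0 := by simp [hf, hT, hνh]
  rw [h0] at hT1
  have h1 : T (hcd.implicitFunction hn' hinv T) = ν₀ (T (hcd.implicitFunction hn' hinv T)) •
    hcd.implicitFunction hn' hinv T := sub_eq_zero.mp hT1
  refine ⟨h1, ?_⟩
  have h2 := congrArg ν₀ h1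
  rw [map_smul, smul_eq_mul] at h2
  exact mul_left_cancel₀ hT2 (by rw [mul_one, ← h2])

/-- The right eigenvector comes from the implicit function theorem; the left one is explicit. With
`S = λ - L + h ⊗ (ν₀ L)`, invertible near `s = 0`, put `R = S⁻¹` and `ν = ν₀ L R`. Then `S h = λ h`
gives `ν h = 1`, and applying `ν₀ L R` to `L = λ - S + h ⊗ (ν₀ L)` gives `ν L = λ ν`. Smoothness of
`ν` follows from that of inversion. -/
lemma exists_contDiffAt_decomposition {L : ℝ → E →L[ℂ] E} {n : ℕ} (hn : n ≠ 0)
    (hL : ContDiffAt ℝ n L 0) (h2 : AssumptionA2 L) :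
    ∃ (lam : ℝ → ℂ) (h : ℝ → E) (ν : ℝ → E →L[ℂ] ℂ), ContDiffAt ℝ n lam 0 ∧ ContDiffAt ℝ n h 0 ∧
      ContDiffAt ℝ n ν 0 ∧ lam 0 = 1 ∧
      (∀ᶠ s in 𝓝 (0 : ℝ), L s (h s) = lam s • h s ∧ (∀ x, ν s (L s x) = lam s * ν s x) ∧
        ν s (h s) = 1) ∧
      spectrum ℂ (L 0 - lam 0 • (ν 0).smulRight (h 0)) ⊆ Metric.ball 0 1 := by
  obtain ⟨h₀, ν₀, hT, hνT, hνh, hspec⟩ := exists_spectral_gap h2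
  have hunit : IsUnit (L 0 - ν₀.smulRight h₀ - 1) := by
    have h1 : (1 : ℂ) ∉ spectrum ℂ (L 0 - ν₀.smulRight h₀) := fun hm => by
      simpa using hspec hm
    rw [spectrum.notMem_iff, map_one, ← neg_sub, IsUnit.neg_iff] at h1
    exact h1
  obtain ⟨ψ, hψ, hψ0, hψev⟩ := exists_contDiffAt_eigenvector hT hνT hνh hunit n hn
  have hh : ContDiffAt ℝ n (fun s => ψ (L s)) 0 := (hψ.restrict_scalars ℝ).comp (0 : ℝ) hL
  set h : ℝ → E := fun s => ψ (L s) with hhdef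
  have hh0 : h 0 = h₀ := hψ0
  have hνr : ContDiff ℝ n (fun x => ν₀ x) := ν₀.contDiff.restrict_scalars ℝ
  have happ : ∀ {g : ℝ → E}, ContDiffAt ℝ n g 0 → ContDiffAt ℝ n (fun s => L s (g s)) 0 :=
    fun hg => (isBoundedBilinearMap_apply (𝕜 := ℂ) (E := E) (F := E)).contDiff.restrict_scalars ℝ
      |>.contDiffAt.comp (0 : ℝ) (hL.prodMk hg)
  set lam : ℝ → ℂ := fun s => ν₀ (L s (h s)) with hlam
  have hlamc : ContDiffAt ℝ n lam 0 := hνr.contDiffAt.comp (0 : ℝ) (happ hh)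
  have hlam0 : lam 0 = 1 := by simp [hlam, hh0, hT, hνh]
  have hcomp : ContDiffAt ℝ n (fun s => ν₀.comp (L s)) 0 :=
    ((ContinuousLinearMap.compL ℂ E E ℂ ν₀).contDiff.restrict_scalars ℝ).contDiffAt.comp (0 : ℝ) hL
  have hsr : ∀ {g : ℝ → E →L[ℂ] ℂ}, ContDiffAt ℝ n g 0 →
      ContDiffAt ℝ n (fun s => (g s).smulRight (h s)) 0 := fun hg =>
    (isBoundedBilinearMap_smulRight (𝕜 := ℂ) (E := E) (F := E)).contDiff.restrict_scalars ℝ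
      |>.contDiffAt.comp (0 : ℝ) (hg.prodMk hh)
  set S : ℝ → E →L[ℂ] E := fun s => lam s • 1 - (L s - (ν₀.comp (L s)).smulRight (h s)) with hS
  have hSc : ContDiffAt ℝ n S 0 :=
    (hlamc.smul contDiffAt_const).sub (hL.sub (hsr hcomp))
  have hνcomp : ν₀.comp (L 0) = ν₀ := ContinuousLinearMap.ext hνT
  have hS0 : IsUnit (S 0) := by
    rw [← IsUnit.neg_iff]
    simpa [hS, hlam0, hh0, hνcomp] using hunit
  have hR : ContDiffAt ℝ n (fun s => Ring.inverse (S s)) 0 := by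
    obtain ⟨u, hu⟩ := hS0
    have := contDiffAt_ringInverse (n := n) ℝ u
    rw [hu] at this
    exact this.comp (0 : ℝ) hSc
  set R : ℝ → E →L[ℂ] E := fun s => Ring.inverse (S s) with hRdef
  have hνc : ContDiffAt ℝ n (fun s => (ν₀.comp (L s)).comp (R s)) 0 :=
    (isBoundedBilinearMap_comp (𝕜 := ℂ) (E := E) (F := E) (G := ℂ)).contDiff.restrict_scalars ℝ
      |>.contDiffAt.comp (0 : ℝ) (hcomp.prodMk hR)
  have hSev : ∀ᶠ s in 𝓝 (0 : ℝ), IsUnit (S s) :=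
    hSc.continuousAt.eventually (Units.isOpen.mem_nhds hS0)
  have hlamev : ∀ᶠ s in 𝓝 (0 : ℝ), lam s ≠ 0 :=
    hlamc.continuousAt.eventually_ne (by rw [hlam0]; exact one_ne_zero)
  have hmain : ∀ᶠ s in 𝓝 (0 : ℝ), L s (h s) = lam s • h s ∧
      (∀ x, (ν₀.comp (L s)).comp (R s) (L s x) = lam s * (ν₀.comp (L s)).comp (R s) x) ∧
        (ν₀.comp (L s)).comp (R s) (h s) = 1 := by
    filter_upwards [hSev, hlamev, hL.continuousAt.eventually hψev] with s hs hl hψs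
    obtain ⟨he, hn1⟩ := hψs
    have hRS : ∀ x, R s (S s x) = x := fun x => by
      rw [← mul_apply_eq_comp, hRdef]
      simp only
      rw [Ring.inverse_mul_cancel _ hs, one_apply_eq_self]
    have hSapp : ∀ x, S s x = lam s • x - (L s x - ν₀ (L s x) • h s) := fun x => by simp [hS]
    have hSh : S s (h s) = lam s • h s := by
      rw [hSapp]
      change lam s • h s - (L s (h s) - lam s • h s) = _
      have : L s (h s) = lam s • h s := he
      rw [this, sub_self, sub_zero]
    have hRh : lam s • R s (h s) = h s := by rw [← map_smul, ← hSh, hRS]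
    have hone : ν₀ (L s (R s (h s))) = 1 := by
      have h5 : lam s * ν₀ (L s (R s (h s))) = lam s * 1 := by
        rw [← smul_eq_mul, ← map_smul, ← map_smul, hRh, mul_one]
      exact mul_left_cancel₀ hl h5
    refine ⟨he, fun x => ?_, hone⟩
    have hLx : L s x = lam s • x - S s x + ν₀ (L s x) • h s := by
      rw [hSapp]
      abel
    change ν₀ (L s (R s (L s x))) = lam s * ν₀ (L s (R s x))
    have h6 : R s (L s x) = lam s • R s x - x + ν₀ (L s x) • R s (h s) := by
      conv_lhs => rw [hLx]
      rw [map_add, map_sub, map_smul, map_smul, hRS]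
    rw [h6]
    simp only [map_add, map_sub, map_smul, smul_eq_mul, hone]
    ring
  refine ⟨lam, h, _, hlamc, hh, hνc, hlam0, hmain, ?_⟩
  -- At `s = 0` the functional `ν₀` is invariant under `S 0`, hence under `R 0`, so the construction
  -- returns `ν₀` and the spectral gap applies.
  have hν0 : (ν₀.comp (L 0)).comp (R 0) = ν₀ := by
    ext x
    have hSR : ∀ x, S 0 (R 0 x) = x := fun x => by
      rw [← mul_apply_eq_comp, hRdef]
      simp only
      rw [Ring.mul_inverse_cancel _ hS0, one_apply_eq_self]
    have hνS : ∀ y, ν₀ (S 0 y) = ν₀ y := fun y => by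
      simp [hS, hlam0, hh0, hνT, hνh]
    rw [hνcomp, ContinuousLinearMap.comp_apply, ← hνS, hSR]
  rw [hν0, hlam0, one_smul, hh0]
  exact hspec

/-- Here `w(s) = ν_s(v) l(h_s)`, and the remainder is `l` of a power of the complementary part
applied to `v`. The second bound compares remainders at `s` and at `0`: the one at `0` vanishes for
characteristic functions, which leaves a factor `|s|`. The exponent `N + 1` is needed because the
splitting of powers fails for exponent `0`. -/
theorem exists_spectral_expansion {L : ℝ → E →L[ℂ] E} {n : ℕ} (hn : n ≠ 0)
    (hL : ContDiffAt ℝ n L 0) (h2 : AssumptionA2 L) (v : E) (l : E →L[ℂ] ℂ) :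
    ∃ (lam w : ℝ → ℂ) (C ρ : ℝ), ContDiffAt ℝ n lam 0 ∧ ContDiffAt ℝ n w 0 ∧ lam 0 = 1 ∧
      0 < C ∧ 0 < ρ ∧ ρ < 1 ∧ ∀ᶠ s in 𝓝 (0 : ℝ), ∀ N : ℕ,
        ‖l ((L s ^ (N + 1)) v) - lam s ^ (N + 1) * w s‖ ≤ C * ρ ^ N ∧
        ‖(l ((L s ^ (N + 1)) v) - lam s ^ (N + 1) * w s) -
          (l ((L 0 ^ (N + 1)) v) - w 0)‖ ≤ C * (N + 1) * ρ ^ N * |s| := by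
  obtain ⟨lam, h, ν, hlam, hh, hν, hlam0, hev, hspec⟩ := exists_contDiffAt_decomposition hn hL h2
  set N : ℝ → E →L[ℂ] E := fun s => L s - lam s • (ν s).smulRight (h s) with hN
  have hNc : ContDiffAt ℝ n N 0 := by
    refine hL.sub (hlam.smul ?_)
    exact (isBoundedBilinearMap_smulRight (𝕜 := ℂ) (E := E) (F := E)).contDiff.restrict_scalars ℝ
      |>.contDiffAt.comp (0 : ℝ) (hν.prodMk hh)
  obtain ⟨C, ρ, hC, hρ, hρ1, hpow⟩ := eventually_pow_norm_le_of_spectrum_subset hspec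
  have hpow' : ∀ᶠ s in 𝓝 (0 : ℝ), ∀ k : ℕ, ‖N s ^ k‖ ≤ C * ρ ^ k := hNc.continuousAt.eventually hpow
  have hw : ContDiffAt ℝ n (fun s => ν s v * l (h s)) 0 := by
    refine ContDiffAt.mul ?_ ((l.contDiff.restrict_scalars ℝ).contDiffAt.comp (0 : ℝ) hh)
    exact ((ContinuousLinearMap.apply ℂ ℂ v).contDiff.restrict_scalars ℝ).contDiffAt.comp (0 : ℝ) hν
  obtain ⟨K, hK0, hK⟩ :=
    ((hNc.differentiableAt (by exact_mod_cast hn)).hasFDerivAt.isBigO_sub).exists_pos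
  have hK' := hK.bound
  have hform : ∀ᶠ s in 𝓝 (0 : ℝ), ∀ k : ℕ,
      l ((L s ^ (k + 1)) v) - lam s ^ (k + 1) * (ν s v * l (h s)) = l ((N s ^ (k + 1)) v) := by
    filter_upwards [hev] with s hs k
    rw [pow_eq_of_eigen hs.1 hs.2.1 hs.2.2, map_add, map_smul, smul_eq_mul]
    ring
  have hform0 := hform.self_of_nhds
  simp only [hlam0, one_pow, one_mul] at hform0
  -- `C` serves the first bound, `C ^ 2 * K` the second, with `K` the local Lipschitz constant at
  -- `0`; the `1` ensures positivity.
  refine ⟨lam, fun s => ν s v * l (h s), ‖l‖ * ‖v‖ * (C + C ^ 2 * K) + 1, ρ, hlam, hw, hlam0,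
    by positivity, hρ, hρ1, ?_⟩
  have hpow0 := hpow'.self_of_nhds
  have hnorm : ∀ M : E →L[ℂ] E, ‖l (M v)‖ ≤ ‖l‖ * ‖v‖ * ‖M‖ := fun M => by
    calc _ ≤ ‖l‖ * ‖M v‖ := l.le_opNorm _
      _ ≤ ‖l‖ * (‖M‖ * ‖v‖) := by gcongr; exact M.le_opNorm _
      _ = _ := by ring
  filter_upwards [hpow', hK', hform] with s hs hKs hfs k
  simp only [hfs, hform0]
  have hρk : 0 < ρ ^ k := pow_pos hρ k
  constructor
  · refine (hnorm _).trans ?_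
    have h1 : ‖N s ^ (k + 1)‖ ≤ (C + C ^ 2 * K) * ρ ^ k := by
      refine (hs (k + 1)).trans ?_
      rw [pow_succ]
      have : ρ ^ k * ρ ≤ ρ ^ k := mul_le_of_le_one_right hρk.le hρ1.le
      have h3 : 0 ≤ C ^ 2 * K * ρ ^ k := by positivity
      nlinarith
    calc _ ≤ ‖l‖ * ‖v‖ * ((C + C ^ 2 * K) * ρ ^ k) := by gcongr
      _ ≤ _ := by nlinarith
  · rw [← map_sub, ← sub_apply]
    refine (hnorm _).trans ?_
    have h1 := norm_pow_sub_pow_le hC.le hρ.le hs hpow0 k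
    rw [sub_zero, Real.norm_eq_abs] at hKs
    have h4 : 0 ≤ ‖l‖ * ‖v‖ := by positivity
    have h5 : 0 ≤ ((k : ℝ) + 1) * ρ ^ k * |s| := by positivity
    calc _ ≤ ‖l‖ * ‖v‖ * ((k + 1) * C ^ 2 * ρ ^ k * (K * |s|)) := by
          gcongr
          exact h1.trans (by gcongr)
      _ = ‖l‖ * ‖v‖ * (C ^ 2 * K) * ((k + 1) * ρ ^ k * |s|) := by ring
      _ ≤ (‖l‖ * ‖v‖ * (C + C ^ 2 * K) + 1) * ((k + 1) * ρ ^ k * |s|) := by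
          refine mul_le_mul_of_nonneg_right ?_ h5
          nlinarith [mul_nonneg h4 hC.le]
      _ = _ := by ring

end Perturbation

/-! ### Decay of the powers away from the origin -/

section Decay

variable {E : Type*} [NormedAddCommGroup E] [NormedSpace ℂ E]

/-- (A3) and norm continuity give uniform decay near each nonzero point; compactness keeps finitely
many constants, of which the maximum is taken. -/
lemma exists_pow_norm_le_of_isCompact [CompleteSpace E] {L : ℝ → E →L[ℂ] E} (hL : Continuous L)
    (h3 : AssumptionA3 L) {S : Set ℝ} (hS : IsCompact S) (h0 : (0 : ℝ) ∉ S) :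
    ∃ C ρ : ℝ, 0 < C ∧ 0 < ρ ∧ ρ < 1 ∧ ∀ s ∈ S, ∀ N : ℕ, ‖L s ^ N‖ ≤ C * ρ ^ N := by
  refine hS.induction_on (p := fun S => ∃ C ρ : ℝ, 0 < C ∧ 0 < ρ ∧ ρ < 1 ∧
    ∀ s ∈ S, ∀ N : ℕ, ‖L s ^ N‖ ≤ C * ρ ^ N) ?_ ?_ ?_ ?_
  · exact ⟨1, 1 / 2, one_pos, by norm_num, by norm_num, by simp⟩
  · rintro s t hst ⟨C, ρ, hC, hρ, hρ1, H⟩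
    exact ⟨C, ρ, hC, hρ, hρ1, fun x hx => H x (hst hx)⟩
  · rintro s t ⟨C, ρ, hC, hρ, hρ1, H⟩ ⟨C', ρ', hC', hρ', hρ1', H'⟩
    refine ⟨max C C', max ρ ρ', lt_max_of_lt_left hC, lt_max_of_lt_left hρ, max_lt hρ1 hρ1', ?_⟩
    rintro x (hx | hx) N
    · refine (H x hx N).trans ?_
      gcongr
      exacts [le_max_left _ _, le_max_left _ _]
    · refine (H' x hx N).trans ?_
      gcongr
      exacts [le_max_right _ _, le_max_right _ _]
  · intro x hx
    have hx0 : x ≠ 0 := fun h => h0 (h ▸ hx)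
    have hsub : spectrum ℂ (L x) ⊆ Metric.ball 0 1 := fun z hz => by
      simpa using h3 x hx0 hz
    obtain ⟨C, ρ, hC, hρ, hρ1, hev⟩ := eventually_pow_norm_le_of_spectrum_subset hsub
    exact ⟨{s | ∀ N : ℕ, ‖L s ^ N‖ ≤ C * ρ ^ N},
      mem_nhdsWithin_of_mem_nhds (hL.continuousAt.eventually hev), C, ρ, hC, hρ, hρ1,
      fun s hs => hs⟩

/-- Under (A4), the powers decay faster than any power of `N` on a slightly smaller range. -/
lemma exists_eventually_pow_norm_le {L : ℝ → E →L[ℂ] E} {r₁ : ℝ} (h4 : AssumptionA4 L r₁) :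
    ∃ K : ℝ, 0 < K ∧ ∀ (B q : ℝ) (M : ℕ), q < r₁ → ∀ᶠ N : ℕ in atTop, ∀ s : ℝ, K ≤ |s| →
      |s| ≤ B * (N : ℝ) ^ q → ‖L s ^ N‖ ≤ ((N : ℝ) ^ M)⁻¹ := by
  obtain ⟨hr₁, K, r₂, N₀, hK, hr₂, hN₀, H⟩ := h4
  refine ⟨K, hK, fun B q M hq => ?_⟩
  -- The power `N` is cut into `j` blocks of length `n = N / (j + 1)` and a last block of length at
  -- least `n`. Each of the `j` blocks gains `n ^ (-r₂)`, the last has norm at most `1`. Asking for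
  -- `r₂ j ≥ M + 1` rather than `M` leaves one power of `N` to absorb `c ^ (r₂ j)`, where `N / c ≤
  -- n`.
  obtain ⟨j, hj⟩ := exists_nat_ge ((M + 1) / r₂)
  rw [div_le_iff₀ hr₂] at hj
  set c : ℝ := 2 * (j + 1) with hc
  have hc0 : 0 < c := by positivity
  have hcast : Tendsto (fun N : ℕ => (N : ℝ)) atTop atTop := tendsto_natCast_atTop_atTop
  have e1 : ∀ᶠ N : ℕ in atTop, N₀ < N / c := by
    have := (hcast.atTop_div_const hc0).eventually_gt_atTop N₀
    exact this
  -- The strict inequality `q < r₁` absorbs both `B` and the loss from replacing `N` by the block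
  -- length.
  have e2 : ∀ᶠ N : ℕ in atTop, B * c ^ r₁ ≤ (N : ℝ) ^ (r₁ - q) :=
    ((tendsto_rpow_atTop (by linarith : 0 < r₁ - q)).comp hcast).eventually_ge_atTop _
  have e3 : ∀ᶠ N : ℕ in atTop, c ^ (r₂ * j) ≤ (N : ℝ) := hcast.eventually_ge_atTop _
  filter_upwards [e1, e2, e3, eventually_ge_atTop (2 * (j + 1)), eventually_ge_atTop 1] with
    N h1 h2 h3 h5 h6 s hs1 hs2
  set n := N / (j + 1) with hn
  have hN0 : (0 : ℝ) < N := by exact_mod_cast h6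
  have hnle : (j + 1) * n ≤ N := Nat.mul_div_le N (j + 1)
  have hnge : (N : ℝ) / c ≤ n := by
    have h7 : N < (j + 1) * (n + 1) := Nat.lt_mul_div_succ N (Nat.succ_pos j)
    have h9 : 1 ≤ n := Nat.div_pos (by omega) (Nat.succ_pos j)
    rw [div_le_iff₀ hc0, hc]
    have h7' : (N : ℝ) < (j + 1) * (n + 1) := by exact_mod_cast h7
    have h9' : (1 : ℝ) ≤ n := by exact_mod_cast h9
    nlinarith [mul_le_mul_of_nonneg_left h9' (by positivity : (0 : ℝ) ≤ j + 1)]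
  have hn0 : (0 : ℝ) < n := lt_of_lt_of_le (by positivity) hnge
  have hsn : |s| ≤ (n : ℝ) ^ r₁ := by
    refine hs2.trans ?_
    calc B * (N : ℝ) ^ q = B * c ^ r₁ * (N : ℝ) ^ q / c ^ r₁ := by field_simp
      _ ≤ (N : ℝ) ^ (r₁ - q) * (N : ℝ) ^ q / c ^ r₁ := by gcongr
      _ = ((N : ℝ) / c) ^ r₁ := by
        rw [← Real.rpow_add hN0, sub_add_cancel, Real.div_rpow hN0.le hc0.le]
      _ ≤ _ := Real.rpow_le_rpow (by positivity) hnge hr₁.le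
  have hnN0 : N₀ < n := h1.trans_le hnge
  have hpow : ‖L s ^ n‖ ≤ 1 / (n : ℝ) ^ r₂ := H n s hnN0 hs1 hsn
  have hrest : n ≤ N - j * n := by
    have : (j + 1) * n = j * n + n := by ring
    omega
  have hrest' : (n : ℝ) ≤ ((N - j * n : ℕ) : ℝ) := by exact_mod_cast hrest
  have hlast : ‖L s ^ (N - j * n)‖ ≤ 1 := by
    refine (H _ s (hnN0.trans_le hrest') hs1
      (hsn.trans (Real.rpow_le_rpow hn0.le hrest' hr₁.le))).trans ?_
    rw [div_le_one (Real.rpow_pos_of_pos (hn0.trans_le hrest') _)]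
    refine Real.one_le_rpow ?_ hr₂.le
    have : (1 : ℝ) ≤ n := by
      have : 0 < n := by exact_mod_cast hn0
      exact_mod_cast this
    linarith
  have hsplit : N = n * j + (N - j * n) := by
    rw [mul_comm n j]
    exact (Nat.add_sub_of_le ((Nat.mul_le_mul_right n (Nat.le_succ j)).trans hnle)).symm
  have hpowj : ∀ i : ℕ, ‖(L s ^ n) ^ i * L s ^ (N - j * n)‖ ≤ (1 / (n : ℝ) ^ r₂) ^ i := by
    intro i
    induction i with
    | zero => simpa using hlast
    | succ i ih =>
      rw [pow_succ', pow_succ' (1 / (n : ℝ) ^ r₂), mul_assoc]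
      exact (norm_mul_le _ _).trans (mul_le_mul hpow ih (norm_nonneg _) (by positivity))
  have h8 : ‖L s ^ N‖ ≤ (1 / (n : ℝ) ^ r₂) ^ j := by
    have : L s ^ N = (L s ^ n) ^ j * L s ^ (N - j * n) := by
      rw [← pow_mul, ← pow_add, ← hsplit]
    rw [this]
    exact hpowj j
  refine h8.trans ?_
  rw [one_div, inv_pow, ← Real.rpow_natCast ((n : ℝ) ^ r₂), ← Real.rpow_mul hn0.le]
  refine inv_anti₀ (by positivity) ?_
  calc (N : ℝ) ^ M = (N : ℝ) ^ (M + 1) / N := by rw [pow_succ]; field_simp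
    _ ≤ (N : ℝ) ^ (M + 1) / c ^ (r₂ * j) := by gcongr
    _ ≤ (N : ℝ) ^ (r₂ * j) / c ^ (r₂ * j) := by
      gcongr
      rw [← Real.rpow_natCast]
      refine Real.rpow_le_rpow_of_exponent_le (by exact_mod_cast h6) ?_
      push_cast
      linarith
    _ = ((N : ℝ) / c) ^ (r₂ * j) := by rw [Real.div_rpow hN0.le hc0.le]
    _ ≤ _ := Real.rpow_le_rpow (by positivity) hnge (by positivity)

end Decay

/-! ### Consequences of `φ` being a characteristic function -/

section Symmetry

/-- Uniqueness of a dominant exponential: after division by `a ^ (N + 1)`, the sequence `(b / a) ^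
(N + 1) * u` tends to `w ≠ 0`. Multiplying the sequence by `b / a` only shifts it, so `b / a = 1`.
-/
lemma eq_of_pow_mul_sub_le {a b u w : ℂ} {C ρ : ℝ} (hρ : 0 ≤ ρ) (ha : ρ < ‖a‖) (hw : w ≠ 0)
    (h : ∀ N : ℕ, ‖a ^ (N + 1) * w - b ^ (N + 1) * u‖ ≤ C * ρ ^ N) : a = b ∧ w = u := by
  have ha0 : 0 < ‖a‖ := hρ.trans_lt ha
  have ha' : a ≠ 0 := norm_pos_iff.mp ha0
  have hlim : Tendsto (fun N : ℕ => (b / a) ^ (N + 1) * u) atTop (𝓝 w) := by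
    rw [tendsto_iff_norm_sub_tendsto_zero]
    have hq : Tendsto (fun N : ℕ => C / ‖a‖ * (ρ / ‖a‖) ^ N) atTop (𝓝 (C / ‖a‖ * 0)) :=
      (tendsto_pow_atTop_nhds_zero_of_lt_one (by positivity)
        ((div_lt_one ha0).mpr ha)).const_mul _
    rw [mul_zero] at hq
    refine squeeze_zero (fun _ => norm_nonneg _) (fun N => ?_) hq
    have h1 : (b / a) ^ (N + 1) * u - w =
        -((a ^ (N + 1) * w - b ^ (N + 1) * u) / a ^ (N + 1)) := by
      rw [div_pow, sub_div, mul_div_cancel_left₀ _ (pow_ne_zero _ ha')]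
      ring
    rw [h1, norm_neg, norm_div, norm_pow, div_le_iff₀ (by positivity)]
    refine (h N).trans (le_of_eq ?_)
    rw [div_pow, pow_succ]
    field_simp
  have hlim2 : Tendsto (fun N : ℕ => (b / a) * ((b / a) ^ (N + 1) * u)) atTop (𝓝 w) := by
    refine (hlim.comp (tendsto_add_atTop_nat 1)).congr fun N => ?_
    simp only [Function.comp_apply]
    ring
  have h2 : b / a * w = w := tendsto_nhds_unique (hlim.const_mul (b / a)) hlim2
  have h3 : b / a = 1 := mul_right_cancel₀ hw (by rw [h2, one_mul])
  have h4 : b = a := by rwa [div_eq_one_iff_eq ha'] at h3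
  refine ⟨h4.symm, ?_⟩
  simp only [h3, one_pow, one_mul] at hlim
  exact tendsto_nhds_unique hlim tendsto_const_nhds

lemma norm_le_one_of_pow_mul_le {a w : ℂ} {M : ℝ} (hw : w ≠ 0)
    (h : ∀ N : ℕ, ‖a ^ (N + 1) * w‖ ≤ M) : ‖a‖ ≤ 1 := by
  by_contra! ha
  have hw0 : 0 < ‖w‖ := norm_pos_iff.mpr hw
  obtain ⟨N, hN⟩ := ((tendsto_pow_atTop_atTop_of_one_lt ha).eventually_gt_atTop (M / ‖w‖)).exists
  have h1 := h N
  rw [norm_mul, norm_pow] at h1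
  rw [div_lt_iff₀ hw0] at hN
  have : ‖a‖ ^ N * ‖w‖ ≤ ‖a‖ ^ (N + 1) * ‖w‖ := by
    gcongr
    · exact ha.le
    · omega
  linarith

variable {φ : ℕ → ℝ → ℂ} {lam w : ℝ → ℂ} {C ρ : ℝ}

lemma eq_one_of_expansion (hρ : 0 < ρ) (hρ1 : ρ < 1) (hlam0 : lam 0 = 1)
    (hφ0 : ∀ N, φ N 0 = 1)
    (h : ∀ᶠ s in 𝓝 (0 : ℝ), ∀ N : ℕ, ‖φ (N + 1) s - lam s ^ (N + 1) * w s‖ ≤ C * ρ ^ N) :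
    w 0 = 1 := by
  have h0 := h.self_of_nhds
  simp only [hφ0, hlam0, one_pow, one_mul] at h0
  have hq : Tendsto (fun N : ℕ => C * ρ ^ N) atTop (𝓝 (C * 0)) :=
    (tendsto_pow_atTop_nhds_zero_of_lt_one hρ.le hρ1).const_mul _
  have h1 : ‖1 - w 0‖ ≤ C * 0 := ge_of_tendsto' hq h0
  rw [mul_zero, norm_le_zero_iff, sub_eq_zero] at h1
  exact h1.symm

/-- Both `λ(-s) ^ N w(-s)` and the conjugate of `λ(s) ^ N w(s)` approximate `φ N (-s)` with an error
`O(ρ ^ N)`, so uniqueness of the dominant exponential applies. This symmetry makes the Edgeworth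
polynomials real. -/
lemma eventually_conj_of_expansion (hρ : 0 < ρ) (hρ1 : ρ < 1) (hlam : ContinuousAt lam 0)
    (hw : ContinuousAt w 0) (hlam0 : lam 0 = 1) (hw0 : w 0 = 1)
    (hφ : ∀ N s, φ N (-s) = starRingEnd ℂ (φ N s))
    (h : ∀ᶠ s in 𝓝 (0 : ℝ), ∀ N : ℕ, ‖φ (N + 1) s - lam s ^ (N + 1) * w s‖ ≤ C * ρ ^ N) :
    ∀ᶠ s in 𝓝 (0 : ℝ), lam (-s) = starRingEnd ℂ (lam s) ∧ w (-s) = starRingEnd ℂ (w s) := by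
  have hneg : Tendsto (fun s : ℝ => -s) (𝓝 0) (𝓝 0) := by
    simpa using (continuous_neg (G := ℝ)).tendsto 0
  have h1 : ∀ᶠ s in 𝓝 (0 : ℝ), ρ < ‖lam s‖ :=
    hlam.norm.eventually_const_lt (by simpa [hlam0] using hρ1)
  have h2 : ∀ᶠ s in 𝓝 (0 : ℝ), w s ≠ 0 := hw.eventually_ne (by rw [hw0]; exact one_ne_zero)
  filter_upwards [h, hneg.eventually h, hneg.eventually h1, hneg.eventually h2] with s hs hs' hl hw'
  refine eq_of_pow_mul_sub_le (C := 2 * C) hρ.le hl hw' fun N => ?_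
  have h3 : ‖starRingEnd ℂ (φ (N + 1) s - lam s ^ (N + 1) * w s)‖ ≤ C * ρ ^ N := by
    rw [RCLike.norm_conj]
    exact hs N
  rw [map_sub, map_mul, map_pow, ← hφ] at h3
  have h4 := norm_sub_le (φ (N + 1) (-s) - starRingEnd ℂ (lam s) ^ (N + 1) * starRingEnd ℂ (w s))
    (φ (N + 1) (-s) - lam (-s) ^ (N + 1) * w (-s))
  rw [sub_sub_sub_cancel_left] at h4
  linarith [hs' N]

/-- A leading eigenvalue outside the unit disk would make the bounded `φ` grow. This is what makes
the variance nonnegative. -/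
lemma eventually_norm_le_one_of_expansion (hρ : 0 < ρ) (hρ1 : ρ < 1) (hC : 0 < C)
    (hw : ContinuousAt w 0) (hw0 : w 0 = 1) (hφ1 : ∀ N s, ‖φ N s‖ ≤ 1)
    (h : ∀ᶠ s in 𝓝 (0 : ℝ), ∀ N : ℕ, ‖φ (N + 1) s - lam s ^ (N + 1) * w s‖ ≤ C * ρ ^ N) :
    ∀ᶠ s in 𝓝 (0 : ℝ), ‖lam s‖ ≤ 1 := by
  have h2 : ∀ᶠ s in 𝓝 (0 : ℝ), w s ≠ 0 := hw.eventually_ne (by rw [hw0]; exact one_ne_zero)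
  filter_upwards [h, h2] with s hs hw'
  refine norm_le_one_of_pow_mul_le (M := 1 + C) hw' fun N => ?_
  have h3 := norm_sub_le (φ (N + 1) s) (φ (N + 1) s - lam s ^ (N + 1) * w s)
  rw [sub_sub_cancel] at h3
  have h4 : C * ρ ^ N ≤ C := mul_le_of_le_one_right hC.le (pow_le_one₀ hρ.le hρ1.le)
  linarith [hs N, hφ1 (N + 1) s]

end Symmetry

/-! ### Taylor and cumulant expansions -/

section Taylor

/-- Taylor expansion of a function with `f (-s) = conj (f s)`: the Taylor polynomial is a polynomial
with real coefficients in `i s`. -/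
lemma exists_taylor_of_conj {f : ℝ → ℂ} {n : ℕ} (hf : ContDiffAt ℝ n f 0)
    (hconj : ∀ᶠ s in 𝓝 (0 : ℝ), f (-s) = starRingEnd ℂ (f s)) :
    ∃ W : Polynomial ℝ,
      (fun s : ℝ => f s - Polynomial.aeval (s * Complex.I) W) =o[𝓝 0] fun s => s ^ n := by
  obtain ⟨u, hu, hcd⟩ := hf.contDiffOn le_rfl (by simp)
  obtain ⟨δ, hδ, hball⟩ := Metric.nhds_basis_ball.mem_iff.mp
    (show u ∈ 𝓝 (0 : ℝ) by simpa using hu)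
  have ht := taylor_isLittleO (convex_ball (0 : ℝ) δ) (Metric.mem_ball_self hδ) (hcd.mono hball)
  rw [nhdsWithin_eq_nhds.mpr (Metric.ball_mem_nhds _ hδ)] at ht
  simp only [taylor_within_apply, sub_zero] at ht
  set b : ℕ → ℂ := fun k => ((k.factorial : ℝ)⁻¹ : ℂ) *
    iteratedDerivWithin k f (Metric.ball 0 δ) 0 with hb
  have hp : ∀ s : ℝ, ∑ k ∈ Finset.range (n + 1), ((k.factorial : ℝ)⁻¹ * s ^ k) •
      iteratedDerivWithin k f (Metric.ball 0 δ) 0 = ∑ k ∈ Finset.range (n + 1), (s : ℂ) ^ k * b k := by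
    intro s
    refine Finset.sum_congr rfl fun k _ => ?_
    rw [hb, Complex.real_smul]
    push_cast
    ring
  simp only [hp] at ht
  set W : Polynomial ℝ := ∑ k ∈ Finset.range (n + 1),
    Polynomial.monomial k (b k * (-Complex.I) ^ k).re with hW
  refine ⟨W, ?_⟩
  have hneg : Tendsto (fun s : ℝ => -s) (𝓝 0) (𝓝 0) := by
    simpa using (continuous_neg (G := ℝ)).tendsto 0
  have ht2 := ht.comp_tendsto hneg
  have ht3 : (fun s : ℝ => starRingEnd ℂ (f (-s) -
      ∑ k ∈ Finset.range (n + 1), ((-s : ℝ) : ℂ) ^ k * b k)) =o[𝓝 0] fun s : ℝ => s ^ n := by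
    refine Asymptotics.IsLittleO.of_norm_norm ?_
    refine ht2.norm_norm.congr (fun s => ?_) fun s => ?_
    · simp only [Function.comp_apply, RCLike.norm_conj]
    · simp [Function.comp_apply]
  -- Averaging the Taylor expansion with its reflected conjugate leaves `f` unchanged and
  -- symmetrises the coefficients, so the derivatives of `f` need not be examined.
  refine ((ht.add ht3).const_mul_left (1 / 2 : ℂ)).congr' ?_ EventuallyEq.rfl
  filter_upwards [hconj] with s hs
  have hWs : Polynomial.aeval ((s : ℂ) * Complex.I) W =
      ∑ k ∈ Finset.range (n + 1), (s : ℂ) ^ k * ((b k + (-1) ^ k * starRingEnd ℂ (b k)) / 2) := by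
    rw [hW, map_sum]
    refine Finset.sum_congr rfl fun k _ => ?_
    rw [Polynomial.aeval_monomial, Complex.coe_algebraMap, Complex.re_eq_add_conj]
    simp only [map_mul, map_pow, map_neg, Complex.conj_I, neg_neg]
    have h1 : Complex.I ^ k * (-Complex.I) ^ k = 1 := by rw [← mul_pow]; simp
    have h2 : Complex.I ^ k * Complex.I ^ k = (-1) ^ k := by rw [← mul_pow]; simp
    rw [mul_pow]
    linear_combination ((s : ℂ) ^ k * b k / 2) * h1 + ((s : ℂ) ^ k * starRingEnd ℂ (b k) / 2) * h2
  rw [hWs, map_sub, hs, Complex.conj_conj, map_sum]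
  have h5 : ∀ k, starRingEnd ℂ (((-s : ℝ) : ℂ) ^ k * b k) =
      (s : ℂ) ^ k * ((-1) ^ k * starRingEnd ℂ (b k)) := by
    intro k
    rw [map_mul, map_pow, Complex.conj_ofReal]
    push_cast
    rw [neg_pow]
    ring
  simp only [h5]
  have h6 : ∑ k ∈ Finset.range (n + 1), (s : ℂ) ^ k * ((b k + (-1) ^ k * starRingEnd ℂ (b k)) / 2) =
      (∑ k ∈ Finset.range (n + 1), (s : ℂ) ^ k * b k +
        ∑ k ∈ Finset.range (n + 1), (s : ℂ) ^ k * ((-1) ^ k * starRingEnd ℂ (b k))) / 2 := by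
    rw [← Finset.sum_add_distrib, Finset.sum_div]
    refine Finset.sum_congr rfl fun k _ => ?_
    ring
  rw [h6]
  ring

end Taylor

lemma isLittleO_pow_apply_zero {f : ℝ → ℂ} {n : ℕ} (hn : n ≠ 0)
    (h : f =o[𝓝 0] fun s : ℝ => s ^ n) : f 0 = 0 := by
  have := (h.bound one_pos).self_of_nhds
  simpa [hn] using this

lemma aeval_zero_mul_I (W : Polynomial ℝ) :
    Polynomial.aeval (((0 : ℝ) : ℂ) * Complex.I) W = (W.coeff 0 : ℂ) := by
  rw [Complex.ofReal_zero, zero_mul, Polynomial.aeval_def, Polynomial.eval₂_at_zero]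
  rfl

lemma continuous_aeval_mul_I (W : Polynomial ℝ) :
    Continuous fun s : ℝ => Polynomial.aeval ((s : ℂ) * Complex.I) W := by
  have := W.continuous_aeval (A := ℂ)
  fun_prop

/-- Cumulant expansion of the leading eigenvalue, together with the expansion of the coefficient. -/
lemma exists_cumulant_expansion {lam w : ℝ → ℂ} {r : ℕ} (hr : r ≠ 0)
    (hlam : ContDiffAt ℝ (r + 2 : ℕ) lam 0) (hw : ContDiffAt ℝ (r + 2 : ℕ) w 0)
    (hlam0 : lam 0 = 1) (hw0 : w 0 = 1)
    (hconj : ∀ᶠ s in 𝓝 (0 : ℝ),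
      lam (-s) = starRingEnd ℂ (lam s) ∧ w (-s) = starRingEnd ℂ (w s))
    (hle : ∀ᶠ s in 𝓝 (0 : ℝ), ‖lam s‖ ≤ 1) :
    ∃ (A c : ℝ) (X W : Polynomial ℝ) (χ : ℝ → ℂ), 0 ≤ c ∧ X.coeff 0 = 0 ∧ W.coeff 0 = 1 ∧
      (∀ᶠ s in 𝓝 (0 : ℝ),
        lam s = Complex.exp (s * A * Complex.I - c * s ^ 2 + s ^ 2 * χ s)) ∧
      ((fun s : ℝ => χ s - Polynomial.aeval (s * Complex.I) X) =o[𝓝 0] fun s => s ^ r) ∧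
      ((fun s : ℝ => w s - Polynomial.aeval (s * Complex.I) W) =o[𝓝 0] fun s => s ^ r) := by
  have hslit : ∀ᶠ s in 𝓝 (0 : ℝ), lam s ∈ Complex.slitPlane := by
    refine hlam.continuousAt.eventually (Complex.isOpen_slitPlane.mem_nhds ?_)
    rw [hlam0]
    exact Complex.one_mem_slitPlane
  set κ : ℝ → ℂ := fun s => Complex.log (lam s) with hκ
  have hκc : ContDiffAt ℝ (r + 2 : ℕ) κ 0 :=
    ((Complex.contDiffAt_log hslit.self_of_nhds).restrict_scalars ℝ).comp (0 : ℝ) hlam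
  have hκconj : ∀ᶠ s in 𝓝 (0 : ℝ), κ (-s) = starRingEnd ℂ (κ s) := by
    filter_upwards [hconj, hslit] with s hs hsl
    simp only [hκ]
    rw [hs.1, Complex.log_conj _ (Complex.slitPlane_arg_ne_pi hsl)]
  have hκ0 : κ 0 = 0 := by simp [hκ, hlam0]
  obtain ⟨V, hV⟩ := exists_taylor_of_conj hκc hκconj
  obtain ⟨W, hW⟩ := exists_taylor_of_conj hw (hconj.mono fun s hs => hs.2)
  have hV0 : V.coeff 0 = 0 := by
    have := isLittleO_pow_apply_zero (by omega) hV
    rw [hκ0, aeval_zero_mul_I, zero_sub, neg_eq_zero] at this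
    exact_mod_cast this
  have hW0 : W.coeff 0 = 1 := by
    have := isLittleO_pow_apply_zero (by omega) hW
    rw [hw0, aeval_zero_mul_I, sub_eq_zero] at this
    exact_mod_cast this.symm
  set A := V.divX.coeff 0 with hA
  set c := V.divX.divX.coeff 0 with hc
  set Y := V.divX.divX.divX with hY
  have hVeval : ∀ z : ℂ, Polynomial.aeval z V =
      ((Polynomial.aeval z Y * z + c) * z + A) * z := by
    intro z
    conv_lhs => rw [← V.divX_mul_X_add, ← V.divX.divX_mul_X_add, ← V.divX.divX.divX_mul_X_add]
    simp [hV0, hA, hc, hY]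
  -- With `z = i s`, `V(z) = A z + c z² + Y(z) z³`; since `z² = -s²`, this is `i A s - c s² + s²
  -- X(z)` for `X = -Y z`. Division by `s²` lowers the order of the error from `r + 2` to `r`.
  set X : Polynomial ℝ := -(Y * Polynomial.X) with hX
  set χ : ℝ → ℂ := fun s => (κ s - s * A * Complex.I + c * s ^ 2) / s ^ 2 with hχ
  have hX0 : X.coeff 0 = 0 := by simp [hX]
  have hχX : (fun s : ℝ => χ s - Polynomial.aeval (s * Complex.I) X) =o[𝓝 0] fun s => s ^ r := by
    have h1 := hV.mul_isBigO (Asymptotics.isBigO_refl (fun s : ℝ => ((s : ℂ) ^ 2)⁻¹) (𝓝 0)).norm_right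
    have h2 : (fun s : ℝ => s ^ (r + 2) * ‖((s : ℂ) ^ 2)⁻¹‖) = fun s : ℝ => s ^ r := by
      ext s
      rcases eq_or_ne s 0 with rfl | hs
      · simp [hr]
      · rw [norm_inv, norm_pow, Complex.norm_real, Real.norm_eq_abs, sq_abs, pow_add]
        field_simp
    have h3 : (fun s : ℝ => (κ s - Polynomial.aeval (s * Complex.I) V) * ((s : ℂ) ^ 2)⁻¹) =
        fun s : ℝ => χ s - Polynomial.aeval (s * Complex.I) X := by
      ext s
      rcases eq_or_ne s 0 with rfl | hs
      · rw [aeval_zero_mul_I X, hX0]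
        simp [hχ]
      · have hs' : (s : ℂ) ≠ 0 := by exact_mod_cast hs
        simp only [hχ, hVeval, hX, map_neg, map_mul, Polynomial.aeval_X]
        field_simp
        have : Complex.I ^ 2 = -1 := Complex.I_sq
        linear_combination (-(s : ℂ) ^ 2 * c - (s : ℂ) ^ 3 *
          Polynomial.aeval ((s : ℂ) * Complex.I) Y * Complex.I) * this
    rw [← h3, ← h2]
    exact h1
  have hχ0 : Tendsto χ (𝓝 0) (𝓝 0) := by
    have h1 : Tendsto (fun s : ℝ => χ s - Polynomial.aeval (s * Complex.I) X) (𝓝 0) (𝓝 0) := by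
      refine hχX.trans_tendsto ?_
      simpa [hr] using (continuous_pow (M := ℝ) r).tendsto 0
    have h2 := (continuous_aeval_mul_I X).tendsto 0
    rw [aeval_zero_mul_I, hX0, Complex.ofReal_zero] at h2
    simpa using h1.add h2
  have hexp : ∀ᶠ s in 𝓝 (0 : ℝ),
      lam s = Complex.exp (s * A * Complex.I - c * s ^ 2 + s ^ 2 * χ s) := by
    filter_upwards [hslit] with s hs
    have h1 : κ s = s * A * Complex.I - c * s ^ 2 + s ^ 2 * χ s := by
      rcases eq_or_ne s 0 with rfl | hs0
      · simp [hκ0]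
      · have hs' : (s : ℂ) ≠ 0 := by exact_mod_cast hs0
        simp only [hχ]
        field_simp
        ring
    rw [← h1, hκ, Complex.exp_log (Complex.slitPlane_ne_zero hs)]
  refine ⟨A, c, X, W, χ, ?_, hX0, hW0, hexp, hχX, ?_⟩
  -- For `s ≠ 0` the bound `|λ(s)| ≤ 1` reads `Re χ(s) ≤ c`, and `χ(s) → 0`.
  · have h1 : ∀ᶠ s in 𝓝[≠] (0 : ℝ), (χ s).re ≤ c := by
      filter_upwards [hexp.filter_mono nhdsWithin_le_nhds, hle.filter_mono nhdsWithin_le_nhds,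
        self_mem_nhdsWithin] with s h1 h2 h3
      rw [h1, Complex.norm_exp, Real.exp_le_one_iff] at h2
      have h4 : ((s : ℂ) * A * Complex.I - c * s ^ 2 + s ^ 2 * χ s).re =
          s ^ 2 * ((χ s).re - c) := by
        rw [← Complex.ofReal_pow]
        simp only [Complex.add_re, Complex.sub_re, Complex.re_ofReal_mul, ← Complex.ofReal_mul,
          Complex.I_re, mul_zero, Complex.ofReal_re]
        ring
      rw [h4] at h2
      have h5 : 0 < s ^ 2 := by
        have : s ≠ 0 := h3
        positivity
      nlinarith
    have h2 : Tendsto (fun s => (χ s).re) (𝓝[≠] 0) (𝓝 0) := by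
      exact ((Complex.continuous_re.tendsto 0).comp hχ0).mono_left nhdsWithin_le_nhds
    exact le_of_tendsto h2 h1
  · refine hW.trans_isBigO (Asymptotics.IsBigO.of_bound 1 ?_)
    filter_upwards [Metric.ball_mem_nhds (0 : ℝ) one_pos] with s hs
    rw [norm_pow, norm_pow, one_mul]
    exact pow_le_pow_of_le_one (norm_nonneg _) (by simpa using (mem_ball_zero_iff.mp hs).le) (by omega)

/-! ### Expansion of the characteristic function in powers of `s` -/

lemma exists_norm_aeval_sub_sum_le (V : Polynomial ℝ) (r : ℕ) :
    ∃ K : ℝ, 0 ≤ K ∧ ∀ s : ℝ, |s| ≤ 1 →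
      ‖Polynomial.aeval (s * Complex.I) V -
        ∑ p ∈ Finset.range (r + 1), (s * Complex.I) ^ p * (V.coeff p : ℂ)‖ ≤ K * |s| ^ (r + 1) := by
  refine ⟨∑ i ∈ Finset.range (V.natDegree + 1), |V.coeff (r + 1 + i)|,
    Finset.sum_nonneg fun _ _ => abs_nonneg _, fun s hs => ?_⟩
  have h1 : Polynomial.aeval ((s : ℂ) * Complex.I) V =
      ∑ i ∈ Finset.range (r + 1 + (V.natDegree + 1)), (s * Complex.I) ^ i * (V.coeff i : ℂ) := by
    rw [Polynomial.aeval_eq_sum_range' (n := r + 1 + (V.natDegree + 1)) (by omega)]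
    refine Finset.sum_congr rfl fun i _ => ?_
    rw [Complex.real_smul, mul_comm]
  rw [h1, Finset.sum_range_add, add_sub_cancel_left, Finset.sum_mul]
  refine (norm_sum_le _ _).trans (Finset.sum_le_sum fun i _ => ?_)
  rw [norm_mul, norm_pow, norm_mul, Complex.norm_I, mul_one, Complex.norm_real, Complex.norm_real,
    Real.norm_eq_abs, Real.norm_eq_abs, mul_comm]
  exact mul_le_mul_of_nonneg_left (pow_le_pow_of_le_one (abs_nonneg _) hs (by omega))
    (abs_nonneg _)

lemma norm_exp_sub_exp_le (a b : ℂ) :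
    ‖Complex.exp a - Complex.exp b‖ ≤ ‖a - b‖ * Real.exp (‖b‖ + ‖a - b‖) := by
  have h1 : Complex.exp a - Complex.exp b = Complex.exp b * (Complex.exp (a - b) - 1) := by
    rw [mul_sub, ← Complex.exp_add, mul_one, add_sub_cancel]
  have h2 := Complex.norm_exp_sub_sum_le_norm_mul_exp (a - b) 1
  simp only [Finset.range_one, Finset.sum_singleton, pow_zero, Nat.factorial_zero, Nat.cast_one,
    div_one, pow_one] at h2
  rw [h1, norm_mul, Real.exp_add]
  calc _ ≤ Real.exp ‖b‖ * (‖a - b‖ * Real.exp ‖a - b‖) := by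
        gcongr
        exact Complex.norm_exp_le_exp_norm b
    _ = _ := by ring

/-- The expansion of `exp (t² χ(s)) w(s)` in powers of `s`, with an error that is small compared with
`|s| ^ r` up to a Gaussian factor in `t`. -/
lemma exists_expansion_bound {c : ℝ} (hc : 0 < c) {r : ℕ} {X W : Polynomial ℝ}
    {χ w : ℝ → ℂ} (hX0 : X.coeff 0 = 0) (hW0 : W.coeff 0 = 1)
    (hχ : (fun s : ℝ => χ s - Polynomial.aeval (s * Complex.I) X) =o[𝓝 0] fun s => s ^ r)
    (hw : (fun s : ℝ => w s - Polynomial.aeval (s * Complex.I) W) =o[𝓝 0] fun s => s ^ r) :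
    ∃ C : ℝ, 0 ≤ C ∧ ∀ η : ℝ, 0 < η → ∀ᶠ s in 𝓝 (0 : ℝ), ∀ t : ℝ,
      ‖Complex.exp (t ^ 2 * χ s) * w s - ∑ p ∈ Finset.range (r + 1), (s * Complex.I) ^ p *
        ∑ m ∈ Finset.range (r + 1), (t : ℂ) ^ (2 * m) * ((X ^ m * W).coeff p / m.factorial : ℝ)‖ ≤
      η * |s| ^ r * (C * Real.exp (c / 2 * t ^ 2)) := by
  -- The allowed growth `exp (c t² / 2)` is split into two factors `exp (c t² / 4)`: one absorbs
  -- powers of `t`, the other the exponential of `t² χ(s)` or of its polynomial approximation.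
  have hb4 : 0 < c / 4 := by positivity
  choose G hG0 hG using fun n => pow_le_const_mul_exp n hb4
  choose K hK0 hK using fun m : ℕ => exists_norm_aeval_sub_sum_le (X ^ m * W) r
  obtain ⟨KX, hKX0, hKX⟩ := exists_norm_aeval_sub_sum_le X 0
  refine ⟨2 * G 2 + 2 * KX ^ (r + 1) * G (2 * (r + 1)) + 1 +
    ∑ m ∈ Finset.range (r + 1), K m * G (2 * m), ?_, fun η hη => ?_⟩
  · have := hG0 2
    have := hG0 (2 * (r + 1))
    have : 0 ≤ ∑ m ∈ Finset.range (r + 1), K m * G (2 * m) :=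
      Finset.sum_nonneg fun m _ => mul_nonneg (hK0 m) (hG0 _)
    positivity
  have hsmall : ∀ {ε : ℝ}, 0 < ε → ∀ᶠ s : ℝ in 𝓝 0, |s| ≤ ε := fun hε => by
    filter_upwards [Metric.closedBall_mem_nhds (0 : ℝ) hε] with s hs
    simpa using hs
  have e1 : ∀ᶠ s : ℝ in 𝓝 0, ‖Polynomial.aeval (s * Complex.I) X‖ < c / 16 := by
    have h := (continuous_aeval_mul_I X).norm.tendsto 0
    rw [aeval_zero_mul_I, hX0, Complex.ofReal_zero, norm_zero] at h
    exact h.eventually_lt_const (by positivity)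
  have e2 : ∀ᶠ s : ℝ in 𝓝 0, ‖Polynomial.aeval (s * Complex.I) W‖ < 3 / 2 := by
    have h := (continuous_aeval_mul_I W).norm.tendsto 0
    rw [aeval_zero_mul_I, hW0, Complex.ofReal_one, norm_one] at h
    exact h.eventually_lt_const (by norm_num)
  filter_upwards [e1, e2, hsmall hη, hsmall one_pos, hχ.bound hη,
    hχ.bound (show 0 < c / 16 by positivity), hw.bound hη,
    hw.bound (show (0 : ℝ) < 1 / 2 by norm_num)] with s h1 h2 h3 h4 h5 h6 h7 h8 t
  have hpow1 : ‖s ^ r‖ ≤ 1 := by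
    rw [norm_pow]
    exact pow_le_one₀ (norm_nonneg _) h4
  have habs : ‖s ^ r‖ = |s| ^ r := by rw [norm_pow, Real.norm_eq_abs]
  have h6' : ‖χ s - Polynomial.aeval (s * Complex.I) X‖ ≤ c / 16 :=
    h6.trans (mul_le_of_le_one_right (by positivity) hpow1)
  have hws : ‖w s‖ ≤ 2 := by
    have := h8.trans (mul_le_of_le_one_right (by norm_num) hpow1)
    have := norm_le_norm_add_norm_sub' (w s) (Polynomial.aeval (s * Complex.I) W)
    linarith
  rw [habs] at h5 h7
  set x := Polynomial.aeval ((s : ℂ) * Complex.I) X with hx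
  set y := Polynomial.aeval ((s : ℂ) * Complex.I) W with hy
  have hxK : ‖x‖ ≤ KX * |s| := by
    have := hKX s h4
    simpa [hX0] using this
  -- Terms of order `r + 1` are small relative to `|s| ^ r` because `|s| ≤ η`.
  have hsr : |s| ^ (r + 1) ≤ η * |s| ^ r := by
    rw [pow_succ, mul_comm]
    gcongr
  have ht2 : ‖(t : ℂ) ^ 2‖ = t ^ 2 := by
    rw [norm_pow, Complex.norm_real, Real.norm_eq_abs, sq_abs]
  have hnb : ‖(t : ℂ) ^ 2 * x‖ ≤ c / 16 * t ^ 2 := by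
    rw [norm_mul, ht2, mul_comm]
    gcongr
  set e := Real.exp (c / 4 * t ^ 2) with he
  have hee : Real.exp (c / 2 * t ^ 2) = e * e := by
    rw [he, ← Real.exp_add]
    congr 1
    ring
  have he1 : 1 ≤ e := Real.one_le_exp (by positivity)
  have hexpb : Real.exp ‖(t : ℂ) ^ 2 * x‖ ≤ e := by
    refine Real.exp_le_exp.mpr (hnb.trans ?_)
    gcongr
    norm_num
  set q := η * |s| ^ r with hq
  have hq0 : 0 ≤ q := by positivity
  have hT1 : ‖(Complex.exp (t ^ 2 * χ s) - Complex.exp (t ^ 2 * x)) * w s‖ ≤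
      q * (2 * G 2) * (e * e) := by
    have h9 : ‖(t : ℂ) ^ 2 * χ s - t ^ 2 * x‖ = t ^ 2 * ‖χ s - x‖ := by
      rw [← mul_sub, norm_mul, ht2]
    have h10 := norm_exp_sub_exp_le (t ^ 2 * χ s) (t ^ 2 * x)
    have h11 : Real.exp (‖(t : ℂ) ^ 2 * x‖ + ‖(t : ℂ) ^ 2 * χ s - t ^ 2 * x‖) ≤ e := by
      refine Real.exp_le_exp.mpr ?_
      rw [h9]
      have : t ^ 2 * ‖χ s - x‖ ≤ t ^ 2 * (c / 16) := by gcongr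
      nlinarith [mul_nonneg hc.le (sq_nonneg t)]
    have h12 : t ^ 2 ≤ G 2 * e := by
      have := hG 2 t
      rwa [sq_abs] at this
    have hG2 := hG0 2
    rw [h9] at h10 h11
    rw [norm_mul]
    calc _ ≤ (t ^ 2 * ‖χ s - x‖ * e) * 2 := by
          gcongr
          exact h10.trans (by gcongr)
      _ ≤ (G 2 * e * q * e) * 2 := by gcongr
      _ = _ := by ring
  have hT2 : ‖(Complex.exp (t ^ 2 * x) - ∑ m ∈ Finset.range (r + 1),
      ((t : ℂ) ^ 2 * x) ^ m / m.factorial) * w s‖ ≤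
      q * (2 * KX ^ (r + 1) * G (2 * (r + 1))) * (e * e) := by
    have h9 := Complex.norm_exp_sub_sum_le_norm_mul_exp ((t : ℂ) ^ 2 * x) (r + 1)
    have h10 : ‖(t : ℂ) ^ 2 * x‖ ^ (r + 1) ≤ G (2 * (r + 1)) * e * (KX ^ (r + 1) * q) := by
      rw [norm_mul, ht2, mul_pow]
      have h11 : (t ^ 2) ^ (r + 1) ≤ G (2 * (r + 1)) * e := by
        have := hG (2 * (r + 1)) t
        rwa [pow_mul, sq_abs] at this
      have h12 : ‖x‖ ^ (r + 1) ≤ KX ^ (r + 1) * q := by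
        calc _ ≤ (KX * |s|) ^ (r + 1) := by gcongr
          _ = KX ^ (r + 1) * |s| ^ (r + 1) := mul_pow _ _ _
          _ ≤ _ := by gcongr
      exact mul_le_mul h11 h12 (by positivity) (mul_nonneg (hG0 _) (by positivity))
    rw [norm_mul]
    calc _ ≤ (G (2 * (r + 1)) * e * (KX ^ (r + 1) * q) * e) * 2 := by
          refine mul_le_mul (h9.trans ?_) hws (norm_nonneg _) ?_
          · exact mul_le_mul h10 hexpb (Real.exp_pos _).le (le_trans (by positivity) h10)
          · have := hG0 (2 * (r + 1))
            positivity
      _ = _ := by ring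
  have hT3 : ‖(∑ m ∈ Finset.range (r + 1), ((t : ℂ) ^ 2 * x) ^ m / m.factorial) * (w s - y)‖ ≤
      q * 1 * (e * e) := by
    have h9 : ‖∑ m ∈ Finset.range (r + 1), ((t : ℂ) ^ 2 * x) ^ m / (m.factorial : ℂ)‖ ≤ e := by
      refine ((norm_sum_le _ _).trans (le_of_eq ?_)).trans
        ((Real.sum_le_exp_of_nonneg (norm_nonneg ((t : ℂ) ^ 2 * x)) (r + 1)).trans hexpb)
      refine Finset.sum_congr rfl fun m _ => ?_
      rw [norm_div, norm_pow, Complex.norm_natCast]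
    rw [norm_mul]
    calc _ ≤ e * q := by gcongr
      _ = q * 1 * (e * 1) := by ring
      _ ≤ _ := by gcongr
  have hT4 : ‖(∑ m ∈ Finset.range (r + 1), ((t : ℂ) ^ 2 * x) ^ m / m.factorial) * y -
      ∑ p ∈ Finset.range (r + 1), (s * Complex.I) ^ p *
        ∑ m ∈ Finset.range (r + 1), (t : ℂ) ^ (2 * m) * ((X ^ m * W).coeff p / m.factorial : ℝ)‖ ≤
      q * (∑ m ∈ Finset.range (r + 1), K m * G (2 * m)) * (e * e) := by
    have h9 : (∑ m ∈ Finset.range (r + 1), ((t : ℂ) ^ 2 * x) ^ m / m.factorial) * y -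
      ∑ p ∈ Finset.range (r + 1), (s * Complex.I) ^ p *
        ∑ m ∈ Finset.range (r + 1), (t : ℂ) ^ (2 * m) * ((X ^ m * W).coeff p / m.factorial : ℝ) =
      ∑ m ∈ Finset.range (r + 1), (t : ℂ) ^ (2 * m) / m.factorial *
        (Polynomial.aeval ((s : ℂ) * Complex.I) (X ^ m * W) -
          ∑ p ∈ Finset.range (r + 1), (s * Complex.I) ^ p * ((X ^ m * W).coeff p : ℂ)) := by
      simp only [mul_sub, Finset.sum_sub_distrib, Finset.mul_sum]
      rw [Finset.sum_comm (s := Finset.range (r + 1)) (t := Finset.range (r + 1)), Finset.sum_mul]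
      congr 1
      · refine Finset.sum_congr rfl fun m _ => ?_
        rw [map_mul, map_pow, ← hx, ← hy]
        ring
      · refine Finset.sum_congr rfl fun m _ => Finset.sum_congr rfl fun p _ => ?_
        push_cast
        ring
    rw [h9, Finset.mul_sum, Finset.sum_mul]
    refine (norm_sum_le _ _).trans (Finset.sum_le_sum fun m _ => ?_)
    rw [norm_mul]
    have h10 : ‖(t : ℂ) ^ (2 * m) / (m.factorial : ℂ)‖ ≤ G (2 * m) * e := by
      rw [norm_div, norm_pow, Complex.norm_real, Complex.norm_natCast, Real.norm_eq_abs]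
      exact (div_le_self (by positivity) (Nat.one_le_cast.mpr
        (Nat.factorial_pos m))).trans (hG _ t)
    have hGm := hG0 (2 * m)
    have hKm := hK0 m
    calc _ ≤ G (2 * m) * e * (K m * q) := by
          gcongr
          exact (hK m s h4).trans (by gcongr)
      _ = q * (K m * G (2 * m)) * (e * 1) := by ring
      _ ≤ _ := by gcongr
  -- Four errors: replacing `χ` by its polynomial, truncating the exponential series, replacing `w`
  -- by its polynomial, and dropping powers of `s` beyond `r`.
  have hsplit : Complex.exp (t ^ 2 * χ s) * w s - ∑ p ∈ Finset.range (r + 1), (s * Complex.I) ^ p *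
        ∑ m ∈ Finset.range (r + 1), (t : ℂ) ^ (2 * m) * ((X ^ m * W).coeff p / m.factorial : ℝ) =
      (Complex.exp (t ^ 2 * χ s) - Complex.exp (t ^ 2 * x)) * w s +
      (Complex.exp (t ^ 2 * x) - ∑ m ∈ Finset.range (r + 1),
        ((t : ℂ) ^ 2 * x) ^ m / m.factorial) * w s +
      (∑ m ∈ Finset.range (r + 1), ((t : ℂ) ^ 2 * x) ^ m / m.factorial) * (w s - y) +
      ((∑ m ∈ Finset.range (r + 1), ((t : ℂ) ^ 2 * x) ^ m / m.factorial) * y -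
        ∑ p ∈ Finset.range (r + 1), (s * Complex.I) ^ p *
          ∑ m ∈ Finset.range (r + 1),
            (t : ℂ) ^ (2 * m) * ((X ^ m * W).coeff p / m.factorial : ℝ)) := by ring
  rw [hsplit, hee]
  refine (norm_add_le _ _).trans ?_
  have := (norm_add_le _ _).trans (add_le_add ((norm_add_le _ _).trans (add_le_add hT1 hT2)) hT3)
  linarith [hT4]

/-- The polynomial `a` for which `a (i t)` is the coefficient of `N ^ (-p / 2)` in the expansion of the
characteristic function divided by its Gaussian factor. -/
noncomputable def edgeworthSymbol (X W : Polynomial ℝ) (r p : ℕ) : Polynomial ℝ :=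
  ∑ m ∈ Finset.range (r + 1),
    Polynomial.monomial (p + 2 * m) ((-1) ^ m * ((X ^ m * W).coeff p / m.factorial))

lemma edgeworthSymbol_coeff_zero (X W : Polynomial ℝ) (r : ℕ) {p : ℕ} (hp : p ≠ 0) :
    (edgeworthSymbol X W r p).coeff 0 = 0 := by
  rw [edgeworthSymbol, Polynomial.finsetSum_coeff]
  refine Finset.sum_eq_zero fun m _ => ?_
  rw [Polynomial.coeff_monomial, if_neg (by omega)]

lemma aeval_edgeworthSymbol (X W : Polynomial ℝ) (r p : ℕ) (t : ℝ) :
    Polynomial.aeval (t * Complex.I) (edgeworthSymbol X W r p) =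
      (t * Complex.I) ^ p * ∑ m ∈ Finset.range (r + 1),
        (t : ℂ) ^ (2 * m) * ((X ^ m * W).coeff p / m.factorial : ℝ) := by
  rw [edgeworthSymbol, map_sum, Finset.mul_sum]
  refine Finset.sum_congr rfl fun m _ => ?_
  rw [Polynomial.aeval_monomial, Complex.coe_algebraMap, pow_add, mul_pow _ _ (2 * m), pow_mul Complex.I,
    Complex.I_sq]
  have h1 : ((-1 : ℂ)) ^ m * (-1) ^ m = 1 := by rw [← mul_pow]; simp
  push_cast
  linear_combination ((t * Complex.I) ^ p * (t : ℂ) ^ (2 * m) *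
    ((X ^ m * W).coeff p / m.factorial)) * h1

/-- The term `p = 0` equals `1`: the constant coefficient of `X ^ m * W` is `1` for `m = 0` and `0`
otherwise. -/
lemma sum_expansion_eq {X W : Polynomial ℝ} (hX0 : X.coeff 0 = 0) (hW0 : W.coeff 0 = 1) (r : ℕ)
    {a : ℝ} (t : ℝ) :
    ∑ p ∈ Finset.range (r + 1), (((t / a : ℝ) : ℂ) * Complex.I) ^ p *
        ∑ m ∈ Finset.range (r + 1), (t : ℂ) ^ (2 * m) * ((X ^ m * W).coeff p / m.factorial : ℝ) =
      1 + ∑ p ∈ Finset.Icc 1 r,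
        Polynomial.aeval (t * Complex.I) (edgeworthSymbol X W r p) / (a : ℂ) ^ p := by
  rw [Finset.sum_range_eq_add_Ico _ (Nat.succ_pos r)]
  congr 1
  · rw [pow_zero, one_mul, Finset.sum_range_succ', Finset.sum_eq_zero]
    · simp [hW0]
    · intro m _
      rw [Polynomial.mul_coeff_zero, Polynomial.coeff_zero_eq_eval_zero (X ^ (m + 1)),
        Polynomial.eval_pow, ← Polynomial.coeff_zero_eq_eval_zero, hX0]
      simp
  · refine Finset.sum_congr (by ext; simp) fun p _ => ?_
    rw [aeval_edgeworthSymbol]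
    push_cast
    rw [div_mul_eq_mul_div, div_pow]
    ring

lemma exists_norm_aeval_le (q : Polynomial ℝ) {b : ℝ} (hb : 0 < b) :
    ∃ C : ℝ, 0 ≤ C ∧ ∀ t : ℝ,
      ‖Polynomial.aeval (t * Complex.I) q‖ ≤ C * Real.exp (b * t ^ 2) := by
  induction q using Polynomial.induction_on' with
  | add p q hp hq =>
    obtain ⟨C₁, h₁, H₁⟩ := hp
    obtain ⟨C₂, h₂, H₂⟩ := hq
    refine ⟨C₁ + C₂, by positivity, fun x => ?_⟩
    rw [map_add, add_mul]
    exact (norm_add_le _ _).trans (add_le_add (H₁ x) (H₂ x))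
  | monomial n a =>
    obtain ⟨C, hC, H⟩ := pow_le_const_mul_exp n hb
    refine ⟨|a| * C, by positivity, fun x => ?_⟩
    rw [Polynomial.aeval_monomial, Complex.coe_algebraMap, norm_mul, norm_pow, norm_mul,
      Complex.norm_I, mul_one, Complex.norm_real, Complex.norm_real, mul_assoc]
    exact mul_le_mul_of_nonneg_left (H x) (abs_nonneg _)

lemma exists_norm_gaussian_symbol_le {c : ℝ} (hc : 0 < c) (r : ℕ) (a : ℕ → Polynomial ℝ) :
    ∃ C : ℝ, 0 ≤ C ∧ ∀ y : ℝ, 1 ≤ y → ∀ t : ℝ,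
      ‖Complex.exp (-(c * t ^ 2)) * (1 + ∑ p ∈ Finset.Icc 1 r,
        Polynomial.aeval (t * Complex.I) (a p) / (y : ℂ) ^ p)‖ ≤
        C * Real.exp (-(c / 2) * t ^ 2) := by
  choose G hG0 hG using fun p => exists_norm_aeval_le (a p) (half_pos hc)
  refine ⟨1 + ∑ p ∈ Finset.Icc 1 r, G p,
    add_nonneg zero_le_one (Finset.sum_nonneg fun _ _ => hG0 _), fun y hy t => ?_⟩
  have h1 : ‖Complex.exp (-(c * t ^ 2))‖ =
      Real.exp (-(c / 2) * t ^ 2) * Real.exp (-(c / 2) * t ^ 2) := by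
    rw [← Complex.ofReal_pow, ← Complex.ofReal_mul, ← Complex.ofReal_neg, Complex.norm_exp_ofReal,
      ← Real.exp_add]
    congr 1
    ring
  have h2 : Real.exp (-(c / 2) * t ^ 2) * Real.exp (c / 2 * t ^ 2) = 1 := by
    rw [← Real.exp_add, ← Real.exp_zero]
    congr 1
    ring
  have he : 1 ≤ Real.exp (c / 2 * t ^ 2) := Real.one_le_exp (by positivity)
  have h3 : ‖1 + ∑ p ∈ Finset.Icc 1 r, Polynomial.aeval (t * Complex.I) (a p) / (y : ℂ) ^ p‖ ≤
      (1 + ∑ p ∈ Finset.Icc 1 r, G p) * Real.exp (c / 2 * t ^ 2) := by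
    rw [add_mul, one_mul, Finset.sum_mul]
    refine (norm_add_le _ _).trans (add_le_add (by simpa using he)
      ((norm_sum_le _ _).trans (Finset.sum_le_sum fun p _ => ?_)))
    rw [norm_div, norm_pow, Complex.norm_real]
    refine (div_le_self (norm_nonneg _) (one_le_pow₀ ?_)).trans (hG p t)
    rwa [Real.norm_of_nonneg (by linarith)]
  rw [norm_mul, h1]
  calc _ ≤ Real.exp (-(c / 2) * t ^ 2) * Real.exp (-(c / 2) * t ^ 2) *
        ((1 + ∑ p ∈ Finset.Icc 1 r, G p) * Real.exp (c / 2 * t ^ 2)) := by gcongr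
    _ = (1 + ∑ p ∈ Finset.Icc 1 r, G p) * Real.exp (-(c / 2) * t ^ 2) *
        (Real.exp (-(c / 2) * t ^ 2) * Real.exp (c / 2 * t ^ 2)) := by ring
    _ = _ := by rw [h2, mul_one]

/-- Centring cancels the drift, and the scaling `s = t / √N` gives `N s² = t²`. -/
lemma exp_mul_pow_eq {lam : ℂ} {χ : ℂ} {A c t : ℝ} {N : ℕ} (hN : 1 ≤ N)
    (hlam : lam = Complex.exp ((t / √(N : ℝ) : ℝ) * A * Complex.I - c * (t / √(N : ℝ) : ℝ) ^ 2 +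
      (t / √(N : ℝ) : ℝ) ^ 2 * χ)) :
    Complex.exp (-((t / √(N : ℝ) : ℝ) * N * A * Complex.I)) * lam ^ N =
      Complex.exp (-(c * t ^ 2)) * Complex.exp (t ^ 2 * χ) := by
  have hN0 : (0 : ℝ) < N := by exact_mod_cast hN
  have h1 : (N : ℂ) * ((t / √(N : ℝ) : ℝ) : ℂ) ^ 2 = t ^ 2 := by
    have : (N : ℝ) * (t / √(N : ℝ)) ^ 2 = t ^ 2 := by
      rw [div_pow, Real.sq_sqrt hN0.le]
      field_simp
    exact_mod_cast this
  rw [hlam, ← Complex.exp_nat_mul, ← Complex.exp_add, ← Complex.exp_add]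
  congr 1
  linear_combination (-c + χ) * h1

/-! ### Estimates for the characteristic function of the normalised sum -/

section Assembly

variable {φ : ℕ → ℝ → ℂ} {lam w χ : ℝ → ℂ} {X W : Polynomial ℝ} {A c C₁ ρ : ℝ} {r : ℕ}

/-- Only pointwise convergence is claimed, so `c = 0` is allowed and the degenerate limit law is
covered. -/
lemma tendsto_gaussian_of_expansion (hρ : 0 < ρ) (hρ1 : ρ < 1) (hr : r ≠ 0)
    (hX0 : X.coeff 0 = 0) (hW0 : W.coeff 0 = 1)
    (hφ : ∀ᶠ s in 𝓝 (0 : ℝ), ∀ N : ℕ, 1 ≤ N →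
      ‖φ N s - lam s ^ N * w s‖ ≤ C₁ * N * ρ ^ N * |s|)
    (hlam : ∀ᶠ s in 𝓝 (0 : ℝ),
        lam s = Complex.exp (s * A * Complex.I - c * s ^ 2 + s ^ 2 * χ s))
    (hχ : (fun s : ℝ => χ s - Polynomial.aeval (s * Complex.I) X) =o[𝓝 0] fun s => s ^ r)
    (hw : (fun s : ℝ => w s - Polynomial.aeval (s * Complex.I) W) =o[𝓝 0] fun s => s ^ r) (t : ℝ) :
    Tendsto (fun N : ℕ => Complex.exp (-((t / √(N : ℝ) : ℝ) * N * A * Complex.I)) *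
      φ N (t / √(N : ℝ))) atTop (𝓝 (Complex.exp (-(c * t ^ 2)))) := by
  have hs : Tendsto (fun N : ℕ => t / √(N : ℝ)) atTop (𝓝 0) :=
    tendsto_const_nhds.div_atTop (Real.tendsto_sqrt_atTop.comp tendsto_natCast_atTop_atTop)
  have hlim : ∀ {f : ℝ → ℂ} {V : Polynomial ℝ},
      ((fun s : ℝ => f s - Polynomial.aeval (s * Complex.I) V) =o[𝓝 0] fun s => s ^ r) →
      Tendsto f (𝓝 0) (𝓝 (V.coeff 0 : ℂ)) := by
    intro f V hf
    have h1 : Tendsto (fun s : ℝ => f s - Polynomial.aeval (s * Complex.I) V) (𝓝 0) (𝓝 0) := by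
      refine hf.trans_tendsto ?_
      simpa [hr] using (continuous_pow (M := ℝ) r).tendsto 0
    have h2 := (continuous_aeval_mul_I V).tendsto 0
    rw [aeval_zero_mul_I] at h2
    simpa using h1.add h2
  have hmain : Tendsto (fun N : ℕ => Complex.exp (-(c * t ^ 2)) *
      Complex.exp (t ^ 2 * χ (t / √(N : ℝ))) * w (t / √(N : ℝ))) atTop
      (𝓝 (Complex.exp (-(c * t ^ 2)))) := by
    have h1 := ((((hlim hχ).comp hs).const_mul ((t : ℂ) ^ 2)).cexp.const_mul
      (Complex.exp (-(c * t ^ 2)))).mul ((hlim hw).comp hs)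
    rw [hX0, hW0, Complex.ofReal_zero, Complex.ofReal_one, mul_zero, Complex.exp_zero, mul_one,
      mul_one] at h1
    exact h1
  have hrem : Tendsto (fun N : ℕ => C₁ * N * ρ ^ N * |t / √(N : ℝ)|) atTop (𝓝 0) := by
    have h1 := (tendsto_pow_const_mul_const_pow_of_abs_lt_one 1
      (show |ρ| < 1 by rwa [abs_of_pos hρ])).const_mul C₁
    have h2 := h1.mul hs.abs
    simpa [mul_assoc] using h2
  have hzero : Tendsto (fun N : ℕ => Complex.exp (-((t / √(N : ℝ) : ℝ) * N * A * Complex.I)) *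
      φ N (t / √(N : ℝ)) - Complex.exp (-(c * t ^ 2)) *
      Complex.exp (t ^ 2 * χ (t / √(N : ℝ))) * w (t / √(N : ℝ))) atTop (𝓝 0) := by
    refine squeeze_zero_norm' ?_ hrem
    filter_upwards [hs.eventually hφ, hs.eventually hlam, eventually_ge_atTop 1] with N h1 h2 h3
    rw [← exp_mul_pow_eq h3 h2, mul_assoc _ (lam _ ^ N), ← mul_sub, norm_mul]
    have h4 : ‖Complex.exp (-((t / √(N : ℝ) : ℝ) * N * A * Complex.I))‖ = 1 := by
      have := norm_exp_real_mul_I (-(t / √(N : ℝ))) (N * A)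
      push_cast at this ⊢
      rw [← this]
      congr 2
      ring
    rw [h4, one_mul]
    exact h1 N h3
  simpa using hzero.add hmain

/-- With `s = t / √N`, three ranges are treated: `s ≤ δ` by the expansion, `δ < s ≤ K` by `hmid`,
and `s > K` by `hhigh`. `C₀` does not depend on `η` or `B`, so both can be chosen afterwards. The
remainder `D N` must be `o(N ^ (-r))`, since it is integrated over a range of length `B N ^ (r/2)`
and must stay `o(N ^ (-r/2))`. -/
lemma exists_fourier_bound (hc : 0 < c) (hρ : 0 < ρ) (hρ1 : ρ < 1) (hC₁ : 0 ≤ C₁) (hr : r ≠ 0)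
    (hX0 : X.coeff 0 = 0) (hW0 : W.coeff 0 = 1)
    (hφ : ∀ᶠ s in 𝓝 (0 : ℝ), ∀ N : ℕ, 1 ≤ N →
      ‖φ N s - lam s ^ N * w s‖ ≤ C₁ * N * ρ ^ N * |s|)
    (hlam : ∀ᶠ s in 𝓝 (0 : ℝ),
        lam s = Complex.exp (s * A * Complex.I - c * s ^ 2 + s ^ 2 * χ s))
    (hχ : (fun s : ℝ => χ s - Polynomial.aeval (s * Complex.I) X) =o[𝓝 0] fun s => s ^ r)
    (hw : (fun s : ℝ => w s - Polynomial.aeval (s * Complex.I) W) =o[𝓝 0] fun s => s ^ r)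
    (hmid : ∀ a b : ℝ, 0 < a → ∃ C ρ' : ℝ, 0 ≤ C ∧ 0 < ρ' ∧ ρ' < 1 ∧ ∀ s, a ≤ |s| → |s| ≤ b →
      ∀ N : ℕ, 1 ≤ N → ‖φ N s‖ ≤ C * ρ' ^ N)
    (hhigh : ∃ K C : ℝ, 0 ≤ C ∧ ∀ B : ℝ, ∀ᶠ N : ℕ in atTop, ∀ s, K ≤ |s| →
      |s| ≤ B * √(N : ℝ) ^ (r - 1) → ‖φ N s‖ ≤ C * ((N : ℝ) ^ (r + 1))⁻¹) :
    ∃ C₀ : ℝ, 0 ≤ C₀ ∧ ∀ η B : ℝ, 0 < η → ∃ D : ℕ → ℝ,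
      Tendsto (fun N : ℕ => (N : ℝ) ^ r * D N) atTop (𝓝 0) ∧ ∀ᶠ N : ℕ in atTop,
        ∀ t ∈ Set.Ioc 0 (B * √(N : ℝ) ^ r),
          ‖Complex.exp (-((t / √(N : ℝ) : ℝ) * N * A * Complex.I)) * φ N (t / √(N : ℝ)) -
            Complex.exp (-(c * t ^ 2)) * (1 + ∑ p ∈ Finset.Icc 1 r,
              Polynomial.aeval (t * Complex.I) (edgeworthSymbol X W r p) / (√(N : ℝ) : ℂ) ^ p)‖ ≤
          t * (η * (√(N : ℝ) ^ r)⁻¹ * (C₀ * Real.exp (-(c / 4) * t ^ 2)) + D N) := by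
  obtain ⟨C, hC, hexp⟩ := exists_expansion_bound hc hX0 hW0 hχ hw
  obtain ⟨G, hG0, hG⟩ := pow_le_const_mul_exp (r - 1) (show 0 < c / 4 by positivity)
  obtain ⟨Cg, hCg, hgauss⟩ := exists_norm_gaussian_symbol_le hc r (edgeworthSymbol X W r)
  obtain ⟨K, C₃, hC₃, hhigh⟩ := hhigh
  refine ⟨C * G, by positivity, fun η B hη => ?_⟩
  obtain ⟨δ, hδ, hball⟩ := Metric.nhds_basis_closedBall.eventually_iff.mp
    ((hexp η hη).and (hφ.and hlam))
  obtain ⟨C₂, ρ', hC₂, hρ', hρ1', hmid⟩ := hmid δ K hδ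
  set g := Real.exp (-(c / 2) * δ ^ 2) with hg
  have hg1 : g < 1 := by
    rw [hg, Real.exp_lt_one_iff, neg_mul]
    exact neg_neg_of_pos (by positivity)
  -- The first term is the spectral remainder for small `s`. The others bound `φ` on the middle and
  -- high ranges and the Gaussian side; there `t ≥ s > δ`, so the factor `δ⁻¹` supplies the required
  -- factor `t`.
  refine ⟨fun N => C₁ * N * ρ ^ N + δ⁻¹ * (C₂ * ρ' ^ N + C₃ * ((N : ℝ) ^ (r + 1))⁻¹ + Cg * g ^ N),
    ?_, ?_⟩
  · have t1 := (tendsto_pow_const_mul_const_pow_of_abs_lt_one (r + 1)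
      (show |ρ| < 1 by rwa [abs_of_pos hρ])).const_mul C₁
    have t2 := (tendsto_pow_const_mul_const_pow_of_abs_lt_one r
      (show |ρ'| < 1 by rwa [abs_of_pos hρ'])).const_mul (δ⁻¹ * C₂)
    have t3 := (tendsto_inv_atTop_nhds_zero_nat (𝕜 := ℝ)).const_mul (δ⁻¹ * C₃)
    have t4 := (tendsto_pow_const_mul_const_pow_of_abs_lt_one r
      (show |g| < 1 by rwa [abs_of_pos (Real.exp_pos _)])).const_mul (δ⁻¹ * Cg)
    have := ((t1.add t2).add t3).add t4
    simp only [mul_zero, add_zero] at this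
    refine this.congr' ?_
    filter_upwards [eventually_ge_atTop 1] with N hN
    have hN0 : (N : ℝ) ≠ 0 := by
      have : (0 : ℝ) < N := by exact_mod_cast hN
      exact this.ne'
    have : (N : ℝ)⁻¹ = (N : ℝ) ^ r * ((N : ℝ) ^ (r + 1))⁻¹ := by
      rw [pow_succ]
      field_simp
    rw [this]
    ring
  filter_upwards [hhigh B, eventually_ge_atTop 1] with N hhighN hN t ht
  have hN1 : (1 : ℝ) ≤ N := by exact_mod_cast hN
  have hy1 : 1 ≤ √(N : ℝ) := Real.one_le_sqrt.mpr hN1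
  set y := √(N : ℝ) with hy
  have hy0 : 0 < y := by linarith
  have ht0 := ht.1
  set s := t / y with hs
  have hs0 : 0 < s := by positivity
  have hst : s ≤ t := div_le_self ht0.le hy1
  have hphase : ‖Complex.exp (-((s : ℝ) * N * A * Complex.I))‖ = 1 := by
    have := norm_exp_real_mul_I (-s) (N * A)
    push_cast at this ⊢
    rw [← this]
    congr 2
    ring
  have hρN : 0 ≤ C₁ * N * ρ ^ N := by positivity
  have hg0 : 0 ≤ Cg * g ^ N := mul_nonneg hCg (pow_nonneg (Real.exp_pos _).le _)
  have h2N : 0 ≤ C₂ * ρ' ^ N := by positivity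
  have h3N : 0 ≤ C₃ * ((N : ℝ) ^ (r + 1))⁻¹ := by positivity
  rcases le_or_gt s δ with hsδ | hsδ
  · obtain ⟨h1, h2, h3⟩ := hball (show s ∈ Metric.closedBall 0 δ by
      rw [mem_closedBall_zero_iff, Real.norm_of_nonneg hs0.le]; exact hsδ)
    have hpow := exp_mul_pow_eq hN h3
    have h4 := h1 t
    rw [hs, sum_expansion_eq hX0 hW0, ← hs] at h4
    set S := (1 + ∑ p ∈ Finset.Icc 1 r,
      Polynomial.aeval (t * Complex.I) (edgeworthSymbol X W r p) / (y : ℂ) ^ p) with hS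
    have hsplit : Complex.exp (-((s : ℝ) * N * A * Complex.I)) * φ N s -
        Complex.exp (-(c * t ^ 2)) * S =
        Complex.exp (-((s : ℝ) * N * A * Complex.I)) * (φ N s - lam s ^ N * w s) +
        Complex.exp (-(c * t ^ 2)) * (Complex.exp (t ^ 2 * χ s) * w s - S) := by
      linear_combination w s * hpow
    have hE : ‖Complex.exp (-(c * t ^ 2))‖ = Real.exp (-(c / 2) * t ^ 2) *
        Real.exp (-(c / 2) * t ^ 2) := by
      rw [← Complex.ofReal_pow, ← Complex.ofReal_mul, ← Complex.ofReal_neg, Complex.norm_exp_ofReal,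
        ← Real.exp_add]
      congr 1
      ring
    have hEE : Real.exp (-(c / 2) * t ^ 2) * Real.exp (c / 2 * t ^ 2) = 1 := by
      rw [← Real.exp_add, ← Real.exp_zero]
      congr 1
      ring
    have hE4 : Real.exp (-(c / 2) * t ^ 2) * Real.exp (c / 4 * t ^ 2) =
        Real.exp (-(c / 4) * t ^ 2) := by
      rw [← Real.exp_add]
      congr 1
      ring
    -- One factor `t` is taken out of `|s| ^ r` to cancel the `1 / t` of Esseen's inequality; the
    -- rest is absorbed by the Gaussian.
    have hsr : |s| ^ r = t * t ^ (r - 1) * (y ^ r)⁻¹ := by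
      rw [abs_of_pos hs0, hs, div_pow, div_eq_mul_inv, mul_pow_sub_one hr]
    have htG : t ^ (r - 1) ≤ G * Real.exp (c / 4 * t ^ 2) := by
      have := hG t
      rwa [abs_of_pos ht0] at this
    have hA : ‖Complex.exp (-(c * t ^ 2)) * (Complex.exp (t ^ 2 * χ s) * w s - S)‖ ≤
        t * (η * (y ^ r)⁻¹ * (C * G * Real.exp (-(c / 4) * t ^ 2))) := by
      rw [norm_mul, hE]
      calc _ ≤ Real.exp (-(c / 2) * t ^ 2) * Real.exp (-(c / 2) * t ^ 2) *
            (η * |s| ^ r * (C * Real.exp (c / 2 * t ^ 2))) := by gcongr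
        _ = η * |s| ^ r * C * Real.exp (-(c / 2) * t ^ 2) *
            (Real.exp (-(c / 2) * t ^ 2) * Real.exp (c / 2 * t ^ 2)) := by ring
        _ = t * (η * (y ^ r)⁻¹ * (C * t ^ (r - 1) * Real.exp (-(c / 2) * t ^ 2))) := by
          rw [hEE, hsr]
          ring
        _ ≤ t * (η * (y ^ r)⁻¹ * (C * (G * Real.exp (c / 4 * t ^ 2)) *
            Real.exp (-(c / 2) * t ^ 2))) := by gcongr
        _ = _ := by
          rw [← hE4]
          ring
    have hB : ‖Complex.exp (-((s : ℝ) * N * A * Complex.I)) * (φ N s - lam s ^ N * w s)‖ ≤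
        t * (C₁ * N * ρ ^ N) := by
      rw [norm_mul, hphase, one_mul, mul_comm t]
      refine (h2 N hN).trans ?_
      rw [abs_of_pos hs0]
      gcongr
    rw [hsplit]
    refine (norm_add_le _ _).trans ((add_le_add hB hA).trans ?_)
    rw [← mul_add]
    refine mul_le_mul_of_nonneg_left ?_ ht0.le
    have : 0 ≤ δ⁻¹ * (C₂ * ρ' ^ N + C₃ * ((N : ℝ) ^ (r + 1))⁻¹ + Cg * g ^ N) := by positivity
    linarith
  · have h1 : ‖φ N s‖ ≤ C₂ * ρ' ^ N + C₃ * ((N : ℝ) ^ (r + 1))⁻¹ := by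
      rcases le_or_gt s K with hsK | hsK
      · have := hmid s (by rw [abs_of_pos hs0]; exact hsδ.le) (by rwa [abs_of_pos hs0]) N hN
        linarith
      · have hle : s ≤ B * y ^ (r - 1) := by
          rw [hs, div_le_iff₀ hy0, mul_assoc, pow_sub_one_mul hr]
          exact ht.2
        have := hhighN s (by rw [abs_of_pos hs0]; exact hsK.le) (by rwa [abs_of_pos hs0])
        linarith
    have h2 := hgauss y hy1 t
    -- From `s > δ` follows `t² ≥ δ² N`, so the Gaussian side is exponentially small in `N`.
    have h3 : Real.exp (-(c / 2) * t ^ 2) ≤ g ^ N := by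
      rw [hg, ← Real.exp_nat_mul, Real.exp_le_exp]
      have h4 : δ * y ≤ t := by
        rw [hs, lt_div_iff₀ hy0] at hsδ
        exact hsδ.le
      have h5 : (δ * y) ^ 2 ≤ t ^ 2 := by gcongr
      rw [mul_pow, hy, Real.sq_sqrt (by positivity)] at h5
      nlinarith
    have h4 : 1 ≤ t * δ⁻¹ := by
      rw [← div_eq_mul_inv, one_le_div hδ]
      linarith
    refine (norm_sub_le _ _).trans ?_
    rw [norm_mul, hphase, one_mul]
    have h6 : ‖φ N s‖ + ‖Complex.exp (-(c * t ^ 2)) * (1 + ∑ p ∈ Finset.Icc 1 r,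
        Polynomial.aeval (t * Complex.I) (edgeworthSymbol X W r p) / (y : ℂ) ^ p)‖ ≤
        C₂ * ρ' ^ N + C₃ * ((N : ℝ) ^ (r + 1))⁻¹ + Cg * g ^ N :=
      add_le_add h1 (h2.trans (by gcongr))
    have h7 : 0 ≤ η * (y ^ r)⁻¹ * (C * G * Real.exp (-(c / 4) * t ^ 2)) := by positivity
    calc _ ≤ 1 * (C₂ * ρ' ^ N + C₃ * ((N : ℝ) ^ (r + 1))⁻¹ + Cg * g ^ N) := by
          rw [one_mul]; exact h6
      _ ≤ t * δ⁻¹ * (C₂ * ρ' ^ N + C₃ * ((N : ℝ) ^ (r + 1))⁻¹ + Cg * g ^ N) := by gcongr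
      _ = t * (δ⁻¹ * (C₂ * ρ' ^ N + C₃ * ((N : ℝ) ^ (r + 1))⁻¹ + Cg * g ^ N)) := by ring
      _ ≤ _ := by
        refine mul_le_mul_of_nonneg_left ?_ ht0.le
        linarith

end Assembly

/-! ### Distribution of the normalised sum and the approximating density -/

section Law

variable {Ω : Type*} [MeasurableSpace Ω] {μ : Measure Ω} {X : ℕ → Ω → ℝ}

lemma aemeasurable_partialSum (hX : ∀ n, AEMeasurable (X n) μ) (N : ℕ) :
    AEMeasurable (partialSum X N) μ := by
  unfold partialSum
  exact Finset.aemeasurable_fun_sum _ fun n _ => hX n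

lemma aemeasurable_normalizedSum (hX : ∀ n, AEMeasurable (X n) μ) (A : ℝ) (N : ℕ) :
    AEMeasurable (normalizedSum X A N) μ := by
  unfold normalizedSum
  exact ((aemeasurable_partialSum hX N).sub_const _).div_const _

/-- The characteristic function of the partial sum `S_N`. -/
noncomputable def partialSumCharFun (μ : Measure Ω) (X : ℕ → Ω → ℝ) (N : ℕ) (t : ℝ) : ℂ :=
  ∫ ω, Complex.exp (Complex.I * t * partialSum X N ω) ∂μ

lemma partialSumCharFun_eq (hX : ∀ n, AEMeasurable (X n) μ) (N : ℕ) (t : ℝ) :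
    partialSumCharFun μ X N t = charFun (μ.map (partialSum X N)) t := by
  rw [charFun_apply_real, integral_map (aemeasurable_partialSum hX N)
    (by apply Continuous.aestronglyMeasurable; fun_prop), partialSumCharFun]
  congr 1 with ω
  congr 1
  ring

lemma charFun_normalizedSum (hX : ∀ n, AEMeasurable (X n) μ) (A : ℝ) (N : ℕ) (t : ℝ) :
    charFun (μ.map (normalizedSum X A N)) t =
      Complex.exp (-((t / √(N : ℝ) : ℝ) * N * A * Complex.I)) *
        partialSumCharFun μ X N (t / √(N : ℝ)) := by
  rw [charFun_apply_real, integral_map (aemeasurable_normalizedSum hX A N)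
    (by apply Continuous.aestronglyMeasurable; fun_prop), partialSumCharFun, ← integral_const_mul]
  congr 1 with ω
  rw [← Complex.exp_add]
  congr 1
  simp only [normalizedSum]
  push_cast
  ring

end Law

section Density

variable {v : NNReal}

/-- The density of the Edgeworth approximation with polynomials `q p` and scale `y = √N`. -/
noncomputable def edgeworthDensity (v : NNReal) (q : ℕ → Polynomial ℝ) (r : ℕ) (y x : ℝ) : ℝ :=
  gaussianPDFReal 0 v x + ∑ p ∈ Finset.Icc 1 r,
    (y ^ p)⁻¹ * ((gaussianDeriv v (q p)).eval x * gaussianPDFReal 0 v x)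

lemma integrable_edgeworthSum (hv : 0 < v) (q : ℕ → Polynomial ℝ) (r : ℕ) (y : ℝ) :
    Integrable fun x => ∑ p ∈ Finset.Icc 1 r,
      (y ^ p)⁻¹ * ((gaussianDeriv v (q p)).eval x * gaussianPDFReal 0 v x) :=
  integrable_finsetSum _ fun _ _ => (integrable_eval_mul_gaussianPDFReal hv _).const_mul _

lemma integrable_edgeworthDensity (hv : 0 < v) (q : ℕ → Polynomial ℝ) (r : ℕ) (y : ℝ) :
    Integrable (edgeworthDensity v q r y) :=
  (integrable_gaussianPDFReal 0 v).add (integrable_edgeworthSum hv q r y)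

lemma setIntegral_edgeworthDensity (hv : 0 < v) (q : ℕ → Polynomial ℝ) (r : ℕ) (y z : ℝ) :
    ∫ x in Set.Iic z, edgeworthDensity v q r y x =
      (∫ x in Set.Iic z, gaussianPDFReal 0 v x) +
        ∑ p ∈ Finset.Icc 1 r, (q p).eval z / y ^ p * gaussianPDFReal 0 v z := by
  simp only [edgeworthDensity]
  rw [integral_add (integrable_gaussianPDFReal 0 v).integrableOn
    (integrable_edgeworthSum hv q r y).integrableOn, integral_finsetSum _ fun p _ =>
    ((integrable_eval_mul_gaussianPDFReal hv _).const_mul _).integrableOn]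
  congr 1
  refine Finset.sum_congr rfl fun p _ => ?_
  rw [integral_const_mul, setIntegral_gaussianDeriv hv]
  ring

/-- The bound is uniform over `y = √N ≥ 1`, so the truncation point in Esseen's inequality can be
chosen with a constant independent of `N`. -/
lemma exists_abs_edgeworthDensity_le (hv : 0 < v) (q : ℕ → Polynomial ℝ) (r : ℕ) :
    ∃ m : ℝ, 0 ≤ m ∧ ∀ y : ℝ, 1 ≤ y → ∀ x, |edgeworthDensity v q r y x| ≤ m := by
  obtain ⟨m₀, hm₀, H₀⟩ := exists_abs_eval_mul_gaussianPDFReal_le_const hv 1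
  choose G hG0 hG using fun p =>
    exists_abs_eval_mul_gaussianPDFReal_le_const hv (gaussianDeriv v (q p))
  refine ⟨m₀ + ∑ p ∈ Finset.Icc 1 r, G p,
    add_nonneg hm₀ (Finset.sum_nonneg fun _ _ => hG0 _), fun y hy x => ?_⟩
  refine (abs_add_le _ _).trans (add_le_add (by simpa using H₀ x)
    ((Finset.abs_sum_le_sum_abs _ _).trans (Finset.sum_le_sum fun p _ => ?_)))
  have hyp : 1 ≤ y ^ p := one_le_pow₀ hy
  rw [abs_mul, abs_of_nonneg (by positivity)]
  exact (mul_le_of_le_one_left (abs_nonneg _) (inv_le_one_of_one_le₀ hyp)).trans (hG p x)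

lemma weightedCharFun_edgeworthDensity (hv : 0 < v) {a : ℕ → Polynomial ℝ}
    (ha : ∀ p, p ≠ 0 → (a p).coeff 0 = 0) (r : ℕ) (y t : ℝ) :
    weightedCharFun volume (edgeworthDensity v (fun p => inverseSymbol v (a p)) r y) t =
      Complex.exp (-((v / 2 : ℝ) * t ^ 2)) *
        (1 + ∑ p ∈ Finset.Icc 1 r, Polynomial.aeval (t * Complex.I) (a p) / (y : ℂ) ^ p) := by
  change weightedCharFun volume (fun x => gaussianPDFReal 0 v x + ∑ p ∈ Finset.Icc 1 r,
    (y ^ p)⁻¹ * ((gaussianDeriv v (inverseSymbol v (a p))).eval x * gaussianPDFReal 0 v x)) t = _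
  rw [weightedCharFun_add (integrable_gaussianPDFReal 0 v) (integrable_edgeworthSum hv _ r y),
    weightedCharFun_sum _ fun p _ => (integrable_eval_mul_gaussianPDFReal hv _).const_mul _,
    weightedCharFun_gaussianPDFReal hv, mul_add, mul_one, Finset.mul_sum]
  have h1 : -((v : ℂ) * t ^ 2 / 2) = -(((v / 2 : ℝ) : ℂ) * t ^ 2) := by
    push_cast
    ring
  congr 1
  · rw [← h1]
  refine Finset.sum_congr rfl fun p hp => ?_
  rw [weightedCharFun_const_mul, weightedCharFun_gaussianDeriv_inverseSymbol hv
    (ha p (by have := (Finset.mem_Icc.mp hp).1; omega)), h1]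
  push_cast
  ring

end Density

lemma natCast_rpow_half (N p : ℕ) : (N : ℝ) ^ ((p : ℝ) / 2) = √(N : ℝ) ^ p := by
  rw [Real.sqrt_eq_rpow, ← Real.rpow_natCast, ← Real.rpow_mul (Nat.cast_nonneg N)]
  congr 1
  ring

/-- A sufficiently good Fourier bound yields the Edgeworth expansion. -/
theorem admitsEdgeworthExpansion_of_fourier_bound {Ω : Type*} [MeasurableSpace Ω] {μ : Measure Ω}
    [IsProbabilityMeasure μ] {X : ℕ → Ω → ℝ} (hX : ∀ n, AEMeasurable (X n) μ) {A : ℝ} {v : NNReal}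
    (hv : 0 < v) {r : ℕ} {a : ℕ → Polynomial ℝ} (ha : ∀ p, p ≠ 0 → (a p).coeff 0 = 0) {C₀ b : ℝ}
    (hC₀ : 0 ≤ C₀) (hb : 0 < b)
    (h : ∀ η B : ℝ, 0 < η → ∃ D : ℕ → ℝ,
      Tendsto (fun N : ℕ => (N : ℝ) ^ r * D N) atTop (𝓝 0) ∧ ∀ᶠ N : ℕ in atTop,
        ∀ t ∈ Set.Ioc 0 (B * √(N : ℝ) ^ r),
          ‖charFun (μ.map (normalizedSum X A N)) t -
            Complex.exp (-((v / 2 : ℝ) * t ^ 2)) * (1 + ∑ p ∈ Finset.Icc 1 r,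
              Polynomial.aeval (t * Complex.I) (a p) / (√(N : ℝ) : ℂ) ^ p)‖ ≤
          t * (η * (√(N : ℝ) ^ r)⁻¹ * (C₀ * Real.exp (-b * t ^ 2)) + D N)) :
    AdmitsEdgeworthExpansion μ X A v r := by
  set q : ℕ → Polynomial ℝ := fun p => inverseSymbol v (a p) with hq
  refine ⟨q, fun ε hε => ?_⟩
  obtain ⟨C, hC, hesseen⟩ := exists_esseen_bound
  obtain ⟨m, hm, hbdd⟩ := exists_abs_edgeworthDensity_le hv q r
  have hgi : Integrable fun t : ℝ => Real.exp (-b * t ^ 2) := integrable_exp_neg_mul_sq hb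
  set J := ∫ t : ℝ, Real.exp (-b * t ^ 2) with hJ
  have hJ0 : 0 ≤ J := integral_nonneg fun t => (Real.exp_pos _).le
  -- The error `ε` is split into thirds: `B` makes the smoothing term `m / T` small, `η` the
  -- Gaussian integral, and large `N` the contribution of `D N`. The summands `1` in `B` and in `η`
  -- prevent division by zero.
  set B := 3 * C * m / ε + 1 with hB
  have hB0 : 0 < B := by positivity
  have hBm : C * (m / B) ≤ ε / 3 := by
    rw [← mul_div_assoc, div_le_iff₀ hB0, hB]
    have : ε / 3 * (3 * C * m / ε + 1) = C * m + ε / 3 := by field_simp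
    rw [this]
    linarith
  set η := ε / (3 * C * (C₀ * J + 1)) with hη
  have hη0 : 0 < η := by positivity
  have hηJ : C * (η * (C₀ * J)) ≤ ε / 3 := by
    have : C * (η * (C₀ * J + 1)) = ε / 3 := by
      rw [hη]
      field_simp
    nlinarith
  obtain ⟨D, hD, hev⟩ := h η B hη0
  have hDs : ∀ᶠ N : ℕ in atTop, (N : ℝ) ^ r * D N < ε / (3 * C * B) :=
    hD.eventually_lt_const (by positivity)
  filter_upwards [hev, hDs, eventually_ge_atTop 1] with N hN hDN hN1 z
  have hN1' : (1 : ℝ) ≤ N := by exact_mod_cast hN1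
  have hy1 : 1 ≤ √(N : ℝ) := Real.one_le_sqrt.mpr hN1'
  have hyy : √(N : ℝ) ^ r * √(N : ℝ) ^ r = (N : ℝ) ^ r := by
    rw [← mul_pow, Real.mul_self_sqrt (by positivity)]
  have hrhs : (N : ℝ) ^ (-(r : ℝ) / 2) = (√(N : ℝ) ^ r)⁻¹ := by
    rw [neg_div, Real.rpow_neg (by positivity), natCast_rpow_half]
  simp only [natCast_rpow_half]
  rw [hrhs]
  set y := √(N : ℝ) with hy
  have hyr : 0 < y ^ r := by positivity
  have hprob : IsProbabilityMeasure (μ.map (normalizedSum X A N)) :=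
    Measure.isProbabilityMeasure_map (aemeasurable_normalizedSum hX A N)
  set T := B * y ^ r with hT
  have hT0 : 0 < T := by positivity
  set f : ℝ → ℝ := fun t => η * (y ^ r)⁻¹ * (C₀ * Real.exp (-b * t ^ 2)) + D N with hf
  have hfi : ∀ t₁ t₂ : ℝ, IntervalIntegrable f volume t₁ t₂ := fun t₁ t₂ => by
    apply Continuous.intervalIntegrable
    fun_prop
  have key := hesseen (μ.map (normalizedSum X A N)) (edgeworthDensity v q r y) m T f
    (integrable_edgeworthDensity hv q r y) (hbdd y hy1) hT0 (hfi 0 T) (fun t ht => by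
      rw [hq, weightedCharFun_edgeworthDensity hv ha]
      exact hN t ht) z
  have hF : (μ.map (normalizedSum X A N)).real (Set.Iic z) =
      μ.real {ω | normalizedSum X A N ω ≤ z} := by
    rw [map_measureReal_apply_of_aemeasurable (aemeasurable_normalizedSum hX A N) measurableSet_Iic]
    rfl
  rw [hF, setIntegral_edgeworthDensity hv, ← sub_sub] at key
  refine key.trans ?_
  have hint : ∫ t in (0 : ℝ)..T, f t ≤ η * (y ^ r)⁻¹ * (C₀ * J) + T * D N := by
    rw [hf, intervalIntegral.integral_add (by apply Continuous.intervalIntegrable; fun_prop)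
      (by simp), intervalIntegral.integral_const_mul, intervalIntegral.integral_const_mul,
      intervalIntegral.integral_const, sub_zero, smul_eq_mul]
    have : ∫ t in (0 : ℝ)..T, Real.exp (-b * t ^ 2) ≤ J := by
      rw [intervalIntegral.integral_of_le hT0.le]
      exact setIntegral_le_integral hgi (ae_of_all _ fun t => (Real.exp_pos _).le)
    gcongr
  have hTD : C * (T * D N) ≤ ε / 3 * (y ^ r)⁻¹ := by
    have h1 : T * D N = B * ((N : ℝ) ^ r * D N) * (y ^ r)⁻¹ := by
      rw [hT, ← hyy]
      field_simp
    have h2 : C * (B * ((N : ℝ) ^ r * D N)) ≤ ε / 3 := by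
      have := (lt_div_iff₀ (by positivity)).mp hDN
      linarith
    rw [h1, ← mul_assoc]
    gcongr
  have hmT : C * (m / T) ≤ ε / 3 * (y ^ r)⁻¹ := by
    have : m / T = m / B * (y ^ r)⁻¹ := by
      rw [hT]
      field_simp
    rw [this, ← mul_assoc]
    gcongr
  have hJJ : C * (η * (y ^ r)⁻¹ * (C₀ * J)) ≤ ε / 3 * (y ^ r)⁻¹ := by
    have : C * (η * (y ^ r)⁻¹ * (C₀ * J)) = C * (η * (C₀ * J)) * (y ^ r)⁻¹ := by ring
    rw [this]
    gcongr
  have := mul_le_mul_of_nonneg_left hint hC.le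
  linarith

section PartialSumCharFun

variable {Ω : Type*} [MeasurableSpace Ω] {μ : Measure Ω} {X : ℕ → Ω → ℝ}

lemma partialSumCharFun_neg (hX : ∀ n, AEMeasurable (X n) μ) (N : ℕ) (t : ℝ) :
    partialSumCharFun μ X N (-t) = starRingEnd ℂ (partialSumCharFun μ X N t) := by
  rw [partialSumCharFun_eq hX, partialSumCharFun_eq hX, charFun_neg]

variable [IsProbabilityMeasure μ]

lemma partialSumCharFun_zero (N : ℕ) : partialSumCharFun μ X N 0 = 1 := by
  simp [partialSumCharFun]

lemma norm_partialSumCharFun_le_one (hX : ∀ n, AEMeasurable (X n) μ) (N : ℕ) (t : ℝ) :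
    ‖partialSumCharFun μ X N t‖ ≤ 1 := by
  have := Measure.isProbabilityMeasure_map (aemeasurable_partialSum hX N)
  rw [partialSumCharFun_eq hX]
  exact norm_charFun_le_one t

/-- Lévy's continuity theorem; `σ2 = 0` is included. -/
lemma tendstoInDistribution_normalizedSum (hX : ∀ n, AEMeasurable (X n) μ) {A : ℝ} {σ2 : NNReal}
    (h : ∀ t : ℝ, Tendsto (fun N : ℕ => charFun (μ.map (normalizedSum X A N)) t) atTop
      (𝓝 (Complex.exp (-((σ2 / 2 : ℝ) * t ^ 2))))) :
    TendstoInDistribution (fun N : ℕ => normalizedSum X A N) atTop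
      (id : ℝ → ℝ) (fun _ => μ) (gaussianReal 0 σ2) where
  forall_aemeasurable := aemeasurable_normalizedSum hX A
  aemeasurable_limit := aemeasurable_id
  tendsto := by
    refine ProbabilityMeasure.tendsto_of_tendsto_charFun fun t => ?_
    simp only [ProbabilityMeasure.coe_mk, Measure.map_id, charFun_gaussianReal]
    convert h t using 2
    congr 1
    push_cast
    ring

end PartialSumCharFun

section OperatorBounds

variable {E : Type*} [NormedAddCommGroup E] [NormedSpace ℂ E]

lemma norm_apply_apply_le (l : E →L[ℂ] ℂ) (T : E →L[ℂ] E) (v : E) :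
    ‖l (T v)‖ ≤ ‖l‖ * ‖v‖ * ‖T‖ := by
  calc ‖l (T v)‖ ≤ ‖l‖ * (‖T‖ * ‖v‖) := l.le_opNorm_of_le (T.le_opNorm v)
    _ = ‖l‖ * ‖v‖ * ‖T‖ := by ring

lemma AssumptionA1.contDiffAt {L : ℝ → E →L[ℂ] E} {s : ℕ} (h : AssumptionA1 L s) :
    ContDiffAt ℝ s L 0 := by
  obtain ⟨-, δ, hδ, hL⟩ := h
  exact hL.contDiffAt (mem_of_superset (Metric.ball_mem_nhds 0 hδ) fun x hx => by
    simpa using (mem_ball_zero_iff.mp hx).le)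

end OperatorBounds

-- The main theorem

end Edgeworth

open Edgeworth

theorem mainTheorem1
    {Ω : Type*} [MeasurableSpace Ω] (μ : Measure Ω) [IsProbabilityMeasure μ]
    (X : ℕ → Ω → ℝ) (hX : ∀ n, AEMeasurable (X n) μ)
    {E : Type*} [NormedAddCommGroup E] [NormedSpace ℂ E] [CompleteSpace E]
    (L : ℝ → E →L[ℂ] E) (v : E) (l : E →L[ℂ] ℂ)
    (hchar : ∀ N : ℕ, 1 ≤ N → ∀ t : ℝ,
      ∫ ω, Complex.exp (Complex.I * t * Edgeworth.partialSum X N ω) ∂μ = l ((L t ^ N) v))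
    (r : ℕ) (hr : 2 ≤ r)
    (hA1 : Edgeworth.AssumptionA1 L (r + 2))
    (hA2 : Edgeworth.AssumptionA2 L)
    (hA3 : Edgeworth.AssumptionA3 L)
    (r₁ : ℝ) (hr₁ : ((r : ℝ) - 1) / 2 < r₁)
    (hA4 : Edgeworth.AssumptionA4 L r₁) :
    ∃ (A : ℝ) (σ2 : NNReal),
      TendstoInDistribution (fun N : ℕ => Edgeworth.normalizedSum X A N) atTop
          (id : ℝ → ℝ) (fun _ => μ) (gaussianReal 0 σ2) ∧
        (0 < σ2 → Edgeworth.AdmitsEdgeworthExpansion μ X A σ2 r) := by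
  have hr0 : r ≠ 0 := by omega
  have hφ : ∀ N : ℕ, 1 ≤ N → ∀ t, partialSumCharFun μ X N t = l ((L t ^ N) v) := hchar
  obtain ⟨lam, w, C, ρ, hlam, hw, hlam0, hC, hρ, hρ1, hexp⟩ :=
    exists_spectral_expansion (by omega) hA1.contDiffAt hA2 v l
  have hexp₁ : ∀ᶠ s in 𝓝 (0 : ℝ), ∀ N : ℕ,
      ‖partialSumCharFun μ X (N + 1) s - lam s ^ (N + 1) * w s‖ ≤ C * ρ ^ N :=
    hexp.mono fun s hs N => by
      rw [hφ _ N.succ_pos]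
      exact (hs N).1
  have hw0 : w 0 = 1 := eq_one_of_expansion hρ hρ1 hlam0 partialSumCharFun_zero hexp₁
  -- At `s = 0` the remainder is zero, since `φ N 0 = 1 = w 0`; the comparison with `s = 0`
  -- therefore bounds the remainder itself. Passing from `k` to `N = k + 1` costs the factor `1 /
  -- ρ`.
  have hexp₂ : ∀ᶠ s in 𝓝 (0 : ℝ), ∀ N : ℕ, 1 ≤ N →
      ‖partialSumCharFun μ X N s - lam s ^ N * w s‖ ≤ C / ρ * N * ρ ^ N * |s| := by
    filter_upwards [hexp] with s hs N hN
    obtain ⟨k, rfl⟩ := Nat.exists_eq_add_of_le' hN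
    have h := (hs k).2
    rw [← hφ _ hN, ← hφ _ hN, partialSumCharFun_zero, hw0, sub_self, sub_zero] at h
    refine h.trans_eq ?_
    rw [pow_succ]
    push_cast
    field_simp
  obtain ⟨A, c, P, W, χ, hc, hP0, hW0, hlamexp, hχ, hwexp⟩ :=
    exists_cumulant_expansion hr0 hlam hw hlam0 hw0
      (eventually_conj_of_expansion hρ hρ1 hlam.continuousAt hw.continuousAt hlam0 hw0
        (partialSumCharFun_neg hX) hexp₁)
      (eventually_norm_le_one_of_expansion hρ hρ1 hC hw.continuousAt hw0
        (norm_partialSumCharFun_le_one hX) hexp₁)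
  -- The quadratic term `-c s²` of `log λ` is `-σ² s² / 2`.
  obtain ⟨σ2, hσ2⟩ : ∃ σ2 : NNReal, (σ2 : ℝ) = 2 * c := ⟨⟨2 * c, by positivity⟩, rfl⟩
  have hv : (σ2 / 2 : ℝ) = c := by
    rw [hσ2]
    ring
  refine ⟨A, σ2, tendstoInDistribution_normalizedSum hX fun t => ?_,
    fun hpos => ?_⟩
  · rw [hv]
    simp only [charFun_normalizedSum hX]
    exact tendsto_gaussian_of_expansion hρ hρ1 hr0 hP0 hW0 hexp₂ hlamexp hχ hwexp t
  · have hc0 : 0 < c := by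
      have : (0 : ℝ) < 2 * c := hσ2 ▸ NNReal.coe_pos.mpr hpos
      linarith
    obtain ⟨C₀, hC₀, hbound⟩ := exists_fourier_bound (φ := partialSumCharFun μ X) hc0 hρ hρ1
      (by positivity) hr0 hP0 hW0 hexp₂ hlamexp hχ hwexp
      (fun a b ha => by
        obtain ⟨C', ρ', hC', hρ', hρ1', H⟩ := exists_pow_norm_le_of_isCompact hA1.1 hA3
          (S := {s : ℝ | |s| ≤ b} ∩ {s | a ≤ |s|})
          ((by simpa [Metric.closedBall, Real.dist_eq] using isCompact_closedBall (0 : ℝ) b :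
            IsCompact {s : ℝ | |s| ≤ b}).inter_right (isClosed_le continuous_const continuous_abs))
          (fun h0 => by simpa [ha.not_ge] using h0.2)
        refine ⟨‖l‖ * ‖v‖ * C', ρ', by positivity, hρ', hρ1', fun s has hsb N hN => ?_⟩
        rw [hφ N hN, mul_assoc]
        exact (norm_apply_apply_le l _ v).trans
          (mul_le_mul_of_nonneg_left (H s ⟨hsb, has⟩ N) (by positivity)))
      (by
        obtain ⟨K, -, H⟩ := exists_eventually_pow_norm_le hA4
        refine ⟨K, ‖l‖ * ‖v‖, by positivity, fun B => ?_⟩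
        -- The exponent is `q = (r - 1) / 2`, as `√N ^ (r - 1) = N ^ ((r - 1) / 2)`; this is where
        -- `r₁ > (r - 1) / 2` enters.
        filter_upwards [H B _ (r + 1) hr₁, eventually_ge_atTop 1] with N hN hN1 s hKs hsB
        rw [hφ N hN1]
        refine (norm_apply_apply_le l _ v).trans
          (mul_le_mul_of_nonneg_left (hN s hKs ?_) (by positivity))
        rwa [← natCast_rpow_half, Nat.cast_sub (by omega), Nat.cast_one] at hsB)
    refine admitsEdgeworthExpansion_of_fourier_bound hX hpos
      (fun p hp => edgeworthSymbol_coeff_zero P W r hp) hC₀ (b := c / 4) (by positivity) ?_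
    simp only [hv, charFun_normalizedSum hX]
    exact hbound
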